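/- Let $q$ be a power of an odd prime, $\mathbb F_q$ the field with $q$ elements, and let $\theta:(\mathbb F_q,+)\to\mathbb C^*$ be a fixed nontrivial linear character. Fix a type $\mathfrak B_n,\mathfrak C_n$ or $\mathfrak D_n$; put $N=2n+1,\ \tilde n=n+1$ for type $\mathfrak B_n$ and $N=2n,\ \tilde n=n$ for types $\mathfrak C_n,\mathfrak D_n$. For $1\le i\le N$ let $\bar i=N+1-i$, and let $S=\sum_{i\le n}e_{i\bar i}+\sum_{i>n}\epsilon\, e_{i\bar i}$ with $\epsilon=-1$ for type $\mathfrak C_n$ and $\epsilon=1$ otherwise. Let $\widetilde U=U_N(q)$ be the group of upper unitriangular matrices and $U=\{u\in\widetilde U: u^tSu=S\}$. **Positions and modules.** Let $P=\{(i,j): i<j<\bar i\}$ for types $\mathfrak B_n,\mathfrak D_n$ and $P=\{(i,j): i<j\le\bar i\}$ for type $\mathfrak C_n$. Let $P^{l}$ and $P^{r}$ be the sets of $(i,j)\in P$ with $j\le\tilde n$ and with $j>\tilde n$, respectively. Let $V$ be the space of $N\times N$-matrices over $\mathbb F_q$ supported in $P$, let $\pi$ be the map from all matrices to $V$ that sets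 the entries outside $P$ to zero, and let $\kappa(A,B)=\operatorname{tr}(A^tB)$. Then $\widetilde U$ acts on $V$ from the right by $A.u=\pi(Au)$. For $A\in V$ let $[A]$ be the linear character $B\mapsto\theta(-\kappa(A,B))$ of $(V,+)$, and let $\hat V=\{[A]: A\in V\}$ be the basis of $\mathbb C^V$ consisting of all linear characters of $(V,+)$. The group $\widetilde U$ acts on $\hat V$ by $(\chi.u)(B)=\chi(B.u^{-1})$, and $\mathbb C^V$ is a right $\mathbb C\widetilde U$-module by the monomial action $\chi u=\chi(\pi(u^{-1}))\,\chi.u$ for $\chi\in\hat V$. For $A\in V$ let $\mathcal O_A=\{[A].u: u\in U\}$ and $\widetilde{\mathcal O}_A=\{[A].u: u\in\widetilde U\}$. Their spans $\mathbb C\mathcal O_A$ and $\mathbb C\widetilde{\mathcal O}_A$ are modules for $U$ and $\widetilde U$, respectively. **Cores.** For $A\in V$ let $\operatorname{main}(A)$ be the set of *main conditions*, the positions of the rightmost nonzero entries of the nonzero rows of $A$. Let $\operatorname{verge}(A)=\sum_{(i,j)\in\operatorname{main}(A)}A_{ij}e_{ij}$, and let $\mathbb C\mathcal V(A)$ be the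 span of all $[B]$ with $\operatorname{verge}(B)=\operatorname{verge}(A)$. The character $[A]$ is a *verge* if $\operatorname{verge}(A)=A$, and it is *staircase* if its main conditions lie in different columns. The *minor conditions* are the positions $(i,\bar j)$ with $(i,j)\in\operatorname{main}(A)\cap P^{r}$. The *supplementary conditions* are the positions in $P^{l}$ that lie to the left, in the same row, of a minor condition or of a main condition in $P^{l}$, that lie in the column of some minor condition, and that are neither main nor minor conditions. The core set of $A$ consists of the main and supplementary conditions and, for types $\mathfrak B_n,\mathfrak D_n$, also of the minor conditions. $[A]$ is a *core* if it is staircase and $A$ is supported in its core set. The *leg* at $(i,j)\in P$ is $\{(a,j)\in P: a>i\}$. The *arm* at $(i,j)$ is $\{(\bar j,a)\in P\}$ if $j\neq\bar i$, and $\{(i,a): i<a<\bar i\}$ if $j=\bar i$. $[A]$ is *main separated* if no main condition of $A$ lies on the leg or the arm of a main condition of $A$. **Supercharacters.** For $(i,j)\in P$ and $\alpha\in\mathbb F_q$ the root element $x_{ij}(\alpha)\in U$ is - $1+\alpha e_{i\bar i}$ if $j=\bar i$; - $1+\alpha e_{i,n+1}-\alpha e_{n+1,\bar i}-\frac12\alpha^2e_{i\bar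 i}$ for type $\mathfrak B_n$ and $j=n+1$; - $1+\alpha e_{ij}+\alpha e_{\bar j\bar i}$ for type $\mathfrak C_n$ and $n<j<\bar i$; - $1+\alpha e_{ij}-\alpha e_{\bar j\bar i}$ otherwise. Let $\varrho_{ij}=\{(i,k)\in P: k<j\}$ if $j\le\tilde n$, and $\varrho_{ij}=\{(i,k)\in P: k\le n\}\cup\{(\bar j,l)\in P: l\le\tilde n\}$ if $j>\tilde n$. Let $U_{ij}$ be the subgroup of $U$ generated by all $x_{kl}(\beta)$ with $(k,l)\in P\setminus\varrho_{ij}$ and $\beta\in\mathbb F_q$. For $\alpha\in\mathbb F_q^*$ the *elementary character* $\xi^{ij}_\alpha$ of $U$ is induced from the linear character $u\mapsto\theta(\alpha u_{ij})$ of $U_{ij}$. A set $\mathcal D$ of positions $(i,j)$, $1\le i<j\le N$, is *basic* if it is stable under $(i,j)\mapsto(\bar j,\bar i)$ and contains at most one position of each row and of each column. For a map $\Phi:\mathcal D\cap P\to\mathbb F_q^*$ the *André–Neto supercharacter* is $\xi_{\mathcal D,\Phi}=\prod_{(i,j)\in\mathcal D\cap P}\xi^{ij}_{\Phi(i,j)}$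 (an empty product is the trivial character). The *André–Neto module* is the $\mathbb C\widetilde U$-module $\bigotimes_{(i,j)\in\mathcal D\cap P}\mathbb C\widetilde{\mathcal O}_{\Phi(i,j)e_{ij}}$ with the diagonal action. **Theorem.** Let $\mathcal D$ be a nonempty basic set, let $\Phi:\mathcal D\cap P\to\mathbb F_q^*$ be a map, and set $A=\sum_{(i,j)\in\mathcal D\cap P}\Phi(i,j)e_{ij}\in V$. 1. If $j\neq\bar i$ for all $(i,j)\in\mathcal D\cap P$, then $\xi_{\mathcal D,\Phi}$ is afforded by the restriction of $\mathbb C\widetilde{\mathcal O}_A$ to $U$. If $(i,\bar i)\in\mathcal D$ for some $i$, then $\xi_{\mathcal D,\Phi}$ is afforded by a direct summand of this restriction. 2. $[A]$ is a main separated verge, and every core $[B]$ with $\operatorname{verge}(B)=A$ is main separated. 3. $\widetilde{\mathcal O}_A$ is the disjoint union of the $U$-orbits $\mathcal O_B$, where $[B]$ runs through the cores with $\operatorname{verge}(B)=A$. 4. As $\mathbb CU$-modules, $$\operatorname{Res}^{\widetilde U}_U(\mathbb C\widetilde{\mathcal O}_A)=\mathbb C\mathcal V(A)=\bigoplus_{\text{cores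 }[B],\ \operatorname{verge}(B)=A}\mathbb C\mathcal O_B ,$$ and $\mathbb C\widetilde{\mathcal O}_A$ is isomorphic, as a $\mathbb C\widetilde U$-module, to the André–Neto module of $(\mathcal D,\Phi)$. -/

import Mathlib

namespace ClassicalUnipotent

open MulOpposite

/-! ### The classical types, positions, and the Sylow subgroup `U` -/

/-- The untwisted classical types. -/
inductive ClassicalType
  | B
  | C
  | D
  deriving DecidableEq

/-- The size `N` of the matrices: `2n+1` in type `B`, and `2n` in types `C` and `D`. -/
def dimN (T : ClassicalType) (n : ℕ) : ℕ :=
  match T with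
  | .B => 2 * n + 1
  | .C => 2 * n
  | .D => 2 * n

/-- The number `ñ`: `n+1` in type `B`, and `n` in types `C` and `D`. -/
def tildeN (T : ClassicalType) (n : ℕ) : ℕ :=
  match T with
  | .B => n + 1
  | .C => n
  | .D => n

/-- Positions of an `N × N` matrix. Rows and columns are numbered from `0`, so that the mirror map
`i ↦ N + 1 - i` of the numbering from `1` is `Fin.rev`. -/
abbrev Pos (T : ClassicalType) (n : ℕ) : Type := Fin (dimN T n) × Fin (dimN T n)

/-- The positions strictly above the diagonal and strictly to the left of the antidiagonal, with
the upper half of the antidiagonal added in type `C` (the positive roots). -/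
def pUP (T : ClassicalType) (n : ℕ) : Finset (Pos T n) :=
  Finset.univ.filter fun p =>
    p.1 < p.2 ∧ (p.2 < p.1.rev ∨ (T = ClassicalType.C ∧ p.2 = p.1.rev))

/-- The positions of `pUP` in the columns `1, …, ñ`. -/
def tril (T : ClassicalType) (n : ℕ) : Finset (Pos T n) :=
  (pUP T n).filter fun p => p.2.val < tildeN T n

/-- The positions of `pUP` in the columns `ñ + 1, …, N`. -/
def trir (T : ClassicalType) (n : ℕ) : Finset (Pos T n) :=
  (pUP T n).filter fun p => tildeN T n ≤ p.2.val

/-- The group `U_N(F)` of upper unitriangular matrices. -/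
def unitriangular (N : ℕ) (F : Type*) [Field F] : Subgroup (GL (Fin N) F) where
  carrier := {g | (∀ i j, j < i → (g : Matrix (Fin N) (Fin N) F) i j = 0) ∧
    ∀ i, (g : Matrix (Fin N) (Fin N) F) i i = 1}
  one_mem' := by
    refine ⟨fun i j h => ?_, fun i => ?_⟩
    · simp [Matrix.one_apply_ne h.ne']
    · simp
  mul_mem' := by
    rintro a b ⟨ha, ha'⟩ ⟨hb, hb'⟩
    refine ⟨fun i j h => ?_, fun i => ?_⟩
    · rw [Units.val_mul, Matrix.mul_apply]
      refine Finset.sum_eq_zero fun k _ => ?_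
      rcases lt_or_ge k i with hk | hk
      · rw [ha i k hk, zero_mul]
      · rw [hb k j (lt_of_lt_of_le h hk), mul_zero]
    · rw [Units.val_mul, Matrix.mul_apply, Finset.sum_eq_single i]
      · rw [ha', hb', one_mul]
      · intro k _ hk
        rcases lt_or_gt_of_ne hk with hk | hk
        · rw [ha i k hk, zero_mul]
        · rw [hb k i hk, mul_zero]
      · simp
  inv_mem' := by
    rintro a ⟨ha, ha'⟩
    have htri : Matrix.BlockTriangular (a : Matrix (Fin N) (Fin N) F) id := fun i j h => ha i j h
    have : Invertible (a : Matrix (Fin N) (Fin N) F) := a.isUnit.invertible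
    have hinv := Matrix.blockTriangular_inv_of_blockTriangular htri
    have hinv' : ∀ i j, j < i → ((a⁻¹ : GL (Fin N) F) : Matrix (Fin N) (Fin N) F) i j = 0 := by
      intro i j h
      rw [Matrix.coe_units_inv]
      exact hinv h
    refine ⟨hinv', fun i => ?_⟩
    have h1 : ((a : Matrix (Fin N) (Fin N) F) *
        ((a⁻¹ : GL (Fin N) F) : Matrix (Fin N) (Fin N) F)) i i = 1 := by
      rw [← Units.val_mul, mul_inv_cancel, Units.val_one, Matrix.one_apply_eq]
    rw [Matrix.mul_apply, Finset.sum_eq_single i] at h1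
    · rwa [ha', one_mul] at h1
    · intro k _ hk
      rcases lt_or_gt_of_ne hk with hk | hk
      · rw [ha i k hk, zero_mul]
      · rw [hinv' k i hk, mul_zero]
    · simp

variable (T : ClassicalType) (n : ℕ) (F : Type*) [Field F]

/-- The square matrices of size `N`. -/
abbrev Mat : Type _ := Matrix (Fin (dimN T n)) (Fin (dimN T n)) F

/-- The overlying unitriangular group `Ũ = U_N(F)`. -/
abbrev TU : Type _ := unitriangular (dimN T n) F

/-- The Gram matrix `S` of the symmetric (types `B`, `D`) or symplectic (type `C`) form. -/
def gram : Mat T n F :=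
  Matrix.of fun i j =>
    if j = i.rev then (if T = ClassicalType.C ∧ n ≤ i.val then -1 else 1) else 0

variable {T n F}

/-- The underlying matrix of an element of `Ũ`. -/
def toMat (u : TU T n F) : Mat T n F := ((u : GL (Fin (dimN T n)) F) : Mat T n F)

@[simp] lemma toMat_one : toMat (1 : TU T n F) = 1 := rfl

@[simp] lemma toMat_mul (u v : TU T n F) : toMat (u * v) = toMat u * toMat v := rfl

lemma toMat_lower (u : TU T n F) {i j : Fin (dimN T n)} (h : j < i) : toMat u i j = 0 :=
  u.2.1 i j h

lemma toMat_diag (u : TU T n F) (i : Fin (dimN T n)) : toMat u i i = 1 := u.2.2 i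

variable (T n F)

/-- The group `U = G ∩ U_N(F)`, where `G` is the group of invertible matrices preserving the
form `(v, w) ↦ vᵗ S w`. -/
def sylowU : Subgroup (TU T n F) where
  carrier := {u | (toMat u).transpose * gram T n F * toMat u = gram T n F}
  one_mem' := by simp
  mul_mem' := by
    intro a b ha hb
    have ha' : (toMat a).transpose * gram T n F * toMat a = gram T n F := ha
    have hb' : (toMat b).transpose * gram T n F * toMat b = gram T n F := hb
    change (toMat (a * b)).transpose * gram T n F * toMat (a * b) = gram T n F
    calc (toMat (a * b)).transpose * gram T n F * toMat (a * b)
        = (toMat b).transpose * ((toMat a).transpose * gram T n F * toMat a) * toMat b := by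
          simp only [toMat_mul, Matrix.transpose_mul, Matrix.mul_assoc]
      _ = gram T n F := by rw [ha', hb']
  inv_mem' := by
    intro a ha
    have ha' : (toMat a).transpose * gram T n F * toMat a = gram T n F := ha
    change (toMat a⁻¹).transpose * gram T n F * toMat a⁻¹ = gram T n F
    have h1 : toMat a * toMat a⁻¹ = 1 := by rw [← toMat_mul, mul_inv_cancel, toMat_one]
    calc (toMat a⁻¹).transpose * gram T n F * toMat a⁻¹
        = (toMat a⁻¹).transpose * ((toMat a).transpose * gram T n F * toMat a) * toMat a⁻¹ := by
          rw [ha']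
      _ = (toMat a * toMat a⁻¹).transpose * gram T n F * (toMat a * toMat a⁻¹) := by
          simp only [Matrix.transpose_mul, Matrix.mul_assoc]
      _ = gram T n F := by rw [h1]; simp

/-! ### The space `V`, the dot action, and the monomial action on `ℂ^V` -/

/-- The space `V` of matrices supported in `pUP`. -/
def V : Submodule F (Mat T n F) where
  carrier := {A | ∀ i j, (i, j) ∉ pUP T n → A i j = 0}
  add_mem' := by
    intro A B hA hB i j h
    rw [Matrix.add_apply, hA i j h, hB i j h, add_zero]
  zero_mem' := by intro i j _; rfl
  smul_mem' := by
    intro c A hA i j h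
    rw [Matrix.smul_apply, hA i j h, smul_zero]

variable {T n F}

/-- The projection `π` of all matrices onto `V`, which sets the entries outside of `pUP` to
zero. -/
def proj : Mat T n F →ₗ[F] V T n F where
  toFun M := ⟨Matrix.of fun i j => if (i, j) ∈ pUP T n then M i j else 0, by
    intro i j h; simp [h]⟩
  map_add' M M' := by
    apply Subtype.ext; ext i j
    by_cases h : (i, j) ∈ pUP T n <;> simp [h]
  map_smul' c M := by
    apply Subtype.ext; ext i j
    by_cases h : (i, j) ∈ pUP T n <;> simp [h]

lemma proj_apply (M : Mat T n F) (i j : Fin (dimN T n)) :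
    (proj M : Mat T n F) i j = if (i, j) ∈ pUP T n then M i j else 0 := rfl

lemma proj_coe (A : V T n F) : proj (A : Mat T n F) = A := by
  apply Subtype.ext; ext i j
  rw [proj_apply]
  split_ifs with h
  · rfl
  · exact (A.2 i j h).symm

lemma proj_one : proj (1 : Mat T n F) = 0 := by
  apply Subtype.ext; ext i j
  rw [proj_apply]
  split_ifs with h
  · have : i < j := (Finset.mem_filter.mp h).2.1
    rw [Matrix.one_apply_ne this.ne]; rfl
  · rfl

lemma pUP_left {i j k : Fin (dimN T n)} (h : (i, j) ∈ pUP T n) (hik : i < k) (hkj : k ≤ j) :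
    (i, k) ∈ pUP T n := by
  simp only [pUP, Finset.mem_filter, Finset.mem_univ, true_and] at h ⊢
  refine ⟨hik, ?_⟩
  rcases h.2 with h2 | ⟨hT, h2⟩
  · exact Or.inl (lt_of_le_of_lt hkj h2)
  · rcases lt_or_eq_of_le hkj with h3 | h3
    · exact Or.inl (h2 ▸ h3)
    · exact Or.inr ⟨hT, h3 ▸ h2⟩

lemma proj_proj_mul (M : Mat T n F) (hM : ∀ i j, j ≤ i → M i j = 0) (v : TU T n F) :
    proj ((proj M : Mat T n F) * toMat v) = proj (M * toMat v) := by
  apply Subtype.ext; ext i j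
  rw [proj_apply, proj_apply]
  split_ifs with h
  · rw [Matrix.mul_apply, Matrix.mul_apply]
    refine Finset.sum_congr rfl fun k _ => ?_
    rw [proj_apply]
    split_ifs with hk
    · rfl
    · rcases le_or_gt k i with h1 | h1
      · rw [hM i k h1]
      · rcases le_or_gt k j with h2 | h2
        · exact absurd (pUP_left h h1 h2) hk
        · rw [toMat_lower v h2, mul_zero, mul_zero]
  · rfl

lemma coe_strict (A : V T n F) (i j : Fin (dimN T n)) (h : j ≤ i) : (A : Mat T n F) i j = 0 :=
  A.2 i j fun h' => absurd (Finset.mem_filter.mp h').2.1 (not_lt.mpr h)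

lemma mul_strict (M : Mat T n F) (hM : ∀ i j, j ≤ i → M i j = 0) (u : TU T n F)
    (i j : Fin (dimN T n)) (h : j ≤ i) : (M * toMat u) i j = 0 := by
  rw [Matrix.mul_apply]
  refine Finset.sum_eq_zero fun k _ => ?_
  rcases le_or_gt k i with h1 | h1
  · rw [hM i k h1, zero_mul]
  · rw [toMat_lower u (lt_of_le_of_lt h h1), mul_zero]

/-- The right action `A.u = π(Au)` of `Ũ` on `V`. -/
def dot (u : TU T n F) : V T n F →ₗ[F] V T n F where
  toFun A := proj ((A : Mat T n F) * toMat u)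
  map_add' A B := by rw [Submodule.coe_add, Matrix.add_mul, map_add]
  map_smul' c A := by rw [Submodule.coe_smul, Matrix.smul_mul, map_smul, RingHom.id_apply]

lemma dot_apply (u : TU T n F) (A : V T n F) : dot u A = proj ((A : Mat T n F) * toMat u) := rfl

lemma dot_one (A : V T n F) : dot 1 A = A := by
  rw [dot_apply, toMat_one, Matrix.mul_one, proj_coe]

lemma dot_mul (u v : TU T n F) (A : V T n F) : dot (u * v) A = dot v (dot u A) := by
  rw [dot_apply, dot_apply, dot_apply, proj_proj_mul _ (mul_strict _ (coe_strict A) u),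
    toMat_mul, Matrix.mul_assoc]

/-- The right 1-cocycle `f : Ũ → V`, the restriction of `π`. -/
def cocycle (u : TU T n F) : V T n F := proj (toMat u)

lemma cocycle_one : cocycle (1 : TU T n F) = 0 := by rw [cocycle, toMat_one, proj_one]

lemma cocycle_mul (u v : TU T n F) : cocycle (u * v) = dot v (cocycle u) + cocycle v := by
  have h1 : cocycle u = proj (toMat u - 1) := by rw [map_sub, proj_one, sub_zero, cocycle]
  have h2 : ∀ i j, j ≤ i → (toMat u - 1) i j = 0 := by
    intro i j h
    rcases lt_or_eq_of_le h with h | h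
    · rw [Matrix.sub_apply, toMat_lower u h, Matrix.one_apply_ne h.ne', sub_zero]
    · subst h
      rw [Matrix.sub_apply, toMat_diag, Matrix.one_apply_eq, sub_self]
  rw [h1, dot_apply, proj_proj_mul _ h2, Matrix.sub_mul, Matrix.one_mul, map_sub, cocycle, cocycle,
    toMat_mul, sub_add_cancel]

/-- The trace form `κ(A, B) = tr(AᵗB)`, as an additive function of `B ∈ V`. -/
def kappa (A : V T n F) : V T n F →+ F where
  toFun B := ((A : Mat T n F).transpose * (B : Mat T n F)).trace
  map_zero' := by simp
  map_add' B C := by rw [Submodule.coe_add, Matrix.mul_add, Matrix.trace_add]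

/-- The linear character `[A] = χ_{-A} : B ↦ θ(-κ(A, B))` of `(V, +)`. -/
noncomputable def bracket (θ : AddChar F ℂ) (A : V T n F) : AddChar (V T n F) ℂ :=
  θ.compAddMonoidHom (-kappa A)

/-- The dot action on linear characters of `(V, +)`: `(χ.u)(B) = χ(B.u⁻¹)`. -/
def charDot (χ : AddChar (V T n F) ℂ) (u : TU T n F) : AddChar (V T n F) ℂ :=
  χ.compAddMonoidHom (dot u⁻¹).toAddMonoidHom

lemma charDot_apply (χ : AddChar (V T n F) ℂ) (u : TU T n F) (B : V T n F) :
    charDot χ u B = χ (dot u⁻¹ B) := rfl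

lemma charDot_mul (χ : AddChar (V T n F) ℂ) (u v : TU T n F) :
    charDot χ (u * v) = charDot (charDot χ u) v := by
  ext B
  rw [charDot_apply, charDot_apply, charDot_apply, mul_inv_rev, dot_mul]

variable (T n F)

/-- The right `ℂŨ`-module `ℂV̂ = ℂ^V`; a right module of a group is a representation of the
opposite group. On the basis of linear characters `χ` of `V` the action is the monomial one,
`χ u = χ(f(u⁻¹)) χ.u`, see `monomialRep_char`. -/
def monomialRep : Representation ℂ (TU T n F)ᵐᵒᵖ (V T n F → ℂ) where
  toFun u :=
    { toFun := fun τ B => τ (dot (unop u)⁻¹ B + cocycle (unop u)⁻¹)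
      map_add' := fun _ _ => rfl
      map_smul' := fun _ _ => rfl }
  map_one' := by
    ext τ B
    simp [dot_one, cocycle_one]
  map_mul' u v := by
    apply LinearMap.ext
    intro τ
    funext B
    change τ (dot (unop (u * v))⁻¹ B + cocycle (unop (u * v))⁻¹) =
      τ (dot (unop v)⁻¹ (dot (unop u)⁻¹ B + cocycle (unop u)⁻¹) + cocycle (unop v)⁻¹)
    rw [unop_mul, mul_inv_rev, dot_mul, cocycle_mul, map_add, add_assoc]

variable {T n F}

lemma monomialRep_char (χ : AddChar (V T n F) ℂ) (u : TU T n F) :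
    monomialRep T n F (op u) (χ : V T n F → ℂ) =
      χ (cocycle u⁻¹) • (charDot χ u : V T n F → ℂ) := by
  funext B
  change χ (dot u⁻¹ B + cocycle u⁻¹) = χ (cocycle u⁻¹) * χ (dot u⁻¹ B)
  rw [AddChar.map_add_eq_mul, mul_comm]

/-- Restriction of right modules from `Ũ` to `U`. -/
def resU {W : Type*} [AddCommMonoid W] [Module ℂ W] (ρ : Representation ℂ (TU T n F)ᵐᵒᵖ W) :
    Representation ℂ (sylowU T n F)ᵐᵒᵖ W :=
  ρ.comp (MonoidHom.op (sylowU T n F).subtype)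

/-- A (right) module of a group `H` affords the function `ξ` on `H`: the trace of the action of
`u` is `ξ u`. -/
def Affords {H W : Type*} [Monoid H] [AddCommMonoid W] [Module ℂ W]
    (ρ : Representation ℂ Hᵐᵒᵖ W) (ξ : H → ℂ) : Prop :=
  ∀ u : H, LinearMap.trace ℂ W (ρ (op u)) = ξ u

/-! ### Orbits and orbit modules -/

/-- The orbit `{[A].u | u ∈ K}` for a subgroup `K` of `Ũ`. -/
def orbitOf (θ : AddChar F ℂ) (K : Subgroup (TU T n F)) (A : V T n F) :
    Set (AddChar (V T n F) ℂ) :=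
  {χ | ∃ u ∈ K, χ = charDot (bracket θ A) u}

/-- The `U`-orbit `O_A`. -/
def orbit (θ : AddChar F ℂ) (A : V T n F) : Set (AddChar (V T n F) ℂ) :=
  orbitOf θ (sylowU T n F) A

/-- The `Ũ`-orbit `Õ_A`. -/
def tildeOrbit (θ : AddChar F ℂ) (A : V T n F) : Set (AddChar (V T n F) ℂ) :=
  orbitOf θ ⊤ A

/-- The subspace of `ℂ^V` spanned by a set of linear characters of `V`. -/
def charSpan (X : Set (AddChar (V T n F) ℂ)) : Submodule ℂ (V T n F → ℂ) :=
  Submodule.span ℂ ((fun χ : AddChar (V T n F) ℂ => (χ : V T n F → ℂ)) '' X)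

lemma monomialRep_mem_charSpan (θ : AddChar F ℂ) (K : Subgroup (TU T n F)) (A : V T n F)
    {u : TU T n F} (hu : u ∈ K) {τ : V T n F → ℂ} (hτ : τ ∈ charSpan (orbitOf θ K A)) :
    monomialRep T n F (op u) τ ∈ charSpan (orbitOf θ K A) := by
  have h : charSpan (orbitOf θ K A) ≤
      (charSpan (orbitOf θ K A)).comap (monomialRep T n F (op u)) := by
    refine Submodule.span_le.mpr ?_
    rintro _ ⟨χ, ⟨v, hv, rfl⟩, rfl⟩
    change monomialRep T n F (op u) _ ∈ charSpan (orbitOf θ K A)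
    rw [monomialRep_char, ← charDot_mul]
    exact Submodule.smul_mem _ _ (Submodule.subset_span ⟨_, ⟨v * u, K.mul_mem hv hu, rfl⟩, rfl⟩)
  exact h hτ

/-- The `Ũ`-orbit module `ℂÕ_A`. -/
def tildeOrbitModule (θ : AddChar F ℂ) (A : V T n F) : Subrepresentation (monomialRep T n F) where
  toSubmodule := charSpan (tildeOrbit θ A)
  apply_mem_toSubmodule g _ hτ :=
    monomialRep_mem_charSpan θ ⊤ A (Subgroup.mem_top (unop g)) hτ

/-- The `U`-orbit module `ℂO_A`. -/
def orbitModule (θ : AddChar F ℂ) (A : V T n F) :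
    Subrepresentation (resU (monomialRep T n F)) where
  toSubmodule := charSpan (orbit θ A)
  apply_mem_toSubmodule g _ hτ :=
    monomialRep_mem_charSpan θ (sylowU T n F) A (unop g).2 hτ

/-! ### Main conditions, verges, cores, separation -/

/-- The main conditions: the positions of the rightmost nonzero entries of the nonzero rows. -/
def mainCond (A : V T n F) : Set (Pos T n) :=
  {p | p ∈ pUP T n ∧ (A : Mat T n F) p.1 p.2 ≠ 0 ∧
    ∀ k, p.2 < k → (A : Mat T n F) p.1 k = 0}

/-- The left main conditions. -/
def leftMain (A : V T n F) : Set (Pos T n) := {p | p ∈ mainCond A ∧ p ∈ tril T n}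

/-- The right main conditions. -/
def rightMain (A : V T n F) : Set (Pos T n) := {p | p ∈ mainCond A ∧ p ∈ trir T n}

/-- Staircase: the main conditions lie in different columns. -/
def IsStaircase (A : V T n F) : Prop :=
  ∀ p ∈ mainCond A, ∀ r ∈ mainCond A, p.2 = r.2 → p = r

/-- The minor conditions: the positions `(i, j̄)` with `(i, j)` a right main condition. -/
def minorCond (A : V T n F) : Set (Pos T n) := {p | (p.1, p.2.rev) ∈ rightMain A}

/-- The supplementary conditions: the positions in the columns up to `ñ` which are to the left of
some minor or left main condition, in the column of some minor condition, and which are neither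
minor nor main conditions. -/
def supplCond (A : V T n F) : Set (Pos T n) :=
  {p | p ∈ tril T n ∧
    (∃ l, p.2 < l ∧ ((p.1, l) ∈ minorCond A ∨ (p.1, l) ∈ leftMain A)) ∧
    (∃ k, (k, p.2) ∈ minorCond A) ∧ p ∉ minorCond A ∧ p ∉ mainCond A}

/-- The core of `A`; minor conditions belong to it in types `B` and `D` only. -/
def core (A : V T n F) : Set (Pos T n) :=
  {p | p ∈ mainCond A ∨ (T ≠ ClassicalType.C ∧ p ∈ minorCond A) ∨ p ∈ supplCond A}

/-- `[A]` is a core character: it is staircase, and supported in its core. -/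
def IsCore (A : V T n F) : Prop :=
  IsStaircase A ∧ ∀ p : Pos T n, (A : Mat T n F) p.1 p.2 ≠ 0 → p ∈ core A

open Classical in
/-- The verge of `A`: all entries except those on the main conditions are set to zero. -/
noncomputable def verge (A : V T n F) : V T n F :=
  ⟨Matrix.of fun i j => if (i, j) ∈ mainCond A then (A : Mat T n F) i j else 0, by
    intro i j h
    have h' : (i, j) ∉ mainCond A := fun hm => h hm.1
    simp [h']⟩

/-- The leg at a position. -/
def leg (p : Pos T n) : Set (Pos T n) := {r | r ∈ pUP T n ∧ r.2 = p.2 ∧ p.1 < r.1}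

/-- The arm at a position `(i, j)`: the positions of `pUP` in row `j̄`, except that at an
antidiagonal position (of type `C`) it consists of the positions strictly left of it in its
row. -/
def arm (p : Pos T n) : Set (Pos T n) :=
  {r | r ∈ pUP T n ∧ r.1 = p.2.rev ∧ (p.2 = p.1.rev → r.2 < p.2)}

/-- The limb of `A`: all positions on legs and arms of main conditions. -/
def limb (A : V T n F) : Set (Pos T n) := {r | ∃ p ∈ mainCond A, r ∈ leg p ∨ r ∈ arm p}

/-- `[A]` is main separated: no main condition lies on a limb. -/
def IsMainSeparated (A : V T n F) : Prop := limb A ∩ mainCond A = ∅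

/-- The set `𝒱(A)` of the characters `[B]` with the same verge as `A`. -/
def vergeSet (θ : AddChar F ℂ) (A : V T n F) : Set (AddChar (V T n F) ℂ) :=
  {χ | ∃ B : V T n F, verge B = verge A ∧ χ = bracket θ B}

/-- The cores `[B]` with verge `A`. -/
def coresWithVerge (A : V T n F) : Set (V T n F) := {B | IsCore B ∧ verge B = A}

/-! ### Elementary characters and supercharacters -/

/-- The root subgroup elements `x_{ij}(α)` of `U`, for `(i, j) ∈ pUP`. -/
def rootElt (p : Pos T n) (α : F) : Mat T n F :=
  if p.2 = p.1.rev then 1 + Matrix.single p.1 p.2 α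
  else if p.2 = p.2.rev then
    1 + Matrix.single p.1 p.2 α - Matrix.single p.2 p.1.rev α
      - Matrix.single p.1 p.1.rev (2⁻¹ * α ^ 2)
  else if T = ClassicalType.C ∧ n ≤ p.2.val then
    1 + Matrix.single p.1 p.2 α + Matrix.single p.2.rev p.1.rev α
  else 1 + Matrix.single p.1 p.2 α - Matrix.single p.2.rev p.1.rev α

variable (F) in
/-- The subgroup `U_J` of `U` generated by the root subgroups `X_{ij}` with `(i, j) ∈ J`. -/
def patternSubgroup (J : Finset (Pos T n)) : Subgroup (sylowU T n F) :=
  Subgroup.closure {u | ∃ p ∈ J, ∃ α : F, toMat (u : TU T n F) = rootElt p α}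

/-- The set `ϱ_{ij}` of positions removed from `pUP`: those of `pUP` left of `(i, j)` in its row
if `j ≤ ñ`; those in the columns up to `n` of row `i` and in the columns up to `ñ` of row `j̄` if
`j > ñ`. -/
def rho (p : Pos T n) : Finset (Pos T n) :=
  if p ∈ tril T n then (pUP T n).filter fun r => r.1 = p.1 ∧ r.2 < p.2
  else (pUP T n).filter fun r =>
    (r.1 = p.1 ∧ r.2.val < n) ∨ (r.1 = p.2.rev ∧ r.2.val < tildeN T n)

variable (F) in
/-- The subgroup `U_{ij}` generated by the root subgroups at the positions outside `ϱ_{ij}`. -/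
def elemSubgroup (p : Pos T n) : Subgroup (sylowU T n F) :=
  patternSubgroup F (pUP T n \ rho p)

open Classical in
/-- The induced class function `g ↦ |H|⁻¹ ∑ₓ χ°(x g x⁻¹)`, where `χ°` is `χ` on `H` and zero
elsewhere. -/
noncomputable def inducedChar {G : Type*} [Group G] (H : Subgroup G) (χ : H → ℂ) (g : G) : ℂ :=
  (Nat.card H : ℂ)⁻¹ * ∑ᶠ x : G, if h : x * g * x⁻¹ ∈ H then χ ⟨x * g * x⁻¹, h⟩ else 0

/-- The elementary character `ξ^{ij}_α`, induced from the linear character `u ↦ θ(α u_{ij})` of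
`U_{ij}`. -/
noncomputable def elemChar (θ : AddChar F ℂ) (p : Pos T n) (α : F) : sylowU T n F → ℂ :=
  inducedChar (elemSubgroup F p) fun u => θ (α * toMat ((u : sylowU T n F) : TU T n F) p.1 p.2)

/-- Basic sets of positions above the diagonal. -/
def IsBasic (D : Finset (Pos T n)) : Prop :=
  (∀ p ∈ D, p.1 < p.2) ∧
  (∀ p : Pos T n, p ∈ D ↔ (p.2.rev, p.1.rev) ∈ D) ∧
  (∀ p ∈ D, ∀ r ∈ D, p.1 = r.1 → p = r) ∧
  (∀ p ∈ D, ∀ r ∈ D, p.2 = r.2 → p = r)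

/-- The André–Neto supercharacter `ξ_{D,Φ}`. -/
noncomputable def superChar (θ : AddChar F ℂ) (D : Finset (Pos T n))
    (Φ : ↥(D ∩ pUP T n) → Fˣ) (u : sylowU T n F) : ℂ :=
  ∏ p : ↥(D ∩ pUP T n), elemChar θ p.1 (Φ p : F) u

/-- The element `Φ(i, j) e_{ij}` of `V`, for `(i, j) ∈ D ∩ pUP`. -/
def unitV (D : Finset (Pos T n)) (Φ : ↥(D ∩ pUP T n) → Fˣ) (p : ↥(D ∩ pUP T n)) : V T n F :=
  ⟨Matrix.single p.1.1 p.1.2 (Φ p : F), by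
    intro i j h
    rw [Matrix.single_apply]
    split_ifs with h'
    · exact absurd (Finset.mem_inter.mp p.2).2 (by rwa [← h'.1, ← h'.2] at h)
    · rfl⟩

/-- The element `A(D, Φ) = ∑ Φ(i, j) e_{ij}` of `V`. -/
def basicV (D : Finset (Pos T n)) (Φ : ↥(D ∩ pUP T n) → Fˣ) : V T n F :=
  ∑ p : ↥(D ∩ pUP T n), unitV D Φ p

/-- The tensor product of a family of representations, with the diagonal action. -/
noncomputable def tensorRep {ι G : Type*} [Monoid G] {W : ι → Type*} [∀ i, AddCommGroup (W i)]
    [∀ i, Module ℂ (W i)] (ρ : ∀ i, Representation ℂ G (W i)) :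
    Representation ℂ G (PiTensorProduct ℂ W) where
  toFun g := PiTensorProduct.map fun i => ρ i g
  map_one' := by simp only [map_one]; exact PiTensorProduct.map_one
  map_mul' g h := by simp only [map_mul]; exact PiTensorProduct.map_mul _ _

/-- The André–Neto module: the `ℂŨ`-module `⨂ ℂÕ_{Φ(i,j)e_{ij}}` over `(i, j) ∈ D ∩ pUP`. -/
noncomputable def andreNetoModule (θ : AddChar F ℂ) (D : Finset (Pos T n))
    (Φ : ↥(D ∩ pUP T n) → Fˣ) :
    Representation ℂ (TU T n F)ᵐᵒᵖ
      (PiTensorProduct ℂ fun p : ↥(D ∩ pUP T n) => (tildeOrbitModule θ (unitV D Φ p)).toSubmodule) :=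
  tensorRep fun p => (tildeOrbitModule θ (unitV D Φ p)).toRepresentation

end ClassicalUnipotent

open ClassicalUnipotent

namespace ClassicalUnipotent

open MulOpposite

variable {T : ClassicalType} {n : ℕ} {F : Type*} [Field F]

/-! On labels the action is `[A].u = [π(A u⁻ᵗ)]`: a column operation which adds multiples of columns
to columns further left, followed by truncation. It cannot change the rightmost nonzero entry of a
row. If the main conditions lie in different columns, each column operation needed to reach a given
matrix with the same verge serves one row only, so `Ũ` is transitive on these matrices. This is
`tildeOrbit_eq_vergeSet`, and it gives `Res ℂÕ_A = ℂ𝒱(A)`.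

The `U`-orbits in `𝒱(A)` are separated in two steps. Existence of cores (`exists_core`): an
operation of `U` comes with its mirror image in the antidiagonal; clearing positions in a suitable
order, the mirror operation spoils only core positions or positions still to be treated. Uniqueness
(`core_unique`): the matrices `u⁻ᵗ` preserve the form `S`, so the `S`-products of pairs of rows are
invariants of the orbit whenever truncation does not interfere (`act_form_apply`), and these
products determine the entries of a core at its minor and supplementary conditions. Distinct
characters are linearly independent, so the disjoint union of orbits becomes a direct sum of orbit
modules.

For the supercharacters, `ℂ^V` is regarded as the algebra of functions on `V`. The monomial action
is composition with affine bijections of `V`, so pointwise multiplication is equivariant, and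
`[B][B'] = [B + B']`. As the positions of `D ∩ pUP` lie in different rows, multiplication identifies
the tensor product of the modules `ℂÕ_{Φ(i,j)e_{ij}}` with `ℂÕ_A` (`mulEquiv`). Inside
`ℂÕ_{αe_{ij}}` the function `elemVec` is an eigenvector of `U_{ij}` whose translates by cosets are
orthogonal, so it generates a `U`-module affording the elementary character (`affords_elemModule`).
Off the antidiagonal a dimension count shows that this is all of `ℂÕ_{αe_{ij}}` (`elemModule_eq`).
Traces multiply over tensor products, which gives the supercharacter; with antidiagonal positions
one obtains a submodule, and Maschke's theorem supplies a complement.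

Main separation is combinatorial: in a symmetric set `D` the row `j̄` of the arm at `(i,j)` is
already occupied by `(j̄,ī)`. -/

/-! ### Index arithmetic, signs of the form, and inverses in `U`. -/

lemma dimN_eq (T : ClassicalType) (n : ℕ) : dimN T n = n + tildeN T n := by
  cases T <;> simp [dimN, tildeN] <;> omega

lemma tildeN_eq (T : ClassicalType) (n : ℕ) :
    (T = .B ∧ tildeN T n = n + 1) ∨ (T ≠ .B ∧ tildeN T n = n) := by
  cases T <;> simp [tildeN]

lemma mem_pUP_iff {i j : Fin (dimN T n)} : (i, j) ∈ pUP T n ↔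
    i.val < j.val ∧ (i.val + j.val + 1 < dimN T n ∨ T = .C ∧ i.val + j.val + 1 = dimN T n) := by
  simp only [pUP, Finset.mem_filter, Finset.mem_univ, true_and, Fin.lt_def, Fin.ext_iff,
    Fin.val_rev]
  have := i.2
  have := j.2
  refine and_congr_right fun h => or_congr ?_ (and_congr_right fun _ => ?_) <;> omega

lemma val_rev_add (i : Fin (dimN T n)) : i.rev.val + i.val + 1 = dimN T n := by
  have := i.2
  rw [Fin.val_rev]; omega

/-- The sign `±1` in row `i` of the Gram matrix. -/
def sgn (T : ClassicalType) (n : ℕ) (F : Type*) [Field F] (i : Fin (dimN T n)) : F :=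
  if T = .C ∧ n ≤ i.val then -1 else 1

lemma gram_apply (i j : Fin (dimN T n)) :
    gram T n F i j = if j = i.rev then sgn T n F i else 0 := rfl

lemma sgn_mul_self (i : Fin (dimN T n)) : sgn T n F i * sgn T n F i = 1 := by
  unfold sgn; split_ifs <;> simp

lemma sgn_ne_zero (i : Fin (dimN T n)) : sgn T n F i ≠ 0 := by
  unfold sgn; split_ifs <;> simp

lemma sgn_of_ne (h : T ≠ .C) (i : Fin (dimN T n)) : sgn T n F i = 1 := by
  simp [sgn, h]

lemma sgn_rev_C (h : T = .C) (i : Fin (dimN T n)) : sgn T n F i.rev = - sgn T n F i := by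
  subst h
  have := val_rev_add i
  have h2 : dimN .C n = 2 * n := rfl
  unfold sgn
  by_cases h : n ≤ i.val
  · rw [if_neg (by simp only [true_and]; omega), if_pos ⟨rfl, h⟩, neg_neg]
  · rw [if_pos ⟨rfl, by omega⟩, if_neg (by simpa using h)]

lemma mul_gram_apply (M : Mat T n F) (a b : Fin (dimN T n)) :
    (M * gram T n F) a b = M a b.rev * sgn T n F b.rev := by
  rw [Matrix.mul_apply, Finset.sum_eq_single b.rev]
  · simp [gram_apply]
  · intro k _ hk
    rw [gram_apply, if_neg, mul_zero]
    rintro rfl; simp at hk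
  · simp

lemma gram_mul_apply (M : Mat T n F) (a b : Fin (dimN T n)) :
    (gram T n F * M) a b = sgn T n F a * M a.rev b := by
  rw [Matrix.mul_apply, Finset.sum_eq_single a.rev]
  · simp [gram_apply]
  · intro k _ hk
    rw [gram_apply, if_neg hk, zero_mul]
  · simp

lemma toMat_mul_inv (u : TU T n F) : toMat u * toMat u⁻¹ = 1 := by
  rw [← toMat_mul, mul_inv_cancel, toMat_one]

lemma toMat_injective : Function.Injective (toMat : TU T n F → Mat T n F) := fun _ _ h =>
  Subtype.ext (Units.ext h)

lemma mem_sylowU_iff {u : TU T n F} : u ∈ sylowU T n F ↔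
    (toMat u).transpose * gram T n F * toMat u = gram T n F := Iff.rfl

/-- From `uᵗSu = S` follows `S u⁻¹ = uᵗS`: up to signs, inversion in `U` is reflection in the
antidiagonal. This translates conditions on columns of `u⁻¹` into conditions on rows of `u`. -/
lemma sylowU_inv_apply {u : TU T n F} (hu : u ∈ sylowU T n F) (a b : Fin (dimN T n)) :
    toMat u⁻¹ a b = sgn T n F a.rev * sgn T n F b.rev * toMat u b.rev a.rev := by
  have h : (toMat u).transpose * gram T n F = gram T n F * toMat u⁻¹ := by
    have h1 := congr_arg (· * toMat u⁻¹) (mem_sylowU_iff.mp hu)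
    simpa only [Matrix.mul_assoc, toMat_mul_inv, Matrix.mul_one] using h1
  have h2 := congr_fun (congr_fun h a.rev) b
  rw [mul_gram_apply, gram_mul_apply, Fin.rev_rev, Matrix.transpose_apply] at h2
  calc toMat u⁻¹ a b = sgn T n F a.rev * (sgn T n F a.rev * toMat u⁻¹ a b) := by
        rw [← mul_assoc, sgn_mul_self, one_mul]
    _ = _ := by rw [← h2]; ring

/-- The lower unitriangular matrices `u⁻ᵗ`, for `u` in `U`, preserve the form as well. -/
lemma sylowU_inv_transpose {u : TU T n F} (hu : u ∈ sylowU T n F) :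
    (toMat u⁻¹).transpose * gram T n F * toMat u⁻¹ = gram T n F :=
  mem_sylowU_iff.mp ((sylowU T n F).inv_mem hu)

/-- An upper unitriangular matrix as an element of the unitriangular group. -/
lemma exists_toMat_eq (M : Mat T n F) (h : ∀ i j, j < i → M i j = 0) (h1 : ∀ i, M i i = 1) :
    ∃ u : TU T n F, toMat u = M := by
  have hd : M.det = 1 := by
    rw [Matrix.det_of_isUpperTriangular (fun i j hij => h i j hij)]
    simp [h1]
  refine ⟨⟨Matrix.GeneralLinearGroup.mkOfDetNeZero M (by rw [hd]; exact one_ne_zero), ?_, ?_⟩, ?_⟩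
  · exact h
  · exact h1
  · rfl

/-! ### Root elements -/

lemma single_mul_apply (i j : Fin (dimN T n)) (c : F) (M : Mat T n F) (a b : Fin (dimN T n)) :
    (Matrix.single i j c * M) a b = if a = i then c * M j b else 0 := by
  split_ifs with h
  · subst h; simp
  · rw [Matrix.single_mul_apply_of_ne _ _ _ _ _ h]

lemma mul_single_apply (i j : Fin (dimN T n)) (c : F) (M : Mat T n F) (a b : Fin (dimN T n)) :
    (M * Matrix.single i j c) a b = if b = j then M a i * c else 0 := by
  split_ifs with h
  · subst h; simp
  · rw [Matrix.mul_single_apply_of_ne _ _ _ _ _ h]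

lemma single_mul_gram (i j : Fin (dimN T n)) (c : F) :
    Matrix.single i j c * gram T n F = Matrix.single i j.rev (c * sgn T n F j) := by
  ext a b
  rw [single_mul_apply, gram_apply, Matrix.single_apply]
  by_cases h1 : a = i
  · by_cases h2 : b = j.rev
    · simp [h1, h2]
    · simp [h1, h2, Ne.symm h2]
  · simp [h1, Ne.symm h1]

lemma gram_mul_single (i j : Fin (dimN T n)) (c : F) :
    gram T n F * Matrix.single i j c = Matrix.single i.rev j (sgn T n F i.rev * c) := by
  ext a b
  rw [mul_single_apply, gram_apply, Matrix.single_apply]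
  by_cases h2 : b = j <;> by_cases h1 : a = i.rev
  · subst h1; simp [h2]
  · have : i ≠ a.rev := by rintro rfl; simp at h1
    simp [h2, this, Ne.symm h1]
  · simp [h2, Ne.symm h2]
  · simp [h2, Ne.symm h2]

lemma two_ne_zero_of_ringChar (hF : ringChar F ≠ 2) : (2 : F) ≠ 0 :=
  Ring.two_ne_zero hF

/-- For `1 + Y` invariance of the form reads `YᵗS + SY + YᵗSY = 0`. The linear part forces the entry
at the mirror position; the quadratic part vanishes except in the middle column of type `B`, where
the term `½α²` compensates for it. -/
lemma rootElt_transpose_mul_gram_mul (hF : ringChar F ≠ 2) {i j : Fin (dimN T n)}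
    (h : (i, j) ∈ pUP T n) (c : F) :
    (rootElt (i, j) c).transpose * gram T n F * rootElt (i, j) c = gram T n F := by
  have h0 := mem_pUP_iff.mp h
  have hi := val_rev_add i
  have hj := val_rev_add j
  have key : ∀ Y : Mat T n F, Y.transpose * gram T n F + gram T n F * Y
      + Y.transpose * gram T n F * Y = 0 →
      (1 + Y).transpose * gram T n F * (1 + Y) = gram T n F := by
    intro Y hY
    have : (1 + Y).transpose * gram T n F * (1 + Y) = gram T n F + (Y.transpose * gram T n F
        + gram T n F * Y + Y.transpose * gram T n F * Y) := by
      rw [Matrix.transpose_add, Matrix.transpose_one]; noncomm_ring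
    rw [this, hY, add_zero]
  have hij : i ≠ j := by rintro rfl; omega
  have hii : i ≠ i.rev := by intro h; have := congr_arg Fin.val h; omega
  -- `σ` is the sign of the mirror entry; both remaining linear terms cancel for this value, and all
  -- four products of matrix units in the quadratic part vanish.
  have hijr : ∀ σ : F, σ = - (sgn T n F i * sgn T n F j) → j ≠ i.rev → j ≠ j.rev →
      (1 + (Matrix.single i j c + Matrix.single j.rev i.rev (σ * c))).transpose * gram T n F *
        (1 + (Matrix.single i j c + Matrix.single j.rev i.rev (σ * c))) = gram T n F := by
    intro σ hσ h1 h2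
    apply key
    have hij' : i.rev ≠ j.rev := by simpa using hij
    have e1 : sgn T n F i + σ * sgn T n F j = 0 := by
      rw [hσ]; linear_combination (-sgn T n F i) * sgn_mul_self (F := F) j
    have e2 : σ * sgn T n F j.rev + sgn T n F i.rev = 0 := by
      rcases eq_or_ne T .C with hT | hT
      · rw [sgn_rev_C hT, sgn_rev_C hT, hσ]
        linear_combination (sgn T n F i) * sgn_mul_self (F := F) j
      · rw [hσ]; simp [sgn_of_ne hT]
    simp only [Matrix.transpose_add, Matrix.transpose_single, Matrix.add_mul, Matrix.mul_add,
      single_mul_gram, gram_mul_single, Fin.rev_rev]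
    rw [Matrix.single_mul_single_of_ne _ _ _ _ hii.symm, Matrix.single_mul_single_of_ne _ _ _ _ hij',
      Matrix.single_mul_single_of_ne _ _ _ _ hij.symm, Matrix.single_mul_single_of_ne _ _ _ _ h2]
    calc _ = Matrix.single j i.rev (c * (sgn T n F i + σ * sgn T n F j)) +
        Matrix.single i.rev j (c * (σ * sgn T n F j.rev + sgn T n F i.rev)) := by
          simp only [mul_add, Matrix.single_add]
          rw [show σ * c * sgn T n F j.rev = c * (σ * sgn T n F j.rev) by ring,
            show sgn T n F j * (σ * c) = c * (σ * sgn T n F j) by ring,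
            show sgn T n F i.rev * c = c * sgn T n F i.rev by ring]
          abel
      _ = 0 := by rw [e1, e2]; simp
  have hN := dimN_eq T n
  unfold rootElt
  simp only
  split_ifs with h1 h2 h3
  · subst h1
    apply key
    have hT : T = .C := by
      rcases h0.2 with h0 | h0
      · omega
      · exact h0.1
    simp only [Matrix.transpose_single, single_mul_gram, gram_mul_single]
    rw [Matrix.single_mul_single_of_ne _ _ _ _ hii.symm, ← Matrix.single_add, sgn_rev_C hT]
    simp [mul_comm]
  · have h2' := congr_arg Fin.val h2
    have hT : T = .B := by
      rcases tildeN_eq T n with h | h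
      · exact h.1
      · omega
    have hC : T ≠ .C := by rw [hT]; simp
    rw [sub_eq_add_neg, sub_eq_add_neg, add_assoc, add_assoc, Matrix.single_neg,
      Matrix.single_neg]
    apply key
    simp only [Matrix.transpose_add, Matrix.transpose_single, Matrix.add_mul, Matrix.mul_add,
      single_mul_gram, gram_mul_single, sgn_of_ne hC, mul_one, one_mul, ← h2]
    simp only [Matrix.single_mul_single_of_ne _ _ _ _ hii.symm,
      Matrix.single_mul_single_of_ne _ _ _ _ hij.symm,
      Matrix.single_mul_single_of_ne _ _ _ _ (Ne.symm h1), Matrix.single_mul_single_same]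
    have e : (2⁻¹ * c ^ 2 : F) + 2⁻¹ * c ^ 2 = c ^ 2 := by
      rw [← add_mul, ← two_mul, mul_inv_cancel₀ (two_ne_zero_of_ringChar hF), one_mul]
    -- The square of the middle entry is the only surviving quadratic term; it is split into halves
    -- to cancel against the two corner entries.
    have e' : (-c * -c : F) = 2⁻¹ * c ^ 2 + 2⁻¹ * c ^ 2 := by rw [e]; ring
    rw [e']
    simp only [Matrix.single_add, ← Matrix.single_neg]
    abel
  · have hi' : sgn T n F i = 1 := by
      unfold sgn; rw [if_neg]; rintro ⟨-, h⟩
      rcases tildeN_eq T n with h | h <;> omega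
    rw [add_assoc, show c = 1 * c by ring]
    have := hijr 1 (by rw [hi']; simp [sgn, h3]) h1 h2
    simpa using this
  · have hi' : sgn T n F i = 1 := by
      unfold sgn; rw [if_neg]; rintro ⟨-, h⟩
      rcases tildeN_eq T n with h | h <;> omega
    have := hijr (-1) (by rw [hi']; simp [sgn, h3]) h1 h2
    rw [sub_eq_add_neg, add_assoc, Matrix.single_neg]
    simpa using this

lemma rootElt_lower {i j : Fin (dimN T n)} (h : (i, j) ∈ pUP T n) (c : F)
    (a b : Fin (dimN T n)) (hab : b ≤ a) : rootElt (i, j) c a b = (1 : Mat T n F) a b := by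
  have h0 := mem_pUP_iff.mp h
  have hi := val_rev_add i
  have hj := val_rev_add j
  have h1 : ¬ (i = a ∧ j = b) := by rintro ⟨rfl, rfl⟩; rw [Fin.le_def] at hab; omega
  have h2 : ¬ (j.rev = a ∧ i.rev = b) := by rintro ⟨rfl, rfl⟩; rw [Fin.le_def] at hab; omega
  have h3 : ¬ (i = a ∧ i.rev = b) := by rintro ⟨rfl, rfl⟩; rw [Fin.le_def] at hab; omega
  unfold rootElt
  simp only
  split_ifs with h4 h5
  · simp [h1]
  · rw [← h5] at h2; simp [h1, h2, h3]
  · simp [h1, h2]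
  · simp [h1, h2]

/-- The root elements belong to `U`. -/
lemma exists_rootElt (hF : ringChar F ≠ 2) {i j : Fin (dimN T n)} (h : (i, j) ∈ pUP T n)
    (c : F) : ∃ u ∈ sylowU T n F, toMat u = rootElt (i, j) c := by
  obtain ⟨u, hu⟩ := exists_toMat_eq (rootElt (i, j) c)
    (fun a b hab => by rw [rootElt_lower h c a b hab.le, Matrix.one_apply_ne hab.ne'])
    (fun a => by rw [rootElt_lower h c a a le_rfl, Matrix.one_apply_eq])
  refine ⟨u, ?_, hu⟩
  rw [mem_sylowU_iff, hu]
  exact rootElt_transpose_mul_gram_mul hF h c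

/-- Multiplication by a root element from the left, on the positions of `pUP`. -/
lemma rootElt_mul_apply {i k : Fin (dimN T n)} (h : (i, k) ∈ pUP T n) (c : F) (u : TU T n F)
    {a b : Fin (dimN T n)} (hab : (a, b) ∈ pUP T n) :
    (rootElt (i, k) c * toMat u) a b = toMat u a b + if a = i then c * toMat u k b else 0 := by
  have h0 := mem_pUP_iff.mp h
  have h0' := mem_pUP_iff.mp hab
  have hi := val_rev_add i
  have hk := val_rev_add k
  -- The mirror entry adds a multiple of row `ī` of `u` to row `k̄`. In row `k̄` the positions of
  -- `pUP` have columns at most `k < ī`, where row `ī` of `u` vanishes.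
  have e1 : k ≠ i.rev → a = k.rev → toMat u i.rev b = 0 := by
    rintro h rfl
    have : k.val ≠ i.rev.val := fun h' => h (Fin.ext h')
    apply toMat_lower; rw [Fin.lt_def]; omega
  have e3 : ∀ d : F, k ≠ i.rev → (if a = k.rev then d * toMat u i.rev b else 0) = 0 := by
    intro d h4
    split_ifs with h'
    · rw [e1 h4 h', mul_zero]
    · rfl
  by_cases h4 : k = i.rev
  · rw [show rootElt (i, k) c = _ from if_pos h4]
    simp only [Matrix.add_mul, Matrix.one_mul, Matrix.add_apply, single_mul_apply]
  by_cases h5 : k = k.rev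
  · rw [show rootElt (i, k) c = _ from (if_neg h4).trans (if_pos h5)]
    simp only [Matrix.add_mul, Matrix.sub_mul, Matrix.one_mul, Matrix.add_apply, Matrix.sub_apply,
      single_mul_apply]
    have e2 : (if a = i then 2⁻¹ * c ^ 2 * toMat u i.rev b else 0) = 0 := by
      split_ifs with h'
      · subst h'
        have hk' := congr_arg Fin.val h5
        have hN := dimN_eq T n
        have : toMat u a.rev b = 0 := by
          apply toMat_lower; rw [Fin.lt_def]
          rcases h0'.2 with h | ⟨hT, h⟩
          · omega
          · have hN : dimN T n = 2 * n := by rw [hT]; rfl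
            omega
        rw [this, mul_zero]
      · rfl
    have e4 := e3 c h4
    rw [← h5] at e4
    rw [e4, e2, sub_zero, sub_zero]
  by_cases h6 : T = .C ∧ n ≤ k.val
  · rw [show rootElt (i, k) c = _ from (if_neg h4).trans ((if_neg h5).trans (if_pos h6))]
    simp only [Matrix.add_mul, Matrix.one_mul, Matrix.add_apply, single_mul_apply]
    rw [e3 c h4, add_zero]
  · rw [show rootElt (i, k) c = _ from (if_neg h4).trans ((if_neg h5).trans (if_neg h6))]
    simp only [Matrix.add_mul, Matrix.sub_mul, Matrix.one_mul, Matrix.add_apply, Matrix.sub_apply,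
      single_mul_apply]
    rw [e3 c h4, sub_zero]

/-! ### Coordinates on `U` -/

/-- The position of `p` in the row by row enumeration of all positions. -/
def rowKey (p : Pos T n) : ℕ := p.1.val * dimN T n + p.2.val

lemma rowKey_lt (p : Pos T n) : rowKey p < dimN T n * dimN T n := by
  have h1 := p.1.2
  have h2 := p.2.2
  unfold rowKey
  nlinarith

lemma rowKey_eq_iff {p q : Pos T n} : rowKey p = rowKey q ↔ p = q := by
  refine ⟨fun h => ?_, fun h => h ▸ rfl⟩
  have h1 := p.2.2
  have h2 := q.2.2
  have hpos : 0 < dimN T n := by omega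
  have e1 := congr_arg (· / dimN T n) h
  have e2 := congr_arg (· % dimN T n) h
  simp only [rowKey, Nat.mul_comm _ (dimN T n), Nat.mul_add_div hpos, Nat.div_eq_of_lt h1,
    Nat.div_eq_of_lt h2, Nat.mul_add_mod, Nat.mod_eq_of_lt h1, Nat.mod_eq_of_lt h2] at e1 e2
  exact Prod.ext (Fin.ext (by simpa using e1)) (Fin.ext e2)

lemma rootElt_mul_apply_self {p : Pos T n} (hp : p ∈ pUP T n) (c : F) (u : TU T n F) :
    (rootElt p c * toMat u) p.1 p.2 = toMat u p.1 p.2 + c := by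
  rw [show p = (p.1, p.2) from rfl, rootElt_mul_apply hp c u hp, if_pos rfl, toMat_diag, mul_one]

/-- Multiplication by `x_p(c)` adds `c` times row `p.2` of `u` to row `p.1`, and that row starts in
column `p.2`. So the entries before `p` in the row by row order are kept and, by
`rootElt_mul_apply_self`, the one at `p` is shifted by `c`: entries can be adjusted one at a time.
-/
lemma rootElt_mul_apply_of_lt {p q : Pos T n} (hp : p ∈ pUP T n) (hq : q ∈ pUP T n)
    (h : rowKey q < rowKey p) (c : F) (u : TU T n F) :
    (rootElt p c * toMat u) q.1 q.2 = toMat u q.1 q.2 := by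
  rw [show p = (p.1, p.2) from rfl, rootElt_mul_apply hp c u hq]
  split_ifs with h'
  · have hlt : q.2 < p.2 := by
      unfold rowKey at h
      rw [h'] at h
      rw [Fin.lt_def]
      omega
    rw [toMat_lower u hlt, mul_zero, add_zero]
  · rw [add_zero]

/-- The entries at the positions of `pUP` of an element of `U` are arbitrary. -/
lemma exists_sylowU_apply_eq (hF : ringChar F ≠ 2) (f : Pos T n → F) :
    ∃ u ∈ sylowU T n F, ∀ p ∈ pUP T n, toMat u p.1 p.2 = f p := by
  have key : ∀ t : ℕ, ∃ u ∈ sylowU T n F,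
      ∀ p ∈ pUP T n, rowKey p < t → toMat u p.1 p.2 = f p := by
    intro t
    induction t with
    | zero => exact ⟨1, one_mem _, by simp⟩
    | succ t ih =>
      obtain ⟨u, hu, h⟩ := ih
      by_cases hp : ∃ p ∈ pUP T n, rowKey p = t
      · obtain ⟨p, hp, rfl⟩ := hp
        obtain ⟨x, hx, hx'⟩ := exists_rootElt hF hp (f p - toMat u p.1 p.2)
        refine ⟨x * u, mul_mem hx hu, fun q hq hqt => ?_⟩
        rw [toMat_mul, hx']
        rcases Nat.lt_succ_iff_lt_or_eq.mp hqt with hlt | heq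
        · exact (rootElt_mul_apply_of_lt hp hq hlt _ _).trans (h q hq hlt)
        · rw [rowKey_eq_iff.mp heq]
          exact (rootElt_mul_apply_self hp _ _).trans (by ring)
      · refine ⟨u, hu, fun q hq hqt => h q hq ?_⟩
        rcases Nat.lt_succ_iff_lt_or_eq.mp hqt with hlt | heq
        · exact hlt
        · exact absurd ⟨q, hq, heq⟩ hp
  obtain ⟨u, hu, h⟩ := key (dimN T n * dimN T n)
  exact ⟨u, hu, fun p hp => h p hp (rowKey_lt p)⟩

/-! ### Left closed sets of positions, pattern subgroups and their indices. -/

/-- Sets of positions of `pUP` which contain with each position those on its left. -/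
def IsLeftClosed (J : Finset (Pos T n)) : Prop :=
  J ⊆ pUP T n ∧ ∀ p ∈ J, ∀ k, p.1 < k → k < p.2 → (p.1, k) ∈ J

lemma isLeftClosed_pUP : IsLeftClosed (pUP T n) :=
  ⟨Finset.Subset.refl _, fun _ hp _ h1 h2 => pUP_left hp h1 h2.le⟩

/-- Up to the position `p`, row `p.1` of `u` agrees with that of the identity. Hence zeros on `J`
define a subgroup, and entries on `J` are constant on its cosets `Hv`. -/
lemma mul_apply_of_row_zero {J : Finset (Pos T n)} (hJ : IsLeftClosed J) {u : TU T n F}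
    (hu : ∀ p ∈ J, toMat u p.1 p.2 = 0) (v : TU T n F) {p : Pos T n} (hp : p ∈ J) :
    toMat (u * v) p.1 p.2 = toMat v p.1 p.2 := by
  rw [toMat_mul, Matrix.mul_apply, Finset.sum_eq_single p.1]
  · rw [toMat_diag, one_mul]
  · intro k _ hk
    rcases lt_or_gt_of_ne hk with h | h
    · rw [toMat_lower u h, zero_mul]
    · rcases lt_trichotomy k p.2 with h' | h' | h'
      · rw [hu _ (hJ.2 p hp k h h'), zero_mul]
      · rw [h', hu p hp, zero_mul]
      · rw [toMat_lower v h', mul_zero]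
  · simp

/-- The subgroup of `U` of the elements with zeros at a left closed set of positions. -/
def zeroSubgroup (F : Type*) [Field F] (J : Finset (Pos T n)) (hJ : IsLeftClosed J) :
    Subgroup (sylowU T n F) where
  carrier := {u | ∀ p ∈ J, toMat (u : TU T n F) p.1 p.2 = 0}
  one_mem' := by
    intro p hp
    have : p.1 < p.2 := Fin.lt_def.mpr (mem_pUP_iff.mp (hJ.1 hp)).1
    exact Matrix.one_apply_ne this.ne
  mul_mem' := by
    intro u v hu hv p hp
    exact (mul_apply_of_row_zero hJ hu v hp).trans (hv p hp)
  inv_mem' := by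
    intro u hu p hp
    have h := mul_apply_of_row_zero hJ hu (u : TU T n F)⁻¹ hp
    rw [mul_inv_cancel, toMat_one] at h
    have : p.1 < p.2 := Fin.lt_def.mpr (mem_pUP_iff.mp (hJ.1 hp)).1
    rw [Matrix.one_apply_ne this.ne] at h
    exact h.symm

lemma mem_zeroSubgroup {J : Finset (Pos T n)} {hJ : IsLeftClosed J} {u : sylowU T n F} :
    u ∈ zeroSubgroup F J hJ ↔ ∀ p ∈ J, toMat (u : TU T n F) p.1 p.2 = 0 := Iff.rfl

/-- The mirror fixes the antidiagonal, and outside type `C` all signs are `1`, so `u` and `u⁻¹` have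
the same entry there. In `u u⁻¹ = 1` this leaves twice the entry equal to zero. -/
lemma inv_apply_antidiagonal (hF : ringChar F ≠ 2) {u : TU T n F} (hu : u ∈ sylowU T n F)
    (hT : T ≠ .C) (a : Fin (dimN T n)) (ha : a < a.rev)
    (h : ∀ k, a < k → k < a.rev → toMat u a k = 0) : toMat u a a.rev = 0 := by
  have e1 : toMat u⁻¹ a a.rev = toMat u a a.rev := by
    rw [sylowU_inv_apply hu, sgn_of_ne hT, sgn_of_ne hT, Fin.rev_rev, one_mul, one_mul]
  have e2 : (toMat u * toMat u⁻¹) a a.rev = 0 := by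
    rw [toMat_mul_inv, Matrix.one_apply_ne ha.ne]
  rw [Matrix.mul_apply, Finset.sum_eq_add a a.rev ha.ne] at e2
  · rw [toMat_diag, toMat_diag, e1, one_mul, mul_one, ← two_mul] at e2
    exact (mul_eq_zero.mp e2).resolve_left (two_ne_zero_of_ringChar hF)
  · rintro k - ⟨h1, h2⟩
    rcases lt_or_gt_of_ne h1 with h3 | h3
    · rw [toMat_lower u h3, zero_mul]
    · rcases lt_or_gt_of_ne h2 with h4 | h4
      · rw [h k h3 h4, zero_mul]
      · rw [toMat_lower u⁻¹ h4, mul_zero]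
  · simp
  · simp

/-- An entry right of the antidiagonal is up to sign an entry of `u⁻¹` at a position of `pUP`, and
`u⁻¹` has zeros there too. So an element of `U` is trivial once its entries on `pUP` vanish. -/
lemma zeroSubgroup_pUP (hF : ringChar F ≠ 2) :
    zeroSubgroup F (pUP T n) isLeftClosed_pUP = ⊥ := by
  rw [eq_bot_iff]
  intro u hu
  have hu' := (zeroSubgroup F (pUP T n) isLeftClosed_pUP).inv_mem hu
  rw [mem_zeroSubgroup] at hu hu'
  rw [Subgroup.mem_bot]
  apply Subtype.ext
  apply toMat_injective
  ext a b
  rcases lt_trichotomy a b with h | h | h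
  · change _ = (1 : Mat T n F) a b
    rw [Matrix.one_apply_ne h.ne]
    have ha := val_rev_add a
    have hb := val_rev_add b
    by_cases h1 : (a, b) ∈ pUP T n
    · exact hu _ h1
    · by_cases h2 : b = a.rev
      · subst h2
        refine inv_apply_antidiagonal hF u.2 ?_ a h fun k h2 h3 => hu (a, k) ?_
        · intro hT
          exact h1 (mem_pUP_iff.mpr ⟨h, Or.inr ⟨hT, by omega⟩⟩)
        · rw [mem_pUP_iff]
          rw [Fin.lt_def] at h2 h3
          exact ⟨h2, Or.inl (by omega)⟩
      · have h2' : b.val ≠ a.rev.val := fun h => h2 (Fin.ext h)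
        rw [mem_pUP_iff] at h1
        rw [Fin.lt_def] at h
        have h3 : (b.rev, a.rev) ∈ pUP T n := mem_pUP_iff.mpr ⟨by omega, Or.inl (by omega)⟩
        have h4 := hu' _ h3
        have h5 := sylowU_inv_apply ((sylowU T n F).inv_mem u.2) a b
        rw [inv_inv] at h5
        rw [h5]
        exact mul_eq_zero_of_right _ h4
  · subst h
    change _ = (1 : Mat T n F) a a
    rw [toMat_diag, Matrix.one_apply_eq]
  · change _ = (1 : Mat T n F) a b
    rw [toMat_lower _ h, Matrix.one_apply_ne h.ne']

/-- The pattern subgroup of the complement of a left closed set is given by its zeros. -/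
lemma patternSubgroup_eq (hF : ringChar F ≠ 2) {J : Finset (Pos T n)} (hJ : IsLeftClosed J) :
    patternSubgroup F (pUP T n \ J) = zeroSubgroup F J hJ := by
  have hroot : ∀ p ∈ pUP T n, p ∉ J → ∀ c : F, ∀ x : sylowU T n F,
      toMat (x : TU T n F) = rootElt p c → x ∈ zeroSubgroup F J hJ := by
    intro p hp hpJ c x hx q hq
    have h1 := rootElt_mul_apply hp c (1 : TU T n F) (hJ.1 hq)
    have hlt : q.1 < q.2 := Fin.lt_def.mpr (mem_pUP_iff.mp (hJ.1 hq)).1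
    rw [toMat_one, Matrix.mul_one, Matrix.one_apply_ne hlt.ne, zero_add] at h1
    rw [hx]
    refine h1.trans ?_
    split_ifs with h2
    · rw [Matrix.one_apply_ne, mul_zero]
      intro h3
      exact hpJ (by rwa [show p = q from Prod.ext h2.symm h3])
    · rfl
  apply le_antisymm
  · rw [patternSubgroup, Subgroup.closure_le]
    rintro x ⟨p, hp, c, hx⟩
    rw [Finset.mem_sdiff] at hp
    exact hroot p hp.1 hp.2 c x hx
  -- The entries are cleared in row by row order by root elements outside `J`; `t` counts the keys
  -- treated and `s` those remaining. When none remain, the element is `1` by `zeroSubgroup_pUP`.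
  · have key : ∀ s t : ℕ, s + t = dimN T n * dimN T n → ∀ u ∈ zeroSubgroup F J hJ,
        (∀ p ∈ pUP T n, rowKey p < t → toMat (u : TU T n F) p.1 p.2 = 0) →
        u ∈ patternSubgroup F (pUP T n \ J) := by
      intro s
      induction s with
      | zero =>
        intro t ht u _ h
        have : u ∈ zeroSubgroup F (pUP T n) isLeftClosed_pUP := fun p hp =>
          h p hp (by rw [← ht.symm.trans (zero_add t)]; exact rowKey_lt p)
        rw [zeroSubgroup_pUP hF, Subgroup.mem_bot] at this
        rw [this]
        exact one_mem _
      | succ s ih =>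
        intro t ht u hu h
        by_cases hp : ∃ p ∈ pUP T n, rowKey p = t ∧ p ∉ J
        · obtain ⟨p, hp, rfl, hpJ⟩ := hp
          obtain ⟨x, hx, hx'⟩ := exists_rootElt hF hp (-toMat (u : TU T n F) p.1 p.2)
          have hxJ : (⟨x, hx⟩ : sylowU T n F) ∈ zeroSubgroup F J hJ := hroot p hp hpJ _ _ hx'
          have hxP : (⟨x, hx⟩ : sylowU T n F) ∈ patternSubgroup F (pUP T n \ J) :=
            Subgroup.subset_closure ⟨p, Finset.mem_sdiff.mpr ⟨hp, hpJ⟩, _, hx'⟩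
          have := ih (rowKey p + 1) (by omega) (⟨x, hx⟩ * u) (mul_mem hxJ hu) (by
            intro q hq hqt
            change toMat (x * (u : TU T n F)) q.1 q.2 = 0
            rw [toMat_mul, hx']
            rcases Nat.lt_succ_iff_lt_or_eq.mp hqt with hlt | heq
            · exact (rootElt_mul_apply_of_lt hp hq hlt _ _).trans (h q hq hlt)
            · rw [rowKey_eq_iff.mp heq]
              exact (rootElt_mul_apply_self hp _ _).trans (by ring))
          exact (Subgroup.mul_mem_cancel_left _ hxP).mp this
        · refine ih (t + 1) (by omega) u hu fun q hq hqt => ?_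
          rcases Nat.lt_succ_iff_lt_or_eq.mp hqt with hlt | heq
          · exact h q hq hlt
          · by_cases hqJ : q ∈ J
            · exact hu q hqJ
            · exact absurd ⟨q, hq, heq, hqJ⟩ hp
    intro u hu
    exact key _ 0 (add_zero _) u hu (by simp)

lemma isLeftClosed_rho (p : Pos T n) : IsLeftClosed (rho p) := by
  unfold rho
  split_ifs with h
  · refine ⟨Finset.filter_subset _ _, fun q hq k h1 h2 => ?_⟩
    rw [Finset.mem_filter] at hq ⊢
    exact ⟨pUP_left hq.1 h1 h2.le, hq.2.1, h2.trans hq.2.2⟩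
  · refine ⟨Finset.filter_subset _ _, fun q hq k h1 h2 => ?_⟩
    rw [Finset.mem_filter] at hq ⊢
    rw [Fin.lt_def] at h2
    exact ⟨pUP_left hq.1 h1 (Fin.le_def.mpr h2.le),
      hq.2.imp (fun h => ⟨h.1, h2.trans h.2⟩) fun h => ⟨h.1, h2.trans h.2⟩⟩

lemma mem_elemSubgroup (hF : ringChar F ≠ 2) {p : Pos T n} {u : sylowU T n F} :
    u ∈ elemSubgroup F p ↔ ∀ r ∈ rho p, toMat (u : TU T n F) r.1 r.2 = 0 := by
  rw [elemSubgroup, patternSubgroup_eq hF (isLeftClosed_rho p), mem_zeroSubgroup]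

/-- The entries of `u⁻¹` on `rho p` are constant on the left cosets of `U_{ij}`, and they can be
prescribed arbitrarily by `exists_sylowU_apply_eq`. This inequality is what the dimension count in
`elemModule_eq` needs. -/
lemma card_le_index [Finite F] (hF : ringChar F ≠ 2) (p : Pos T n) :
    Nat.card F ^ (rho p).card ≤ (elemSubgroup F p).index := by
  classical
  have hJ := isLeftClosed_rho p
  have : Finite (GL (Fin (dimN T n)) F) := inferInstance
  let f : (sylowU T n F ⧸ elemSubgroup F p) → (rho p → F) := fun c =>
    Quotient.liftOn' c (fun u r => toMat ((u⁻¹ : sylowU T n F) : TU T n F) r.1.1 r.1.2) (by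
      intro a b hab
      funext r
      rw [QuotientGroup.leftRel_apply, elemSubgroup, patternSubgroup_eq hF hJ] at hab
      have := mul_apply_of_row_zero hJ hab (b⁻¹ : sylowU T n F) r.2
      rw [← this]
      congr 3
      simp)
  have hf : Function.Surjective f := by
    intro g
    obtain ⟨u, hu, h⟩ := exists_sylowU_apply_eq hF
      fun r : Pos T n => if hr : r ∈ rho p then g ⟨r, hr⟩ else 0
    refine ⟨Quotient.mk'' ((⟨u, hu⟩ : sylowU T n F)⁻¹), ?_⟩
    funext r
    have := h r.1 (hJ.1 r.2)
    rw [dif_pos r.2] at this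
    simp only [f, Quotient.liftOn'_mk'', inv_inv]
    exact this
  have := Nat.card_le_card_of_surjective f hf
  rw [Nat.card_fun, Nat.card_eq_fintype_card (α := rho p), Fintype.card_coe] at this
  exact this

/-! ### The action on the labels of the characters -/

/-- The action of `Ũ` on `V` for which `[A].u = [act u A]`. -/
def act (u : TU T n F) (A : V T n F) : V T n F :=
  proj ((A : Mat T n F) * (toMat u⁻¹).transpose)

lemma act_apply (u : TU T n F) (A : V T n F) {i j : Fin (dimN T n)} (h : (i, j) ∈ pUP T n) :
    (act u A : Mat T n F) i j = ((A : Mat T n F) * (toMat u⁻¹).transpose) i j := by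
  rw [act, proj_apply, if_pos h]

lemma kappa_apply (A B : V T n F) :
    kappa A B = ∑ i, ∑ j, (A : Mat T n F) i j * (B : Mat T n F) i j := by
  change ((A : Mat T n F).transpose * (B : Mat T n F)).trace = _
  rw [Matrix.trace, Finset.sum_comm]
  simp [Matrix.mul_apply]

lemma kappa_add (A A' : V T n F) : kappa (A + A') = kappa A + kappa A' := by
  ext B
  rw [AddMonoidHom.add_apply, kappa_apply, kappa_apply, kappa_apply, ← Finset.sum_add_distrib]
  refine Finset.sum_congr rfl fun i _ => ?_
  rw [← Finset.sum_add_distrib]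
  exact Finset.sum_congr rfl fun j _ => by rw [Submodule.coe_add, Matrix.add_apply, add_mul]

/-- The trace form of `π(M)` and `B ∈ V` is that of `M` and `B`. -/
lemma kappa_proj_left (M : Mat T n F) (B : V T n F) :
    kappa (proj M) B = (M.transpose * (B : Mat T n F)).trace := by
  rw [kappa_apply, Matrix.trace, Finset.sum_comm]
  refine Finset.sum_congr rfl fun j _ => ?_
  rw [Matrix.diag_apply, Matrix.mul_apply]
  refine Finset.sum_congr rfl fun i _ => ?_
  rw [proj_apply, Matrix.transpose_apply]
  split_ifs with h
  · rfl
  · rw [B.2 i j h, mul_zero, mul_zero]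

lemma kappa_comm (A B : V T n F) : kappa A B = kappa B A := by
  rw [kappa_apply, kappa_apply]
  simp_rw [mul_comm]

lemma bracket_apply (θ : AddChar F ℂ) (A B : V T n F) : bracket θ A B = θ (-kappa A B) := rfl

lemma bracket_add (θ : AddChar F ℂ) (A A' : V T n F) :
    bracket θ (A + A') = bracket θ A * bracket θ A' := by
  ext B
  rw [AddChar.mul_apply, bracket_apply, bracket_apply, bracket_apply, kappa_add,
    AddMonoidHom.add_apply, neg_add, AddChar.map_add_eq_mul]

lemma bracket_zero (θ : AddChar F ℂ) : bracket θ (0 : V T n F) = 1 := by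
  ext B
  rw [bracket_apply, kappa_apply]
  simp

/-- Right multiplication by `u⁻¹` is adjoint to right multiplication by `u⁻ᵗ` for the trace form,
and truncation is harmless when the other argument lies in `V`. -/
lemma charDot_bracket (θ : AddChar F ℂ) (A : V T n F) (u : TU T n F) :
    charDot (bracket θ A) u = bracket θ (act u A) := by
  ext B
  rw [charDot_apply, bracket_apply, bracket_apply, kappa_comm, dot_apply, kappa_proj_left, act,
    kappa_proj_left, Matrix.transpose_mul, Matrix.transpose_mul, Matrix.transpose_transpose,
    Matrix.mul_assoc, Matrix.mul_assoc]
  rw [← Matrix.trace_transpose, Matrix.transpose_mul, Matrix.transpose_mul,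
    Matrix.transpose_transpose, Matrix.transpose_transpose, Matrix.mul_assoc,
    Matrix.trace_mul_comm, Matrix.mul_assoc, Matrix.trace_mul_comm, Matrix.mul_assoc]

/-- The element `c e_p` of `V`, for `p ∈ pUP`. -/
def singleV (p : Pos T n) (hp : p ∈ pUP T n) (c : F) : V T n F :=
  ⟨Matrix.single p.1 p.2 c, by
    intro i j h
    rw [Matrix.single_apply_of_ne]
    rintro ⟨rfl, rfl⟩
    exact h hp⟩

lemma kappa_singleV (A : V T n F) (p : Pos T n) (hp : p ∈ pUP T n) (c : F) :
    kappa A (singleV p hp c) = (A : Mat T n F) p.1 p.2 * c := by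
  change ((A : Mat T n F).transpose * Matrix.single p.1 p.2 c).trace = _
  rw [Matrix.trace_mul_single]
  simp [Matrix.transpose_apply, mul_comm]

lemma eq_zero_of_forall_addChar_eq_one {θ : AddChar F ℂ} (hθ : θ ≠ 1) {a : F}
    (h : ∀ c, θ (a * c) = 1) : a = 0 := by
  by_contra ha
  apply hθ
  ext c
  rw [AddChar.one_apply, ← h (a⁻¹ * c), mul_inv_cancel_left₀ ha]

lemma bracket_injective {θ : AddChar F ℂ} (hθ : θ ≠ 1) :
    Function.Injective (bracket θ : V T n F → AddChar (V T n F) ℂ) := by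
  intro A A' h
  apply Subtype.ext
  ext i j
  by_cases hp : (i, j) ∈ pUP T n
  · rw [← sub_eq_zero]
    apply eq_zero_of_forall_addChar_eq_one hθ
    intro c
    have h1 := DFunLike.congr_fun h (singleV (i, j) hp c)
    rw [bracket_apply, bracket_apply, kappa_singleV, kappa_singleV] at h1
    rw [sub_mul, sub_eq_neg_add, AddChar.map_add_eq_mul, ← neg_neg ((A : Mat T n F) i j * c)]
    simp only at h1
    rw [AddChar.map_neg_eq_inv θ (-_), h1, mul_inv_cancel₀]
    exact (AddChar.val_isUnit _ _).ne_zero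
  · rw [A.2 i j hp, A'.2 i j hp]

/-! ### Verges -/

lemma exists_mainCond {A : V T n F} {i k : Fin (dimN T n)} (h : (A : Mat T n F) i k ≠ 0) :
    ∃ j, k ≤ j ∧ (i, j) ∈ mainCond A := by
  classical
  let s := Finset.univ.filter fun j => (A : Mat T n F) i j ≠ 0
  have hs : s.Nonempty := ⟨k, by simpa [s] using h⟩
  have hm := s.max'_mem hs
  refine ⟨s.max' hs, s.le_max' k (by simpa [s] using h), ?_, ?_, ?_⟩
  · by_contra h'
    exact (Finset.mem_filter.mp hm).2 (A.2 _ _ h')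
  · exact (Finset.mem_filter.mp hm).2
  · intro m hm'
    by_contra h'
    exact absurd (s.le_max' m (by simpa [s] using h')) (not_le.mpr hm')

lemma mainCond_unique {A : V T n F} {i j j' : Fin (dimN T n)} (h : (i, j) ∈ mainCond A)
    (h' : (i, j') ∈ mainCond A) : j = j' := by
  rcases lt_trichotomy j j' with hlt | heq | hlt
  · exact absurd (h.2.2 j' hlt) h'.2.1
  · exact heq
  · exact absurd (h'.2.2 j hlt) h.2.1

lemma le_of_mainCond {A : V T n F} {i j k : Fin (dimN T n)} (h : (i, j) ∈ mainCond A)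
    (h' : (A : Mat T n F) i k ≠ 0) : k ≤ j := by
  by_contra hlt
  exact h' (h.2.2 k (not_le.mp hlt))

open Classical in
lemma verge_apply (A : V T n F) (i j : Fin (dimN T n)) :
    (verge A : Mat T n F) i j = if (i, j) ∈ mainCond A then (A : Mat T n F) i j else 0 := rfl

lemma verge_apply_of_mem {A : V T n F} {i j : Fin (dimN T n)} (h : (i, j) ∈ mainCond A) :
    (verge A : Mat T n F) i j = (A : Mat T n F) i j := by
  rw [verge_apply, if_pos h]

lemma mainCond_verge (A : V T n F) : mainCond (verge A) = mainCond A := by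
  ext ⟨i, j⟩
  constructor
  · rintro ⟨h1, h2, h3⟩
    by_contra h
    rw [verge_apply, if_neg h] at h2
    exact h2 rfl
  · intro h
    refine ⟨h.1, ?_, fun k hk => ?_⟩
    · simp only
      rw [verge_apply_of_mem h]; exact h.2.1
    · simp only
      rw [verge_apply, h.2.2 k hk, ite_self]

lemma mainCond_eq_of_verge_eq {A B : V T n F} (h : verge B = verge A) :
    mainCond B = mainCond A := by
  rw [← mainCond_verge, h, mainCond_verge]

lemma verge_eq_iff {A B : V T n F} : verge B = verge A ↔
    ∀ i, ((∀ k, (A : Mat T n F) i k = 0) → ∀ k, (B : Mat T n F) i k = 0) ∧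
      ∀ j, (i, j) ∈ mainCond A →
        (B : Mat T n F) i j = (A : Mat T n F) i j ∧ ∀ k, j < k → (B : Mat T n F) i k = 0 := by
  constructor
  · intro h i
    have hm := mainCond_eq_of_verge_eq h
    refine ⟨fun h0 k => ?_, fun j hj => ?_⟩
    · by_contra h1
      obtain ⟨j, -, hj⟩ := exists_mainCond h1
      rw [hm] at hj
      exact hj.2.1 (h0 j)
    · rw [← verge_apply_of_mem hj, ← h, verge_apply_of_mem (hm ▸ hj)]
      exact ⟨rfl, (hm ▸ hj : (i, j) ∈ mainCond B).2.2⟩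
  · intro h
    have hm : mainCond B = mainCond A := by
      have h1 : ∀ i j, (i, j) ∈ mainCond A → (i, j) ∈ mainCond B := fun i j hj =>
        ⟨hj.1, by simp only; rw [((h i).2 j hj).1]; exact hj.2.1, ((h i).2 j hj).2⟩
      ext ⟨i, j⟩
      refine ⟨fun hj => ?_, h1 i j⟩
      by_cases h0 : ∀ k, (A : Mat T n F) i k = 0
      · exact absurd ((h i).1 h0 j) hj.2.1
      · push Not at h0
        obtain ⟨k, hk⟩ := h0
        obtain ⟨j', -, hj'⟩ := exists_mainCond hk
        rwa [mainCond_unique hj (h1 i j' hj')]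
    apply Subtype.ext
    ext i j
    by_cases hj : (i, j) ∈ mainCond A
    · rw [verge_apply_of_mem hj, verge_apply_of_mem (hm ▸ hj), ((h i).2 j hj).1]
    · rw [verge_apply, verge_apply, hm, if_neg hj, if_neg hj]

/-- The transpose is lower unitriangular, so an entry is changed only by entries on its right in the
same row. -/
lemma mul_transpose_apply_of_row {B : V T n F} (u : TU T n F) {i j : Fin (dimN T n)}
    (h : ∀ k, j < k → (B : Mat T n F) i k = 0) :
    ((B : Mat T n F) * (toMat u).transpose) i j = (B : Mat T n F) i j := by
  rw [Matrix.mul_apply, Finset.sum_eq_single j]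
  · rw [Matrix.transpose_apply, toMat_diag, mul_one]
  · intro k _ hk
    rw [Matrix.transpose_apply]
    rcases lt_or_gt_of_ne hk with h' | h'
    · rw [toMat_lower u h', mul_zero]
    · rw [h k h', zero_mul]
  · simp

lemma verge_act (u : TU T n F) (B : V T n F) : verge (act u B) = verge B := by
  have key : ∀ i j, (∀ k, j < k → (B : Mat T n F) i k = 0) →
      (act u B : Mat T n F) i j = (B : Mat T n F) i j := by
    intro i j h
    by_cases hp : (i, j) ∈ pUP T n
    · rw [act_apply u B hp, mul_transpose_apply_of_row _ h]
    · rw [(act u B).2 i j hp, B.2 i j hp]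
  rw [verge_eq_iff]
  refine fun i => ⟨fun h k => ?_, fun j hj => ⟨?_, fun k hk => ?_⟩⟩
  · rw [key i k fun _ _ => h _, h]
  · exact key i j hj.2.2
  · rw [key i k fun m hm => hj.2.2 m (hk.trans hm)]
    exact hj.2.2 k hk

open Classical in
/-- `Ũ` permutes transitively the matrices with a given staircase verge. -/
lemma exists_act_eq {A B : V T n F} (hA : verge A = A) (hs : IsStaircase A)
    (h : verge B = A) : ∃ u : TU T n F, act u A = B := by
  have h' := verge_eq_iff.mp (h.trans hA.symm)
  -- Row `i` of `A` has the single entry `A i j`, so `(A Lᵗ) i k = A i j * L k j`; this dictates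
  -- column `j` of `L`. The staircase condition makes the row `i` with main condition in column `j`
  -- unique.
  let L : Mat T n F := Matrix.of fun k j => if k = j then 1 else
    if h : k < j ∧ ∃ i, (i, j) ∈ mainCond A then
      (B : Mat T n F) h.2.choose k / (A : Mat T n F) h.2.choose j else 0
  obtain ⟨v, hv⟩ := exists_toMat_eq L
    (fun i j hij => by simp [L, hij.ne', not_lt_of_gt hij]) (fun i => by simp [L])
  refine ⟨v⁻¹, Subtype.ext ?_⟩
  ext i k
  by_cases hp : (i, k) ∈ pUP T n
  swap
  · rw [(act v⁻¹ A).2 i k hp, B.2 i k hp]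
  rw [act_apply _ _ hp, inv_inv, Matrix.mul_apply]
  by_cases h0 : ∀ k, (A : Mat T n F) i k = 0
  · rw [(h' i).1 h0 k]
    exact Finset.sum_eq_zero fun m _ => by rw [h0, zero_mul]
  push Not at h0
  obtain ⟨m, hm⟩ := h0
  obtain ⟨j, -, hj⟩ := exists_mainCond hm
  obtain ⟨e1, e2⟩ := (h' i).2 j hj
  rw [Finset.sum_eq_single j]
  · rw [Matrix.transpose_apply, hv]
    rcases lt_trichotomy k j with hk | hk | hk
    · have hex : k < j ∧ ∃ i, (i, j) ∈ mainCond A := ⟨hk, i, hj⟩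
      have hi : hex.2.choose = i := congr_arg Prod.fst (hs _ hex.2.choose_spec _ hj rfl)
      simp only [L, Matrix.of_apply]
      rw [if_neg hk.ne, dif_pos hex, hi, mul_div_cancel₀ _ hj.2.1]
    · subst hk
      simp [L, e1]
    · simp [L, hk.ne', not_lt_of_gt hk, e2 k hk]
  · intro m _ hm
    have : (A : Mat T n F) i m = 0 := by
      rw [← hA, verge_apply, if_neg]
      exact fun h => hm (mainCond_unique h hj)
    rw [this, zero_mul]
  · simp

lemma tildeOrbit_eq_vergeSet (θ : AddChar F ℂ) {A : V T n F} (hA : verge A = A)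
    (hs : IsStaircase A) : tildeOrbit θ A = vergeSet θ A := by
  ext χ
  constructor
  · rintro ⟨u, -, rfl⟩
    exact ⟨act u A, verge_act u A, charDot_bracket θ A u⟩
  · rintro ⟨B, hB, rfl⟩
    obtain ⟨u, rfl⟩ := exists_act_eq hA hs (hB.trans hA)
    exact ⟨u, Subgroup.mem_top u, (charDot_bracket θ A u).symm⟩

/-! ### The orbit invariants -/

lemma mul_gram_mul_transpose_apply (M : Mat T n F) (i a : Fin (dimN T n)) :
    (M * gram T n F * M.transpose) i a = ∑ k, M i k.rev * sgn T n F k.rev * M a k := by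
  rw [Matrix.mul_apply]
  exact Finset.sum_congr rfl fun k _ => by rw [mul_gram_apply, Matrix.transpose_apply]

/-- The form of two rows is a `U`-invariant, if these are orthogonal to the truncated parts. -/
lemma act_form_apply {u : TU T n F} (hu : u ∈ sylowU T n F) (B : V T n F)
    {i a : Fin (dimN T n)} (hi : ∀ k, (B : Mat T n F) i k ≠ 0 → k < a.rev)
    (ha : ∀ k, (B : Mat T n F) a k ≠ 0 → k < i.rev) :
    ((act u B : Mat T n F) * gram T n F * (act u B : Mat T n F).transpose) i a =
      ((B : Mat T n F) * gram T n F * (B : Mat T n F).transpose) i a := by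
  have h1 : ((B : Mat T n F) * (toMat u⁻¹).transpose) * gram T n F *
      ((B : Mat T n F) * (toMat u⁻¹).transpose).transpose =
      (B : Mat T n F) * gram T n F * (B : Mat T n F).transpose := by
    rw [Matrix.transpose_mul, Matrix.transpose_transpose]
    calc _ = (B : Mat T n F) * ((toMat u⁻¹).transpose * gram T n F * toMat u⁻¹) *
        (B : Mat T n F).transpose := by simp only [Matrix.mul_assoc]
      _ = _ := by rw [sylowU_inv_transpose hu]
  rw [← h1, mul_gram_mul_transpose_apply, mul_gram_mul_transpose_apply]
  have hex : ∀ x k, ((B : Mat T n F) * (toMat u⁻¹).transpose) x k ≠ 0 →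
      ∃ m, k ≤ m ∧ (B : Mat T n F) x m ≠ 0 := by
    intro x k h
    by_contra! h'
    apply h
    rw [Matrix.mul_apply]
    refine Finset.sum_eq_zero fun m _ => ?_
    rcases le_or_gt k m with hk | hk
    · rw [h' m hk, zero_mul]
    · rw [Matrix.transpose_apply, toMat_lower _ hk, mul_zero]
  refine Finset.sum_congr rfl fun k _ => ?_
  rw [act, proj_apply, proj_apply]
  split_ifs with p1 p2 p2
  · rfl
  -- If a term with a truncated factor were nonzero, the hypotheses on the rows `i` and `a` would
  -- place `k̄` and `k` right of the diagonal and weakly left of positions of `pUP`. Both factors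
  -- would then lie in `pUP` and would not be truncated.
  all_goals
    symm
    simp only [zero_mul, mul_zero]
    by_contra h
    obtain ⟨m1, hm1, hm1'⟩ := hex i k.rev (left_ne_zero_of_mul (left_ne_zero_of_mul h))
    obtain ⟨m2, hm2, hm2'⟩ := hex a k (right_ne_zero_of_mul h)
    have q1 : (i, m1) ∈ pUP T n := by
      by_contra hq; exact hm1' (B.2 _ _ hq)
    have q2 : (a, m2) ∈ pUP T n := by
      by_contra hq; exact hm2' (B.2 _ _ hq)
    have l1 := hi m1 hm1'
    have l2 := ha m2 hm2'
    have k1 : a < k := by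
      rw [← Fin.rev_lt_rev]; exact lt_of_le_of_lt hm1 l1
    have k2 : i < k.rev := by
      rw [← Fin.rev_lt_rev, Fin.rev_rev]; exact lt_of_le_of_lt hm2 l2
    first
      | exact p1 (pUP_left q1 k2 hm1)
      | exact p2 (pUP_left q2 k1 hm2)

/-! ### Cores -/

/-- The root elements once more, for all positions above the diagonal which belong to a root. -/
lemma exists_root (hF : ringChar F ≠ 2) {k l : Fin (dimN T n)} (hkl : k < l)
    (h : l = k.rev → T = .C) (c : F) :
    ∃ u ∈ sylowU T n F, ∃ c' d d' : F, (l ≠ l.rev → d = 0) ∧ (k ≠ k.rev → d' = 0) ∧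
      (l = k.rev → c' = 0) ∧
      toMat u = 1 + Matrix.single k l c + Matrix.single l.rev k.rev c' + Matrix.single k k.rev d +
        Matrix.single l.rev l d' := by
  have hk := val_rev_add k
  have hl := val_rev_add l
  have hkl' := Fin.lt_def.mp hkl
  rcases lt_trichotomy l k.rev with h1 | h1 | h1
  · have hp : (k, l) ∈ pUP T n := mem_pUP_iff.mpr ⟨hkl, Or.inl (by rw [Fin.lt_def] at h1; omega)⟩
    obtain ⟨u, hu, hu'⟩ := exists_rootElt hF hp c
    refine ⟨u, hu, ?_⟩
    unfold rootElt at hu'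
    simp only at hu'
    rw [if_neg h1.ne] at hu'
    split_ifs at hu' with h2 h3
    · refine ⟨-c, -(2⁻¹ * c ^ 2), 0, fun h => absurd h2 h, fun _ => rfl,
        fun h => absurd h h1.ne, ?_⟩
      rw [hu', ← h2]; simp [Matrix.single_neg, sub_eq_add_neg]
    · exact ⟨c, 0, 0, fun _ => rfl, fun _ => rfl, fun h => absurd h h1.ne, by rw [hu']; simp⟩
    · exact ⟨-c, 0, 0, fun _ => rfl, fun _ => rfl, fun h => absurd h h1.ne, by
        rw [hu']; simp [Matrix.single_neg, sub_eq_add_neg]⟩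
  · have hp : (k, l) ∈ pUP T n := mem_pUP_iff.mpr ⟨hkl, Or.inr ⟨h h1, by subst h1; omega⟩⟩
    obtain ⟨u, hu, hu'⟩ := exists_rootElt hF hp c
    refine ⟨u, hu, 0, 0, 0, fun _ => rfl, fun _ => rfl, fun _ => rfl, ?_⟩
    rw [hu', rootElt, if_pos h1]; simp
  -- Right of the antidiagonal, `(k, l)` is the mirror of a position of `pUP`; the root element
  -- there is used, with parameter `±c` so that its entry at `(k, l)` is `c`.
  · have hp : (l.rev, k.rev) ∈ pUP T n :=
      mem_pUP_iff.mpr ⟨by omega, Or.inl (by rw [Fin.lt_def] at h1; omega)⟩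
    have hroot := exists_rootElt hF hp
    unfold rootElt at hroot
    simp only [Fin.rev_rev, if_neg h1.ne] at hroot
    by_cases h2 : k.rev = k
    · obtain ⟨u, hu, hu'⟩ := hroot (-c)
      rw [if_pos h2] at hu'
      refine ⟨u, hu, -c, 0, -(2⁻¹ * (-c) ^ 2), fun _ => rfl, fun h => absurd h2.symm h,
        fun h => absurd h h1.ne', ?_⟩
      rw [hu', h2]
      simp only [Matrix.single_neg, sub_eq_add_neg, neg_neg, Matrix.single_zero]
      abel
    · simp only [if_neg h2] at hroot
      by_cases h3 : T = .C ∧ n ≤ k.rev.val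
      · obtain ⟨u, hu, hu'⟩ := hroot c
        rw [if_pos h3] at hu'
        refine ⟨u, hu, c, 0, 0, fun _ => rfl, fun _ => rfl, fun h => absurd h h1.ne', ?_⟩
        rw [hu']; simp only [Matrix.single_zero]; abel
      · obtain ⟨u, hu, hu'⟩ := hroot (-c)
        rw [if_neg h3] at hu'
        refine ⟨u, hu, -c, 0, 0, fun _ => rfl, fun _ => rfl, fun h => absurd h h1.ne', ?_⟩
        rw [hu']
        simp only [Matrix.single_neg, sub_eq_add_neg, neg_neg, Matrix.single_zero]; abel

/-- The action of a root element as column operations: column `l` into column `k`, its mirror,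
column `k̄` into column `l̄`, and the two correction terms of type `B`. -/
lemma act_inv_apply_of_eq {u : TU T n F} {k l : Fin (dimN T n)} {c c' d d' : F}
    (hu : toMat u = 1 + Matrix.single k l c + Matrix.single l.rev k.rev c' +
      Matrix.single k k.rev d + Matrix.single l.rev l d') (B : V T n F) {a b : Fin (dimN T n)}
    (hp : (a, b) ∈ pUP T n) :
    (act u⁻¹ B : Mat T n F) a b = (B : Mat T n F) a b +
      (if b = k then (B : Mat T n F) a l * c else 0) +
      (if b = l.rev then (B : Mat T n F) a k.rev * c' else 0) +
      (if b = k then (B : Mat T n F) a k.rev * d else 0) +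
      (if b = l.rev then (B : Mat T n F) a l * d' else 0) := by
  rw [act_apply _ _ hp, inv_inv, hu]
  simp only [Matrix.transpose_add, Matrix.transpose_one, Matrix.transpose_single, Matrix.mul_add,
    Matrix.mul_one, Matrix.add_apply, mul_single_apply]

lemma core_eq_of_mainCond_eq {A B : V T n F} (h : mainCond B = mainCond A) : core B = core A := by
  have h1 : rightMain B = rightMain A := by unfold rightMain; rw [h]
  have h2 : leftMain B = leftMain A := by unfold leftMain; rw [h]
  have h3 : minorCond B = minorCond A := by unfold minorCond; rw [h1]
  have h4 : supplCond B = supplCond A := by unfold supplCond; rw [h, h2, h3]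
  unfold core
  rw [h, h3, h4]

lemma mem_pUP_of_ne_zero {A : V T n F} {i j : Fin (dimN T n)} (h : (A : Mat T n F) i j ≠ 0) :
    (i, j) ∈ pUP T n := by
  by_contra h'
  exact h (A.2 i j h')

lemma mem_leftMain_or_rightMain {A : V T n F} {p : Pos T n} (h : p ∈ mainCond A) :
    (p ∈ leftMain A ∧ p.2.val < tildeN T n) ∨ (p ∈ rightMain A ∧ tildeN T n ≤ p.2.val) := by
  rcases lt_or_ge p.2.val (tildeN T n) with h1 | h1
  · exact Or.inl ⟨⟨h, Finset.mem_filter.mpr ⟨h.1, h1⟩⟩, h1⟩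
  · exact Or.inr ⟨⟨h, Finset.mem_filter.mpr ⟨h.1, h1⟩⟩, h1⟩

/-- The position `(a, l̄)` belongs to the core, if `(i, l)` is a main condition, and the main
condition of row `a` is on its left and right of `(a, l̄)`. -/
lemma mem_core_of_lt {A : V T n F} {i k l a j : Fin (dimN T n)} (hi : (i, l) ∈ mainCond A)
    (ha : (a, j) ∈ mainCond A) (hjl : j < l) (hkl : k < l) (hkj : k.rev ≤ j) (hlj : l.rev < j)
    (hp : (a, l.rev) ∈ pUP T n) : (a, l.rev) ∈ core A := by
  have hk := val_rev_add k
  have hl := val_rev_add l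
  have hj := val_rev_add j
  have hN := dimN_eq T n
  have hn : n ≤ tildeN T n ∧ tildeN T n ≤ n + 1 := by rcases tildeN_eq T n with h | h <;> omega
  rw [Fin.lt_def] at hjl hkl hlj
  rw [Fin.le_def] at hkj
  have hr : (i, l) ∈ rightMain A := by
    rcases mem_leftMain_or_rightMain hi with ⟨-, h⟩ | ⟨h, -⟩
    · simp only at h
      omega
    · exact h
  have hr' : tildeN T n ≤ l.val := (Finset.mem_filter.mp hr.2).2
  have hmin : (i, l.rev) ∈ minorCond A := by
    change (i, l.rev.rev) ∈ rightMain A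
    rwa [Fin.rev_rev]
  refine Or.inr (Or.inr ⟨Finset.mem_filter.mpr ⟨hp, by simp only; omega⟩, ?_, ⟨i, hmin⟩, ?_, ?_⟩)
  · rcases mem_leftMain_or_rightMain ha with ⟨h, -⟩ | ⟨h, -⟩
    · exact ⟨j, by simpa [Fin.lt_def] using hlj, Or.inr h⟩
    · refine ⟨j.rev, by simpa using hjl, Or.inl ?_⟩
      change (a, j.rev.rev) ∈ rightMain A
      rwa [Fin.rev_rev]
  · intro h
    change (a, l.rev.rev) ∈ rightMain A at h
    rw [Fin.rev_rev] at h
    have := mainCond_unique h.1 ha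
    omega
  · intro h
    have := congr_arg Fin.val (mainCond_unique h ha)
    omega

/-- Positions in the order in which they are cleared: by the columns of the main conditions of the
rows, and from right to left in the rows. -/
def clearKey (j k : Fin (dimN T n)) : ℕ := j.val * dimN T n + k.rev.val

lemma clearKey_lt_of_lt {j k j' k' : Fin (dimN T n)} (h : j < j') :
    clearKey j k < clearKey j' k' := by
  have h1 := k.rev.2
  rw [Fin.lt_def] at h
  have : j.val * dimN T n + dimN T n ≤ j'.val * dimN T n := by
    rw [← Nat.succ_mul]; exact Nat.mul_le_mul_right _ h
  unfold clearKey
  omega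

lemma clearKey_lt_of_lt_right (j : Fin (dimN T n)) {k k' : Fin (dimN T n)} (h : k' < k) :
    clearKey j k < clearKey j k' := by
  unfold clearKey
  have := Fin.lt_def.mp (Fin.rev_lt_rev.mpr h)
  omega

lemma clearKey_eq_iff {j k j' k' : Fin (dimN T n)} :
    clearKey j k = clearKey j' k' ↔ j = j' ∧ k = k' := by
  refine ⟨fun h => ?_, fun h => by rw [h.1, h.2]⟩
  rcases lt_trichotomy j j' with h1 | h1 | h1
  · exact absurd h (clearKey_lt_of_lt h1).ne
  · subst h1
    refine ⟨rfl, ?_⟩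
    rcases lt_trichotomy k k' with h2 | h2 | h2
    · exact absurd h (clearKey_lt_of_lt_right j h2).ne'
    · exact h2
    · exact absurd h (clearKey_lt_of_lt_right j h2).ne
  · exact absurd h (clearKey_lt_of_lt h1).ne'

/-- A position outside of the core can be cleared. -/
lemma exists_clear (hF : ringChar F ≠ 2) {A B : V T n F} (hs : IsStaircase A)
    (hB : verge B = verge A) {i k l : Fin (dimN T n)} (hi : (i, l) ∈ mainCond A)
    (hik : (i, k) ∈ pUP T n) (hkl : k < l) (hc : (i, k) ∉ core A)
    (h : ∀ a j b, (a, j) ∈ mainCond A → (a, b) ∈ pUP T n → b < j → (a, b) ∉ core A →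
      clearKey j b < clearKey l k → (B : Mat T n F) a b = 0) :
    ∃ u ∈ sylowU T n F, ∀ a j b, (a, j) ∈ mainCond A → (a, b) ∈ pUP T n → b < j →
      (a, b) ∉ core A → clearKey j b < clearKey l k + 1 → (act u B : Mat T n F) a b = 0 := by
  have hm : mainCond B = mainCond A := mainCond_eq_of_verge_eq hB
  -- Clearing an antidiagonal partner would need an antidiagonal root, which only type `C` has. In
  -- the other types such a position is a minor condition and belongs to the core.
  have hC : l = k.rev → T = .C := by
    intro h1
    by_contra hT
    refine hc (Or.inr (Or.inl ⟨hT, ?_⟩))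
    change (i, k.rev) ∈ rightMain A
    rw [← h1]
    rcases mem_leftMain_or_rightMain hi with ⟨-, h⟩ | ⟨h, -⟩
    · simp only at h
      have hk := val_rev_add k
      have hN := dimN_eq T n
      have h1' := congr_arg Fin.val h1
      rw [Fin.lt_def] at hkl
      rcases tildeN_eq T n with h' | h' <;> omega
    · exact h
  have hA0 : (B : Mat T n F) i l ≠ 0 := (hm ▸ hi : (i, l) ∈ mainCond B).2.1
  -- The main entry at `(i, l)` is used to clear `(i, k)` by adding a multiple of column `l` to
  -- column `k`.
  obtain ⟨u, hu, c', d, d', hd, hd', hc', hu'⟩ :=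
    exists_root hF hkl hC (-((B : Mat T n F) i k / (B : Mat T n F) i l))
  refine ⟨u⁻¹, inv_mem hu, fun a j b ha hp hbj hcore hkey => ?_⟩
  rw [act_inv_apply_of_eq hu' B hp]
  have hle : ∀ m, (B : Mat T n F) a m ≠ 0 → m ≤ j := fun m hm' =>
    le_of_mainCond (hm.symm ▸ ha : (a, j) ∈ mainCond B) hm'
  have hjl : j ≤ l := by
    by_contra hlt
    have := clearKey_lt_of_lt (k := k) (k' := b) (not_le.mp hlt)
    omega
  -- The mirror operation reaches row `a` only if its main column `j` is at least `k̄`. If `j < l`,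
  -- the position hit is in the core; if `j = l`, it lies left of `k` and comes later in the order.
  have e2 : (if b = l.rev then (B : Mat T n F) a k.rev * c' else 0) = 0 := by
    split_ifs with hb
    · subst hb
      by_contra h0
      have hkr := hle _ (left_ne_zero_of_mul h0)
      have hne : l ≠ k.rev := fun h' => right_ne_zero_of_mul h0 (hc' h')
      rcases lt_or_eq_of_le hjl with h1 | rfl
      · exact hcore (mem_core_of_lt hi ha h1 hkl hkr hbj hp)
      · have : j.rev < k := by
          rw [← Fin.rev_lt_rev, Fin.rev_rev]
          exact lt_of_le_of_ne hkr hne.symm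
        have := clearKey_lt_of_lt_right j this
        omega
    · rfl
  have e3 : (if b = k then (B : Mat T n F) a k.rev * d else 0) = 0 := by
    split_ifs with hb
    · subst hb
      by_contra h0
      have hkr := hle _ (left_ne_zero_of_mul h0)
      have hl : l = l.rev := by
        by_contra hl; exact right_ne_zero_of_mul h0 (hd hl)
      have : l < b.rev := by rw [hl]; exact Fin.rev_lt_rev.mpr hkl
      exact absurd (hkr.trans hjl) (not_le.mpr this)
    · rfl
  have e4 : (if b = l.rev then (B : Mat T n F) a l * d' else 0) = 0 := by
    split_ifs with hb
    · subst hb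
      by_contra h0
      have hlj := le_antisymm hjl (hle _ (left_ne_zero_of_mul h0))
      have hk : k = k.rev := by
        by_contra hk; exact right_ne_zero_of_mul h0 (hd' hk)
      have : l.rev < k := by rw [hk]; exact Fin.rev_lt_rev.mpr hkl
      rw [hlj] at hkey
      have := clearKey_lt_of_lt_right l this
      omega
    · rfl
  rw [e2, e3, e4, add_zero, add_zero, add_zero]
  -- Since main columns are distinct, `i` is the only row with main column `l`; the other rows under
  -- consideration have smaller main column, hence zero in column `l`.
  by_cases hak : j = l ∧ b = k
  · obtain ⟨rfl, rfl⟩ := hak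
    have : a = i := congr_arg Prod.fst (hs _ ha _ hi rfl)
    rw [this, if_pos rfl, mul_neg, mul_div_cancel₀ _ hA0, add_neg_cancel]
  · have hlt : clearKey j b < clearKey l k := by
      rcases Nat.lt_succ_iff_lt_or_eq.mp hkey with h1 | h1
      · exact h1
      · exact absurd (clearKey_eq_iff.mp h1) hak
    rw [h a j b ha hp hbj hcore hlt, zero_add]
    split_ifs with hb
    · subst hb
      by_contra h0
      exact hak ⟨le_antisymm hjl (hle _ (left_ne_zero_of_mul h0)), rfl⟩
    · rfl

/-- Each `U`-orbit of matrices with a given staircase verge contains a core. -/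
lemma exists_core (hF : ringChar F ≠ 2) (θ : AddChar F ℂ) {A B : V T n F} (hA : verge A = A)
    (hs : IsStaircase A) (hB : verge B = A) :
    ∃ C ∈ coresWithVerge A, ∃ u ∈ sylowU T n F,
      charDot (bracket θ B) u = bracket θ C := by
  -- The induction runs through the values of `clearKey`, treating one noncore position at a time
  -- when its key is reached.
  have key : ∀ t : ℕ, ∃ C : V T n F, verge C = A ∧
      (∃ u ∈ sylowU T n F, charDot (bracket θ B) u = bracket θ C) ∧
      ∀ a j b, (a, j) ∈ mainCond A → (a, b) ∈ pUP T n → b < j → (a, b) ∉ core A →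
        clearKey j b < t → (C : Mat T n F) a b = 0 := by
    intro t
    induction t with
    | zero =>
      exact ⟨B, hB, ⟨1, one_mem _, by ext; simp [charDot_apply, dot_one]⟩, by simp⟩
    | succ t ih =>
      obtain ⟨C, hC, ⟨u, hu, hBC⟩, h⟩ := ih
      by_cases hex : ∃ i l k, (i, l) ∈ mainCond A ∧ (i, k) ∈ pUP T n ∧ k < l ∧
          (i, k) ∉ core A ∧ clearKey l k = t
      · obtain ⟨i, l, k, hi, hik, hkl, hc, rfl⟩ := hex
        obtain ⟨v, hv, hv'⟩ := exists_clear hF hs (hC.trans hA.symm) hi hik hkl hc h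
        refine ⟨act v C, (verge_act v C).trans hC, ⟨u * v, mul_mem hu hv, ?_⟩, hv'⟩
        rw [charDot_mul, hBC, charDot_bracket]
      · refine ⟨C, hC, ⟨u, hu, hBC⟩, fun a j b ha hp hbj hcore hkey => ?_⟩
        rcases Nat.lt_succ_iff_lt_or_eq.mp hkey with h1 | h1
        · exact h a j b ha hp hbj hcore h1
        · exact absurd ⟨a, j, b, ha, hp, hbj, hcore, h1⟩ hex
  obtain ⟨C, hC, hBC, h⟩ := key (dimN T n * dimN T n + dimN T n)
  have hm : mainCond C = mainCond A := mainCond_eq_of_verge_eq (hC.trans hA.symm)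
  refine ⟨C, ⟨⟨?_, ?_⟩, hC⟩, hBC⟩
  · unfold IsStaircase
    rw [hm]
    exact hs
  · rintro ⟨a, b⟩ hab
    rw [core_eq_of_mainCond_eq hm]
    by_contra hcore
    obtain ⟨j, hbj, ha⟩ := exists_mainCond hab
    rw [hm] at ha
    refine hab (h a j b ha (mem_pUP_of_ne_zero hab) (lt_of_le_of_ne hbj ?_) hcore ?_)
    · rintro rfl
      exact hcore (Or.inl ha)
    · have h1 := j.2
      have h2 := b.rev.2
      unfold clearKey
      nlinarith

/-! ### Separation of cores by the form. -/

lemma lt_of_mem_minorCond {A : V T n F} {i k : Fin (dimN T n)} (h : (i, k) ∈ minorCond A) :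
    k.val < n := by
  have h1 : tildeN T n ≤ k.rev.val := (Finset.mem_filter.mp h.2).2
  have := val_rev_add k
  have := dimN_eq T n
  omega

lemma lt_of_mem_core {A : V T n F} {i k : Fin (dimN T n)} (h : (i, k) ∈ core A)
    (h' : (i, k) ∉ mainCond A) : k.val < n := by
  rcases h with h | ⟨-, h⟩ | h
  · exact absurd h h'
  · exact lt_of_mem_minorCond h
  · obtain ⟨x, hx⟩ := h.2.2.1
    exact lt_of_mem_minorCond hx

lemma core_apply_eq_zero {A B : V T n F} (hA : verge A = A) (hB : B ∈ coresWithVerge A)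
    {i k : Fin (dimN T n)} (h : (i, k) ∉ core A) : (B : Mat T n F) i k = 0 := by
  by_contra h0
  have := hB.1.2 (i, k) h0
  rw [core_eq_of_mainCond_eq (mainCond_eq_of_verge_eq (hB.2.trans hA.symm))] at this
  exact h this

lemma verge_apply_eq_zero {A : V T n F} (hA : verge A = A)
    {i k : Fin (dimN T n)} (h : (i, k) ∉ mainCond A) : (A : Mat T n F) i k = 0 := by
  rw [← hA, verge_apply, if_neg h]

lemma core_apply_main {A B : V T n F} (hA : verge A = A) (hB : B ∈ coresWithVerge A)
    {i k : Fin (dimN T n)} (h : (i, k) ∈ mainCond A) :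
    (B : Mat T n F) i k = (A : Mat T n F) i k :=
  ((verge_eq_iff.mp (hB.2.trans hA.symm) i).2 k h).1

/-- The form of two rows of a core. -/
lemma core_form_apply {A B : V T n F} (hA : verge A = A) (hB : B ∈ coresWithVerge A)
    {i j a m : Fin (dimN T n)} (hi : (i, j) ∈ mainCond A) (ha : (a, m) ∈ mainCond A) :
    ((B : Mat T n F) * gram T n F * (B : Mat T n F).transpose) i a =
      ((A : Mat T n F) * gram T n F * (A : Mat T n F).transpose) i a +
      (B - A : Mat T n F) i m.rev * sgn T n F m.rev * (A : Mat T n F) a m +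
      (A : Mat T n F) i j * sgn T n F j * (B - A : Mat T n F) a j.rev := by
  -- A core differs from its verge only in the first `n` columns. These span a totally isotropic
  -- space, so the product of two rows of `B - A` vanishes and only the products with the verge
  -- remain.
  have hz : ∀ x y, (B - A : Mat T n F) x y ≠ 0 → y.val < n := by
    intro x y h
    by_cases hm : (x, y) ∈ mainCond A
    · rw [Matrix.sub_apply, core_apply_main hA hB hm, sub_self] at h
      exact absurd rfl h
    · by_cases hc : (x, y) ∈ core A
      · exact lt_of_mem_core hc hm
      · rw [Matrix.sub_apply, core_apply_eq_zero hA hB hc, verge_apply_eq_zero hA hm,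
          sub_zero] at h
        exact absurd rfl h
  have e : (B : Mat T n F) = A + (B - A : Mat T n F) := by abel
  generalize (B - A : Mat T n F) = C at hz e
  rw [e]
  simp only [mul_gram_mul_transpose_apply]
  have e1 : C i m.rev * sgn T n F m.rev * (A : Mat T n F) a m =
      ∑ k, C i k.rev * sgn T n F k.rev * (A : Mat T n F) a k := by
    rw [Finset.sum_eq_single m]
    · intro k _ hk
      rw [verge_apply_eq_zero hA fun h => hk (mainCond_unique h ha), mul_zero]
    · simp
  have e2 : (A : Mat T n F) i j * sgn T n F j * C a j.rev =
      ∑ k, (A : Mat T n F) i k.rev * sgn T n F k.rev * C a k := by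
    rw [Finset.sum_eq_single j.rev]
    · rw [Fin.rev_rev]
    · intro k _ hk
      rw [verge_apply_eq_zero hA fun h => hk (by rw [← mainCond_unique h hi, Fin.rev_rev]),
        zero_mul, zero_mul]
    · simp
  rw [e1, e2, ← Finset.sum_add_distrib, ← Finset.sum_add_distrib]
  refine Finset.sum_congr rfl fun k _ => ?_
  have e3 : C i k.rev * C a k = 0 := by
    by_contra h
    have h1 := hz _ _ (left_ne_zero_of_mul h)
    have h2 := hz _ _ (right_ne_zero_of_mul h)
    have := val_rev_add k
    have := dimN_eq T n
    rcases tildeN_eq T n with h | h <;> omega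
  simp only [Matrix.add_apply]
  linear_combination sgn T n F k.rev * e3

lemma lt_rev_of_mem_pUP {A : V T n F} {i j x : Fin (dimN T n)} (h : (i, j) ∈ mainCond A)
    (hx : j < x) {B : V T n F} (hB : verge B = verge A) :
    ∀ k, (B : Mat T n F) i k ≠ 0 → k < x := fun k hk =>
  lt_of_le_of_lt
    (le_of_mainCond ((mainCond_eq_of_verge_eq hB).symm ▸ h : (i, j) ∈ mainCond B) hk) hx

/-- A supplementary condition `(i, k)`, with the main conditions `(i, j)` and `(a, k̄)`. -/
lemma exists_of_mem_supplCond {A : V T n F} {i k : Fin (dimN T n)} (h : (i, k) ∈ supplCond A) :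
    ∃ j a, (i, j) ∈ mainCond A ∧ (a, k.rev) ∈ rightMain A ∧ j < k.rev ∧ a ≠ i ∧
      ((i, j) ∈ leftMain A ∧ j.val < tildeN T n ∨ k < j.rev) := by
  obtain ⟨h1, ⟨l, hl, hl'⟩, ⟨a, ha⟩, h2, h3⟩ := h
  simp only at hl hl' ha
  have hne : a ≠ i := by
    rintro rfl
    exact h2 ha
  rcases hl' with hl' | hl'
  · exact ⟨l.rev, a, hl'.1, ha, Fin.rev_lt_rev.mpr hl, hne, Or.inr (by rwa [Fin.rev_rev])⟩
  · have h4 : l.val < tildeN T n := (Finset.mem_filter.mp hl'.2).2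
    have h5 : tildeN T n ≤ k.rev.val := (Finset.mem_filter.mp ha.2).2
    exact ⟨l, a, hl'.1, ha, Fin.lt_def.mpr (by omega), hne, Or.inl ⟨hl', h4⟩⟩

/-- In the product of rows `i` and `a` of a core there are two unknown terms; this kills the one in
row `a`, so that the other can be read off. A minor condition at `(a, j̄)` would put a second main
condition into column `j`. A supplementary one would have to lie left of the minor condition `(a,
k)`, but `k < j̄`. -/
lemma core_apply_rev_eq_zero {A B : V T n F} (hA : verge A = A) (hs : IsStaircase A)
    (hB : B ∈ coresWithVerge A) {i j k a : Fin (dimN T n)}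
    (hi : (i, j) ∈ mainCond A) (ha : (a, k.rev) ∈ rightMain A) (hne : a ≠ i)
    (h : (i, j) ∈ leftMain A ∧ j.val < tildeN T n ∨ k < j.rev) :
    (B - A : Mat T n F) a j.rev = 0 := by
  rw [Matrix.sub_apply]
  by_cases hm : (a, j.rev) ∈ mainCond A
  · rw [core_apply_main hA hB hm, sub_self]
  rw [verge_apply_eq_zero hA hm, sub_zero]
  apply core_apply_eq_zero hA hB
  intro hc
  have hlt := lt_of_mem_core hc hm
  have hj := val_rev_add j
  have hN := dimN_eq T n
  have hkj : k < j.rev := by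
    rcases h with ⟨-, h⟩ | h
    · omega
    · exact h
  rcases hc with hc | ⟨-, hc⟩ | hc
  · exact hm hc
  · have h1 : (a, j.rev.rev) ∈ rightMain A := hc
    rw [Fin.rev_rev] at h1
    exact hne (congr_arg Prod.fst (hs _ h1.1 _ hi rfl))
  · obtain ⟨-, ⟨l, hl, hl' | hl'⟩, -⟩ := hc
    · have h1 := mainCond_unique hl'.1 ha.1
      simp only at h1 hl
      rw [Fin.rev_inj] at h1
      rw [h1] at hl
      exact absurd hkj (not_lt_of_gt hl)
    · have h1 := mainCond_unique hl'.1 ha.1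
      have h2 : l.val < tildeN T n := (Finset.mem_filter.mp hl'.2).2
      have h3 : tildeN T n ≤ k.rev.val := (Finset.mem_filter.mp ha.2).2
      rw [h1] at h2
      omega

/-- Different cores with the same verge lie in different `U`-orbits. -/
lemma core_unique (hF : ringChar F ≠ 2) {A B B' : V T n F} (hA : verge A = A)
    (hs : IsStaircase A) (hB : B ∈ coresWithVerge A) (hB' : B' ∈ coresWithVerge A)
    {u u' : TU T n F} (hu : u ∈ sylowU T n F) (hu' : u' ∈ sylowU T n F)
    (h : act u B = act u' B') : B = B' := by
  -- The invariant of the rows `i` and `a`, expanded for both cores; the part coming from the verge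
  -- alone is common to both sides.
  have hform : ∀ i j a m, (i, j) ∈ mainCond A → (a, m) ∈ mainCond A → j < a.rev → m < i.rev →
      (B - A : Mat T n F) i m.rev * sgn T n F m.rev * (A : Mat T n F) a m +
      (A : Mat T n F) i j * sgn T n F j * (B - A : Mat T n F) a j.rev =
      (B' - A : Mat T n F) i m.rev * sgn T n F m.rev * (A : Mat T n F) a m +
      (A : Mat T n F) i j * sgn T n F j * (B' - A : Mat T n F) a j.rev := by
    intro i j a m hi ha h1 h2
    have e1 := act_form_apply hu B (lt_rev_of_mem_pUP hi h1 (hB.2.trans hA.symm))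
      (lt_rev_of_mem_pUP ha h2 (hB.2.trans hA.symm))
    have e2 := act_form_apply hu' B' (lt_rev_of_mem_pUP hi h1 (hB'.2.trans hA.symm))
      (lt_rev_of_mem_pUP ha h2 (hB'.2.trans hA.symm))
    rw [h] at e1
    rw [e1, core_form_apply hA hB hi ha, core_form_apply hA hB' hi ha] at e2
    linear_combination e2
  apply Subtype.ext
  ext i k
  by_cases hm : (i, k) ∈ mainCond A
  · rw [core_apply_main hA hB hm, core_apply_main hA hB' hm]
  by_cases hc : (i, k) ∈ core A
  swap
  · rw [core_apply_eq_zero hA hB hc, core_apply_eq_zero hA hB' hc]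
  have hsub : (B - A : Mat T n F) i k = (B' - A : Mat T n F) i k →
      (B : Mat T n F) i k = (B' : Mat T n F) i k := by
    rw [Matrix.sub_apply, Matrix.sub_apply]
    exact fun h => sub_left_injective h
  apply hsub
  rcases hc with hc | ⟨hT, hc⟩ | hc
  · exact absurd hc hm
  · have hi : (i, k.rev) ∈ rightMain A := hc
    have hlt : k.rev < i.rev := by
      have h1 := mem_pUP_iff.mp hi.1.1
      have := val_rev_add i
      rw [Fin.lt_def]
      rcases h1.2 with h2 | h2
      · omega
      · exact absurd h2.1 hT
    -- At a minor condition, row `i` is paired with itself. The form is symmetric here, so the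
    -- unknown entry appears with the factor `2 A i k̄`; odd characteristic is used.
    have e := hform i k.rev i k.rev hi.1 hi.1 hlt hlt
    rw [Fin.rev_rev, sgn_of_ne hT, sgn_of_ne hT] at e
    have h2 : (2 : F) * (A : Mat T n F) i k.rev ≠ 0 :=
      mul_ne_zero (two_ne_zero_of_ringChar hF) hi.1.2.1
    apply mul_right_cancel₀ h2
    linear_combination e
  · obtain ⟨j, a, hi, ha, hjk, hne, hor⟩ := exists_of_mem_supplCond hc
    have hik := mem_pUP_iff.mp (Finset.mem_filter.mp hc.1).1
    have hak := mem_pUP_iff.mp ha.1.1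
    have hi' := val_rev_add i
    have ha' := val_rev_add a
    have hk' := val_rev_add k
    rw [Fin.lt_def] at hjk
    -- At a supplementary condition, row `i` is paired with the row `a` whose main condition is in
    -- column `k̄`.
    have e := hform i j a k.rev hi ha.1 (Fin.lt_def.mpr (by omega)) (Fin.lt_def.mpr (by omega))
    rw [core_apply_rev_eq_zero hA hs hB hi ha hne hor,
      core_apply_rev_eq_zero hA hs hB' hi ha hne hor, Fin.rev_rev, mul_zero, add_zero,
      add_zero] at e
    exact mul_right_cancel₀ (sgn_ne_zero _) (mul_right_cancel₀ ha.1.2.1 e)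

/-! ### Decomposition of the `Ũ`-orbit into `U`-orbits of cores. -/

lemma tildeOrbit_eq_iUnion (hF : ringChar F ≠ 2) (θ : AddChar F ℂ) {A : V T n F}
    (hA : verge A = A) (hs : IsStaircase A) :
    tildeOrbit θ A = ⋃ B ∈ coresWithVerge A, orbit θ B := by
  rw [tildeOrbit_eq_vergeSet θ hA hs]
  ext χ
  rw [Set.mem_iUnion₂]
  constructor
  · rintro ⟨B, hB, rfl⟩
    obtain ⟨C, hC, u, hu, h⟩ := exists_core hF θ hA hs (hB.trans hA)
    refine ⟨C, hC, u⁻¹, inv_mem hu, ?_⟩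
    rw [← h, ← charDot_mul, mul_inv_cancel]
    ext
    simp [charDot_apply, dot_one]
  · rintro ⟨B, hB, u, hu, rfl⟩
    exact ⟨act u B, (verge_act u B).trans (hB.2.trans hA.symm), charDot_bracket θ B u⟩

lemma pairwiseDisjoint_orbit (hF : ringChar F ≠ 2) {θ : AddChar F ℂ} (hθ : θ ≠ 1)
    {A : V T n F} (hA : verge A = A) (hs : IsStaircase A) :
    (coresWithVerge A).PairwiseDisjoint (orbit θ) := by
  intro B hB B' hB' hne
  rw [Function.onFun, Set.disjoint_left]
  rintro χ ⟨u, hu, rfl⟩ ⟨u', hu', h⟩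
  rw [charDot_bracket, charDot_bracket] at h
  exact hne (core_unique hF hA hs hB hB' hu hu' (bracket_injective hθ h))

/-! ### Linear independence of characters -/

lemma charSpan_iUnion {ι : Sort*} (X : ι → Set (AddChar (V T n F) ℂ)) :
    charSpan (⋃ i, X i) = ⨆ i, charSpan (X i) := by
  rw [charSpan, Set.image_iUnion, Submodule.span_iUnion]
  rfl

lemma linearIndependent_char [Finite F] :
    LinearIndependent ℂ (fun χ : AddChar (V T n F) ℂ => (χ : V T n F → ℂ)) :=
  have : Finite (V T n F) := Finite.of_injective _ Subtype.val_injective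
  AddChar.linearIndependent (V T n F) ℂ

/-- Disjoint parts of a linearly independent family span independent subspaces. -/
lemma iSupIndep_charSpan [Finite F] {ι : Type*} {X : ι → Set (AddChar (V T n F) ℂ)}
    (h : Pairwise (Function.onFun Disjoint X)) : iSupIndep fun i => charSpan (X i) := by
  intro i
  have : ⨆ j, ⨆ (_ : j ≠ i), charSpan (X j) = charSpan (⋃ j, ⋃ (_ : j ≠ i), X j) := by
    simp_rw [charSpan_iUnion]
  rw [this]
  refine linearIndependent_char.disjoint_span_image ?_
  rw [Set.disjoint_iUnion_right]
  intro j
  rw [Set.disjoint_iUnion_right]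
  exact fun hj => h hj.symm

/-! ### Modules generated by an eigenvector of a subgroup -/

section Induced

variable {G W : Type*} [Group G] [AddCommGroup W] [Module ℂ W]

lemma op_mul_apply (ρ : Representation ℂ Gᵐᵒᵖ W) (x y : G) (w : W) :
    ρ (op (x * y)) w = ρ (op y) (ρ (op x) w) := by
  rw [op_mul, map_mul, Module.End.mul_apply]

/-- The eigenvalues on a nonzero vector form a linear character automatically; so `χ` may be given
below as a bare function. -/
lemma eigenvalue_mul {ρ : Representation ℂ Gᵐᵒᵖ W} {H : Subgroup G} {χ : H → ℂ} {v : W}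
    (hv0 : v ≠ 0) (hv : ∀ h : H, ρ (op (h : G)) v = χ h • v) (a b : H) :
    χ (a * b) = χ a * χ b := by
  have h := hv (a * b)
  rw [Subgroup.coe_mul, op_mul_apply, hv, map_smul, hv, smul_smul] at h
  exact (smul_left_injective ℂ hv0 h).symm

lemma eigenvalue_one {ρ : Representation ℂ Gᵐᵒᵖ W} {H : Subgroup G} {χ : H → ℂ} {v : W}
    (hv0 : v ≠ 0) (hv : ∀ h : H, ρ (op (h : G)) v = χ h • v) : χ 1 = 1 := by
  have h := hv 1
  rw [Subgroup.coe_one, op_one, map_one, Module.End.one_apply] at h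
  exact smul_left_injective ℂ hv0 (by simpa using h.symm)

open Classical in
lemma sum_eq_card_mul_sum_out [Fintype G] (H : Subgroup G) [Fintype (G ⧸ H)] (f : G → ℂ)
    (hf : ∀ x, ∀ h ∈ H, f (x * h) = f x) :
    ∑ x, f x = Nat.card H * ∑ c : G ⧸ H, f c.out := by
  rw [← Equiv.sum_comp (Subgroup.groupEquivQuotientProdSubgroup (s := H)).symm f,
    Fintype.sum_prod_type, Finset.mul_sum]
  refine Finset.sum_congr rfl fun c _ => ?_
  have : ∀ h : H, f ((Subgroup.groupEquivQuotientProdSubgroup (s := H)).symm (c, h)) =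
      f c.out := by
    intro h
    have h1 : (Subgroup.groupEquivQuotientProdSubgroup (s := H)
        ((Subgroup.groupEquivQuotientProdSubgroup (s := H)).symm (c, h))).1 = c := by simp
    set y := (Subgroup.groupEquivQuotientProdSubgroup (s := H)).symm (c, h)
    have h2 : (QuotientGroup.mk y : G ⧸ H) = c := h1
    have h3 := QuotientGroup.leftRel_apply.mp (Quotient.exact (h2.trans c.out_eq.symm))
    rw [← hf y _ h3, mul_inv_cancel_left]
  rw [Finset.sum_congr rfl fun h _ => this h]
  simp

/-- A module which is generated by an eigenvector of a subgroup affords the induced character,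
if the translates of the eigenvector by coset representatives form a basis. -/
lemma trace_eq_inducedChar [Finite G] {ρ : Representation ℂ Gᵐᵒᵖ W} {H : Subgroup G}
    {χ : H → ℂ} {v : W} (hv : ∀ h : H, ρ (op (h : G)) v = χ h • v)
    (hli : LinearIndependent ℂ fun c : G ⧸ H => ρ (op c.out⁻¹) v)
    (hsp : Submodule.span ℂ (Set.range fun c : G ⧸ H => ρ (op c.out⁻¹) v) = ⊤) :
    Affords ρ (inducedChar H χ) := by
  classical
  intro g
  have : Fintype G := Fintype.ofFinite G
  have : Fintype (G ⧸ H) := Fintype.ofFinite _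
  have hv0 : v ≠ 0 := by
    intro h
    exact hli.ne_zero (QuotientGroup.mk 1) (by rw [h, map_zero])
  have hmul := eigenvalue_mul hv0 hv
  have hone := eigenvalue_one hv0 hv
  let b := Module.Basis.mk hli hsp.ge
  let f : G → ℂ := fun y => if h : y⁻¹ * g * y ∈ H then χ ⟨y⁻¹ * g * y, h⟩ else 0
  have hb : ∀ c, b c = ρ (op c.out⁻¹) v := fun c => by simp [b]
  have hdiag : ∀ c, b.repr (ρ (op g) (b c)) c = f c.out := by
    intro c
    -- The action of `g` permutes the lines spanned by the translates, taking that of `c` to that of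
    -- `c'`; a diagonal entry occurs only for `c' = c`, that is, when `c.out⁻¹ g c.out` lies in `H`.
    let c' : G ⧸ H := QuotientGroup.mk (g⁻¹ * c.out)
    have h1 : (c'.out)⁻¹ * (g⁻¹ * c.out) ∈ H :=
      QuotientGroup.leftRel_apply.mp (Quotient.exact (c'.out_eq.trans rfl))
    have h2 : (c.out⁻¹ * g) * c'.out ∈ H := by
      have := H.inv_mem h1
      simpa [mul_assoc] using this
    have h3 : ρ (op g) (b c) = χ ⟨_, h2⟩ • b c' := by
      rw [hb, hb, ← op_mul_apply, ← map_smul, ← hv, ← op_mul_apply]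
      simp [mul_assoc]
    rw [h3, map_smul, Module.Basis.repr_self, Finsupp.smul_apply, Finsupp.single_apply]
    simp only [f]
    by_cases hc : c' = c
    · rw [hc] at h2
      rw [if_pos hc, dif_pos h2]
      simp [hc]
    · rw [if_neg hc, dif_neg, smul_zero]
      intro h4
      apply hc
      rw [← c.out_eq]
      refine Quotient.sound (QuotientGroup.leftRel_apply.mpr ?_)
      simpa [mul_assoc] using h4
  have hf : ∀ x, ∀ h ∈ H, f (x * h) = f x := by
    intro x h hh
    simp only [f]
    have e : (x * h)⁻¹ * g * (x * h) = h⁻¹ * (x⁻¹ * g * x) * h := by group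
    by_cases hx : x⁻¹ * g * x ∈ H
    · have hx' : (x * h)⁻¹ * g * (x * h) ∈ H := by
        rw [e]; exact H.mul_mem (H.mul_mem (H.inv_mem hh) hx) hh
      rw [dif_pos hx, dif_pos hx']
      have e' : (⟨_, hx'⟩ : H) = ⟨h, hh⟩⁻¹ * ⟨_, hx⟩ * ⟨h, hh⟩ := Subtype.ext e
      rw [e', hmul, hmul, mul_right_comm, ← hmul, inv_mul_cancel, hone, one_mul]
    · rw [dif_neg hx, dif_neg]
      intro hx'
      apply hx
      rw [e] at hx'
      have := H.mul_mem (H.mul_mem hh hx') (H.inv_mem hh)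
      simpa [mul_assoc] using this
  rw [LinearMap.trace_eq_matrix_trace ℂ b, Matrix.trace, inducedChar, finsum_eq_sum_of_fintype,
    ← Equiv.sum_comp (Equiv.inv G)]
  have hsum : ∑ x : G, f x = Nat.card H * ∑ c : G ⧸ H, f c.out := sum_eq_card_mul_sum_out H f hf
  simp only [Equiv.inv_apply, inv_inv]
  rw [show (∑ x : G, if h : x⁻¹ * g * x ∈ H then χ ⟨x⁻¹ * g * x, h⟩ else 0) = ∑ x, f x from rfl,
    hsum, inv_mul_cancel_left₀ (Nat.cast_ne_zero.mpr Nat.card_pos.ne')]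
  refine Finset.sum_congr rfl fun c _ => ?_
  rw [Matrix.diag_apply, LinearMap.toMatrix_apply, hdiag]

end Induced

/-- Nonzero functions on a finite set with orthogonal pairs are linearly independent. -/
lemma linearIndependent_of_sum_mul_star_eq_zero {X κ : Type*} [Fintype X] {f : κ → X → ℂ}
    (h0 : ∀ c, f c ≠ 0) (h : ∀ c c', c ≠ c' → ∑ x, f c x * star (f c' x) = 0) :
    LinearIndependent ℂ f := by
  rw [linearIndependent_iff']
  intro s g hg c hc
  have h1 : ∑ x, (∑ c' ∈ s, g c' • f c') x * star (f c x) = 0 := by rw [hg]; simp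
  have h2 : ∑ x, (∑ c' ∈ s, g c' • f c') x * star (f c x) =
      g c * ∑ x, f c x * star (f c x) := by
    simp only [Finset.sum_apply, Pi.smul_apply, smul_eq_mul, Finset.sum_mul]
    rw [Finset.sum_comm, Finset.sum_eq_single c]
    · rw [Finset.mul_sum]
      exact Finset.sum_congr rfl fun x _ => mul_assoc _ _ _
    · intro c' _ hne
      simp_rw [mul_assoc]
      rw [← Finset.mul_sum, h c' c hne, mul_zero]
    · exact fun h => absurd hc h
  rw [h1] at h2
  refine (mul_eq_zero.mp h2.symm).resolve_right fun h3 => ?_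
  obtain ⟨x, hx⟩ := Function.ne_iff.mp (h0 c)
  have h4 : ∑ x, f c x * star (f c x) = ((∑ x, Complex.normSq (f c x) : ℝ) : ℂ) := by
    rw [Complex.ofReal_sum]
    exact Finset.sum_congr rfl fun x _ => Complex.mul_conj _
  rw [h4, Complex.ofReal_eq_zero, Finset.sum_eq_zero_iff_of_nonneg fun x _ =>
    Complex.normSq_nonneg _] at h3
  exact hx (Complex.normSq_eq_zero.mp (h3 x (Finset.mem_univ x)))

/-! ### The eigenvectors for elementary characters -/

/-- The affine action of `Ũ` on `V`, which induces the monomial action on functions. -/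
def affineAct (w : TU T n F) (B : V T n F) : V T n F := dot w B + cocycle w

lemma monomialRep_apply (u : TU T n F) (τ : V T n F → ℂ) (B : V T n F) :
    monomialRep T n F (op u) τ B = τ (affineAct u⁻¹ B) := rfl

lemma affineAct_apply (w : TU T n F) (B : V T n F) {a b : Fin (dimN T n)}
    (h : (a, b) ∈ pUP T n) :
    (affineAct w B : Mat T n F) a b = ∑ k, (B : Mat T n F) a k * toMat w k b + toMat w a b := by
  rw [affineAct, Submodule.coe_add, Matrix.add_apply, dot_apply, cocycle, proj_apply, proj_apply,
    if_pos h, if_pos h, Matrix.mul_apply]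

lemma affineAct_bijective (w : TU T n F) :
    Function.Bijective (affineAct w : V T n F → V T n F) := by
  have h : ∀ w : TU T n F, ∀ B, affineAct w⁻¹ (affineAct w B) = B := by
    intro w B
    have h1 := cocycle_mul w w⁻¹
    rw [mul_inv_cancel, cocycle_one] at h1
    rw [affineAct, affineAct, map_add, ← dot_mul, mul_inv_cancel, dot_one, add_assoc, ← h1,
      add_zero]
  refine ⟨Function.LeftInverse.injective (h w),
    Function.RightInverse.surjective (g := affineAct w⁻¹) ?_⟩
  intro B
  simpa using h w⁻¹ B

/-- The group permutes the points of `V`, so it preserves the standard inner product of functions.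
-/
lemma sum_monomialRep_mul_star [Fintype (V T n F)] (u : TU T n F) (τ σ : V T n F → ℂ) :
    ∑ B, monomialRep T n F (op u) τ B * star (monomialRep T n F (op u) σ B) =
      ∑ B, τ B * star (σ B) := by
  simp only [monomialRep_apply]
  exact Function.Bijective.sum_comp (affineAct_bijective u⁻¹) fun B => τ B * star (σ B)

/-- The last of the columns to the left of `p` which belong to `rho p`, plus one. -/
def rowBound (p : Pos T n) : ℕ := if p.2.val < tildeN T n then p.2.val else n

lemma rowBound_le (p : Pos T n) : rowBound p ≤ p.2.val := by
  unfold rowBound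
  split_ifs with h
  · exact le_rfl
  · rcases tildeN_eq T n with h' | h' <;> omega

lemma mem_rho_iff {p r : Pos T n} (hp : p ∈ pUP T n) : r ∈ rho p ↔ r ∈ pUP T n ∧
    ((r.1 = p.1 ∧ r.2.val < rowBound p) ∨
      (tildeN T n ≤ p.2.val ∧ r.1 = p.2.rev ∧ r.2.val < tildeN T n)) := by
  unfold rho rowBound
  by_cases h : p.2.val < tildeN T n
  · rw [if_pos (show p ∈ tril T n from Finset.mem_filter.mpr ⟨hp, h⟩), if_pos h, Finset.mem_filter, Fin.lt_def]
    simp [not_le.mpr h]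
  · rw [if_neg (show p ∉ tril T n from fun h' => h (Finset.mem_filter.mp h').2), if_neg h, Finset.mem_filter]
    simp [not_lt.mp h]

lemma row_mem_pUP {p : Pos T n} (hp : p ∈ pUP T n) {k : Fin (dimN T n)} (h : p.1 < k)
    (h' : k.val < rowBound p) : (p.1, k) ∈ pUP T n :=
  pUP_left hp h (Fin.le_def.mpr (h'.le.trans (rowBound_le p)))

/-- The part of `rho p` in row `p.2.rev` is the mirror image of a part of column `p.2`. Stated for
`u⁻¹`, the conditions concern precisely the entries which enter row `p.1` of `affineAct u⁻¹ B` up to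
column `p.2`. -/
lemma mem_elemSubgroup_iff (hF : ringChar F ≠ 2) {p : Pos T n} (hp : p ∈ pUP T n)
    (u : sylowU T n F) : u ∈ elemSubgroup F p ↔
      (∀ k, p.1 < k → k.val < rowBound p → toMat (u : TU T n F)⁻¹ p.1 k = 0) ∧
      (∀ l, p.1 < l → l < p.2 → rowBound p ≤ l.val → toMat (u : TU T n F)⁻¹ l p.2 = 0) := by
  have hp' := mem_pUP_iff.mp hp
  have h1 := val_rev_add p.1
  have h2 := val_rev_add p.2
  have hN := dimN_eq T n
  have hlow : ∀ l : Fin (dimN T n), l < p.2 → rowBound p ≤ l.val →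
      tildeN T n ≤ p.2.val ∧ l.rev.val < tildeN T n := by
    intro l hl hb
    rw [Fin.lt_def] at hl
    have h3 := val_rev_add l
    unfold rowBound at hb
    split_ifs at hb with h
    · omega
    · omega
  constructor
  · intro hu
    have hu' := (elemSubgroup F p).inv_mem hu
    rw [mem_elemSubgroup hF] at hu hu'
    refine ⟨fun k hk hkb => ?_, fun l hl hlp hlb => ?_⟩
    · exact hu' (p.1, k) ((mem_rho_iff hp).mpr ⟨row_mem_pUP hp hk hkb, Or.inl ⟨rfl, hkb⟩⟩)
    · rw [sylowU_inv_apply u.2]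
      obtain ⟨h3, h4⟩ := hlow l hlp hlb
      have h5 := val_rev_add l
      rw [Fin.lt_def] at hl hlp
      rw [hu (p.2.rev, l.rev), mul_zero]
      refine (mem_rho_iff hp).mpr ⟨mem_pUP_iff.mpr ⟨by omega, Or.inl (by omega)⟩,
        Or.inr ⟨h3, rfl, h4⟩⟩
  · rintro ⟨hu, hu'⟩
    rw [mem_elemSubgroup hF]
    intro r hr
    obtain ⟨hrP, ⟨hr1, hr2⟩ | ⟨hr0, hr1, hr2⟩⟩ := (mem_rho_iff hp).mp hr
    · let J : Finset (Pos T n) := (pUP T n).filter fun r => r.1 = p.1 ∧ r.2.val < rowBound p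
      have hJ : IsLeftClosed J := by
        refine ⟨Finset.filter_subset _ _, fun q hq k h1 h2 => ?_⟩
        rw [Finset.mem_filter] at hq ⊢
        exact ⟨pUP_left hq.1 h1 h2.le, hq.2.1, (Fin.lt_def.mp h2).trans hq.2.2⟩
      have h3 : u⁻¹ ∈ zeroSubgroup F J hJ := by
        intro q hq
        obtain ⟨hq0, hq1, hq2⟩ := Finset.mem_filter.mp hq
        have hq3 := (mem_pUP_iff.mp hq0).1
        rw [hq1] at hq3 ⊢
        exact hu q.2 hq3 hq2
      have h4 := (zeroSubgroup F J hJ).inv_mem h3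
      rw [inv_inv] at h4
      exact h4 r (Finset.mem_filter.mpr ⟨hrP, hr1, hr2⟩)
    · have hr3 := mem_pUP_iff.mp hrP
      have hr4 := val_rev_add r.2
      have hr1' := congr_arg Fin.val hr1
      by_cases hlt : p.1 < r.2.rev
      · have hb : rowBound p ≤ r.2.rev.val := by
          unfold rowBound
          rw [if_neg (not_lt.mpr hr0)]
          omega
        have h3 := hu' r.2.rev hlt (Fin.lt_def.mpr (by omega)) hb
        rw [sylowU_inv_apply u.2, Fin.rev_rev, ← hr1] at h3
        exact (mul_eq_zero.mp h3).resolve_left (mul_ne_zero (sgn_ne_zero _) (sgn_ne_zero _))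
      · rw [Fin.lt_def] at hlt
        omega

/-- A function on `V` which is an eigenvector of the elementary subgroup at the position `p`. -/
noncomputable def elemVec (θ : AddChar F ℂ) (p : Pos T n) (α : F) (B : V T n F) : ℂ :=
  open Classical in
  if ∀ k, p.1 < k → k.val < rowBound p → (B : Mat T n F) p.1 k = 0 then
    θ (-(α * (B : Mat T n F) p.1 p.2)) else 0

lemma elemVec_zero (θ : AddChar F ℂ) (p : Pos T n) (α : F) : elemVec θ p α 0 = 1 := by
  simp [elemVec]

/-- The leftmost nonzero entries of a row are moved by the corresponding entries of `w`. -/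
lemma affineAct_apply_of_zero {w : TU T n F} {B : V T n F} {p : Pos T n} (hp : p ∈ pUP T n)
    {k : Fin (dimN T n)} (hk : p.1 < k) (hkb : k.val < rowBound p)
    (h : ∀ m, p.1 < m → m < k → (B : Mat T n F) p.1 m = 0) :
    (affineAct w B : Mat T n F) p.1 k = (B : Mat T n F) p.1 k + toMat w p.1 k := by
  rw [affineAct_apply w B (row_mem_pUP hp hk hkb), Finset.sum_eq_single k]
  · rw [toMat_diag, mul_one]
  · intro m _ hm
    rcases lt_or_gt_of_ne hm with h1 | h1
    · rcases le_or_gt m p.1 with h2 | h2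
      · rw [coe_strict B p.1 m h2, zero_mul]
      · rw [h m h2 h1, zero_mul]
    · rw [toMat_lower w h1, mul_zero]
  · simp

/-- With `w = u⁻¹`, the affine map of `w` fixes the support of `elemVec`, a set of zeros in row
`p.1`. On it every term `B p.1 m * w m p.2` with `m ≠ p.2` vanishes, so the entry at `p` is shifted
by `w p.1 p.2 = -u p.1 p.2`. -/
lemma elemVec_eigen (hF : ringChar F ≠ 2) (θ : AddChar F ℂ) {p : Pos T n} (hp : p ∈ pUP T n)
    (α : F) (u : elemSubgroup F p) :
    resU (monomialRep T n F) (op (u : sylowU T n F)) (elemVec θ p α) =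
      θ (α * toMat ((u : sylowU T n F) : TU T n F) p.1 p.2) • elemVec θ p α := by
  have hu := u.2
  obtain ⟨h1, h2⟩ := (mem_elemSubgroup_iff hF hp _).mp hu
  rw [mem_elemSubgroup hF] at hu
  have hlt : p.1 < p.2 := Fin.lt_def.mpr (mem_pUP_iff.mp hp).1
  funext B
  change elemVec θ p α (affineAct ((u : sylowU T n F) : TU T n F)⁻¹ B) = _ * elemVec θ p α B
  set w : TU T n F := ((u : sylowU T n F) : TU T n F)⁻¹ with hw
  by_cases hB : ∀ k, p.1 < k → k.val < rowBound p → (B : Mat T n F) p.1 k = 0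
  · have hB' : ∀ k, p.1 < k → k.val < rowBound p → (affineAct w B : Mat T n F) p.1 k = 0 := by
      intro k hk hkb
      rw [affineAct_apply_of_zero hp hk hkb fun m hm hmk =>
        hB m hm ((Fin.lt_def.mp hmk).trans hkb), hB k hk hkb, h1 k hk hkb, add_zero]
    have e1 : (affineAct w B : Mat T n F) p.1 p.2 =
        (B : Mat T n F) p.1 p.2 + toMat w p.1 p.2 := by
      rw [affineAct_apply w B hp, Finset.sum_eq_single p.2]
      · rw [toMat_diag, mul_one]
      · intro m _ hm
        rcases lt_or_gt_of_ne hm with h3 | h3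
        · rcases le_or_gt m p.1 with h4 | h4
          · rw [coe_strict B p.1 m h4, zero_mul]
          · rcases lt_or_ge m.val (rowBound p) with h5 | h5
            · rw [hB m h4 h5, zero_mul]
            · rw [h2 m h4 h3 h5, mul_zero]
        · rw [toMat_lower w h3, mul_zero]
      · simp
    have e2 : toMat w p.1 p.2 = - toMat ((u : sylowU T n F) : TU T n F) p.1 p.2 := by
      have h3 : (toMat ((u : sylowU T n F) : TU T n F) * toMat w) p.1 p.2 = 0 := by
        rw [hw, toMat_mul_inv, Matrix.one_apply_ne hlt.ne]
      rw [Matrix.mul_apply, Finset.sum_eq_add p.1 p.2 hlt.ne] at h3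
      · rw [toMat_diag, toMat_diag, one_mul, mul_one] at h3
        exact eq_neg_of_add_eq_zero_left h3
      · rintro m - ⟨h4, h5⟩
        rcases lt_or_gt_of_ne h4 with h6 | h6
        · rw [toMat_lower _ h6, zero_mul]
        · rcases lt_or_gt_of_ne h5 with h7 | h7
          · rcases lt_or_ge m.val (rowBound p) with h8 | h8
            · rw [hu (p.1, m) ((mem_rho_iff hp).mpr ⟨row_mem_pUP hp h6 h8, Or.inl ⟨rfl, h8⟩⟩),
                zero_mul]
            · rw [h2 m h6 h7 h8, mul_zero]
          · rw [toMat_lower w h7, mul_zero]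
      · simp
      · simp
    rw [elemVec, elemVec, if_pos hB, if_pos hB', e1, e2, ← AddChar.map_add_eq_mul]
    congr 1
    ring
  -- Zeros of the image are traced back to zeros of `B` from left to right along the row.
  · have hB' : ¬ ∀ k, p.1 < k → k.val < rowBound p → (affineAct w B : Mat T n F) p.1 k = 0 := by
      intro h
      apply hB
      intro k
      induction k using WellFoundedLT.induction with
      | ind k ih =>
        intro hk hkb
        have h3 := affineAct_apply_of_zero (w := w) hp hk hkb fun m hm hmk =>
          ih m hmk hm ((Fin.lt_def.mp hmk).trans hkb)
        rw [h k hk hkb, h1 k hk hkb, add_zero] at h3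
        exact h3.symm
    rw [elemVec, elemVec, if_neg hB, if_neg hB', mul_zero]

/-- An element outside `U_{ij}` violates one of the two conditions of `mem_elemSubgroup_iff`. A
nonzero entry in the row separates the supports of the two functions. If only the condition on the
column fails, translating `B` along row `p.1` multiplies the summands by a nontrivial character. -/
lemma sum_elemVec_mul_star [Fintype (V T n F)] (hF : ringChar F ≠ 2) {θ : AddChar F ℂ}
    (hθ : θ ≠ 1) {p : Pos T n} (hp : p ∈ pUP T n) {α : F} (hα : α ≠ 0) {u : sylowU T n F}
    (hu : u ∉ elemSubgroup F p) :
    ∑ B, resU (monomialRep T n F) (op u) (elemVec θ p α) B * star (elemVec θ p α B) = 0 := by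
  classical
  change ∑ B, elemVec θ p α (affineAct (u : TU T n F)⁻¹ B) * star (elemVec θ p α B) = 0
  rw [mem_elemSubgroup_iff hF hp] at hu
  set w : TU T n F := (u : TU T n F)⁻¹
  by_cases h1 : ∀ k, p.1 < k → k.val < rowBound p → toMat w p.1 k = 0
  · have h2 : ∃ l, p.1 < l ∧ l < p.2 ∧ rowBound p ≤ l.val ∧ toMat w l p.2 ≠ 0 := by
      by_contra! h
      exact hu ⟨h1, h⟩
    obtain ⟨l, hl, hlp, hlb, hwl⟩ := h2
    have hlP : (p.1, l) ∈ pUP T n := pUP_left hp hl hlp.le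
    -- A shift by `t` at `(p.1, l)` is invisible to `elemVec` at `B`, since `rowBound p ≤ l < p.2`,
    -- but moves the entry at `p` of the image by `t * w l p.2`.
    have key : ∀ t B, elemVec θ p α (affineAct w (B + singleV (p.1, l) hlP t)) *
        star (elemVec θ p α (B + singleV (p.1, l) hlP t)) = θ (-(α * toMat w l p.2) * t) *
        (elemVec θ p α (affineAct w B) * star (elemVec θ p α B)) := by
      intro t B
      have e1 : ∀ k, (B + singleV (p.1, l) hlP t : V T n F).1 p.1 k =
          (B : Mat T n F) p.1 k + if k = l then t else 0 := by
        intro k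
        change (B : Mat T n F) p.1 k + Matrix.single p.1 l t p.1 k = _
        simp [Matrix.single_apply, eq_comm]
      have e2 : ∀ k, (p.1, k) ∈ pUP T n → (affineAct w (B + singleV (p.1, l) hlP t)).1 p.1 k =
          (affineAct w B : Mat T n F) p.1 k + t * toMat w l k := by
        intro k hk
        rw [affineAct_apply w _ hk, affineAct_apply w _ hk]
        simp only [e1, add_mul, Finset.sum_add_distrib, ite_mul, zero_mul, Finset.sum_ite_eq',
          Finset.mem_univ, if_true]
        ring
      have e3 : elemVec θ p α (B + singleV (p.1, l) hlP t) = elemVec θ p α B := by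
        unfold elemVec
        have : ∀ k, p.1 < k → k.val < rowBound p →
            (B + singleV (p.1, l) hlP t : V T n F).1 p.1 k = (B : Mat T n F) p.1 k := by
          intro k hk hkb
          rw [e1, if_neg, add_zero]
          rintro rfl
          omega
        rw [e1 p.2, if_neg hlp.ne', add_zero]
        exact if_congr (forall_congr' fun k => forall_congr' fun hk => forall_congr' fun hkb => by
          rw [this k hk hkb]) rfl rfl
      have e4 : elemVec θ p α (affineAct w (B + singleV (p.1, l) hlP t)) =
          θ (-(α * toMat w l p.2) * t) * elemVec θ p α (affineAct w B) := by
        unfold elemVec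
        have : ∀ k, p.1 < k → k.val < rowBound p →
            (affineAct w (B + singleV (p.1, l) hlP t)).1 p.1 k =
              (affineAct w B : Mat T n F) p.1 k := by
          intro k hk hkb
          rw [e2 k (row_mem_pUP hp hk hkb), toMat_lower w (Fin.lt_def.mpr (by omega)), mul_zero,
            add_zero]
        rw [e2 p.2 hp, mul_ite, mul_zero, ← AddChar.map_add_eq_mul]
        refine if_congr (forall_congr' fun k => forall_congr' fun hk => forall_congr' fun hkb => by
          rw [this k hk hkb]) ?_ rfl
        congr 1
        ring
      rw [e3, e4, mul_assoc]
    by_contra hne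
    apply mul_ne_zero hα hwl
    rw [← neg_eq_zero]
    apply eq_zero_of_forall_addChar_eq_one hθ
    intro t
    have h3 := Equiv.sum_comp (Equiv.addRight (singleV (p.1, l) hlP t : V T n F))
      fun B => elemVec θ p α (affineAct w B) * star (elemVec θ p α B)
    simp only [Equiv.coe_addRight, key] at h3
    rw [← Finset.mul_sum] at h3
    exact mul_right_cancel₀ hne (h3.trans (one_mul _).symm)
  · push Not at h1
    obtain ⟨k, hk, hkb, hwk⟩ := h1
    refine Finset.sum_eq_zero fun B _ => ?_
    by_cases hB : ∀ k, p.1 < k → k.val < rowBound p → (B : Mat T n F) p.1 k = 0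
    · have h2 := affineAct_apply_of_zero (w := w) hp hk hkb fun m hm hmk =>
        hB m hm ((Fin.lt_def.mp hmk).trans hkb)
      rw [hB k hk hkb, zero_add] at h2
      rw [elemVec, if_neg, zero_mul]
      intro h
      exact hwk (h2.symm.trans (h k hk hkb))
    · rw [elemVec, elemVec, if_neg hB, star_zero, mul_zero]

/-! ### Orbit modules of a single position and elementary characters. -/

instance finite_V [Finite F] : Finite (V T n F) := Finite.of_injective _ Subtype.val_injective

lemma singleV_coe (p : Pos T n) (hp : p ∈ pUP T n) (c : F) (a b : Fin (dimN T n)) :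
    (singleV p hp c : Mat T n F) a b = if p.1 = a ∧ p.2 = b then c else 0 :=
  Matrix.single_apply _ _ _ _ _

lemma mainCond_singleV {p : Pos T n} (hp : p ∈ pUP T n) {α : F} (hα : α ≠ 0) :
    mainCond (singleV p hp α) = {p} := by
  ext ⟨a, b⟩
  rw [Set.mem_singleton_iff]
  constructor
  · rintro ⟨-, h, -⟩
    rw [singleV_coe] at h
    by_contra h'
    exact h (if_neg fun h'' => h' (Prod.ext h''.1.symm h''.2.symm))
  · rintro rfl
    refine ⟨hp, ?_, fun k hk => ?_⟩
    · rw [singleV_coe, if_pos ⟨rfl, rfl⟩]; exact hα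
    · rw [singleV_coe, if_neg fun h => hk.ne h.2]

lemma verge_singleV {p : Pos T n} (hp : p ∈ pUP T n) {α : F} (hα : α ≠ 0) :
    verge (singleV p hp α) = singleV p hp α := by
  apply Subtype.ext
  ext a b
  rw [verge_apply, mainCond_singleV hp hα]
  split_ifs with h
  · rfl
  · rw [singleV_coe, if_neg fun h' => h (Prod.ext h'.1.symm h'.2.symm)]

lemma isStaircase_singleV {p : Pos T n} (hp : p ∈ pUP T n) {α : F} (hα : α ≠ 0) :
    IsStaircase (singleV p hp α) := by
  intro q hq r hr _
  rw [mainCond_singleV hp hα, Set.mem_singleton_iff] at hq hr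
  rw [hq, hr]

lemma verge_eq_singleV_iff {p : Pos T n} (hp : p ∈ pUP T n) {α : F} (hα : α ≠ 0)
    {B : V T n F} : verge B = singleV p hp α ↔ (∀ i k, i ≠ p.1 → (B : Mat T n F) i k = 0) ∧
      (B : Mat T n F) p.1 p.2 = α ∧ ∀ k, p.2 < k → (B : Mat T n F) p.1 k = 0 := by
  rw [← verge_singleV hp hα, verge_eq_iff, mainCond_singleV hp hα]
  constructor
  · intro h
    refine ⟨fun i k hi => (h i).1 (fun k => ?_) k, ?_, ((h p.1).2 p.2 rfl).2⟩
    · rw [singleV_coe, if_neg fun h => hi h.1.symm]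
    · rw [((h p.1).2 p.2 rfl).1, singleV_coe, if_pos ⟨rfl, rfl⟩]
  · rintro ⟨h1, h2, h3⟩ i
    refine ⟨fun h => ?_, fun j hj => ?_⟩
    · have hi : i ≠ p.1 := by
        rintro rfl
        have := h p.2
        rw [singleV_coe, if_pos ⟨rfl, rfl⟩] at this
        exact hα this
      exact fun k => h1 i k hi
    · rw [Set.mem_singleton_iff] at hj
      subst hj
      rw [singleV_coe, if_pos ⟨rfl, rfl⟩]
      exact ⟨h2, h3⟩

/-- The columns of `rho p` in the row of `p`. -/
def rowCols (p : Pos T n) : Finset (Fin (dimN T n)) :=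
  Finset.univ.filter fun k => p.1 < k ∧ k.val < rowBound p

lemma mem_rowCols {p : Pos T n} {k : Fin (dimN T n)} :
    k ∈ rowCols p ↔ p.1 < k ∧ k.val < rowBound p := by simp [rowCols]

lemma rowCols_mem_pUP {p : Pos T n} (hp : p ∈ pUP T n) (k : rowCols p) :
    (p.1, k.1) ∈ pUP T n :=
  row_mem_pUP hp (mem_rowCols.mp k.2).1 (mem_rowCols.mp k.2).2

/-- The elements of `V` with the entry `α` at `p` and entries `c` on its left. -/
def rowV {p : Pos T n} (hp : p ∈ pUP T n) (α : F) (c : rowCols p → F) : V T n F :=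
  singleV p hp α + ∑ k : rowCols p, singleV (p.1, k.1) (rowCols_mem_pUP hp k) (c k)

lemma verge_rowV {p : Pos T n} (hp : p ∈ pUP T n) {α : F} (hα : α ≠ 0) (c : rowCols p → F) :
    verge (rowV hp α c) = singleV p hp α := by
  have e : ∀ a b, (rowV hp α c : Mat T n F) a b = (if p.1 = a ∧ p.2 = b then α else 0) +
      ∑ k : rowCols p, if p.1 = a ∧ k.1 = b then c k else 0 := by
    intro a b
    rw [rowV, Submodule.coe_add, Matrix.add_apply, singleV_coe, Submodule.coe_sum,
      Matrix.sum_apply]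
    simp only [singleV_coe]
  have e2 : ∀ b, p.2 ≤ b → (∑ k : rowCols p, if p.1 = p.1 ∧ k.1 = b then c k else 0) = 0 := by
    intro b hb
    refine Finset.sum_eq_zero fun k _ => if_neg fun h => ?_
    have h1 := (mem_rowCols.mp k.2).2
    have h2 := rowBound_le p
    rw [h.2] at h1
    rw [Fin.le_def] at hb
    omega
  rw [verge_eq_singleV_iff hp hα]
  refine ⟨fun i k hi => ?_, ?_, fun k hk => ?_⟩
  · rw [e, if_neg fun h => hi h.1.symm, zero_add]
    exact Finset.sum_eq_zero fun _ _ => if_neg fun h => hi h.1.symm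
  · rw [e, if_pos ⟨rfl, rfl⟩, e2 _ le_rfl, add_zero]
  · rw [e, if_neg fun h => hk.ne h.2, e2 _ hk.le, add_zero]

lemma bracket_singleV (θ : AddChar F ℂ) {p : Pos T n} (hp : p ∈ pUP T n) (c : F) (B : V T n F) :
    bracket θ (singleV p hp c) B = θ (-(c * (B : Mat T n F) p.1 p.2)) := by
  rw [bracket_apply, kappa_comm, kappa_singleV, mul_comm]

lemma bracket_sum (θ : AddChar F ℂ) {ι : Type*} (s : Finset ι) (A : ι → V T n F) :
    bracket θ (∑ i ∈ s, A i) = ∏ i ∈ s, bracket θ (A i) := by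
  classical
  induction s using Finset.induction_on with
  | empty => rw [Finset.sum_empty, Finset.prod_empty, bracket_zero]
  | insert i s hi ih => rw [Finset.sum_insert hi, Finset.prod_insert hi, bracket_add, ih]

lemma sum_addChar_neg_mul [Fintype F] [DecidableEq F] {θ : AddChar F ℂ} (hθ : θ ≠ 1) (b : F) :
    ∑ c, θ (-(c * b)) = if b = 0 then (Fintype.card F : ℂ) else 0 := by
  have h := AddChar.sum_mulShift (-b) (AddChar.IsPrimitive.of_ne_one hθ)
  simp only [neg_eq_zero, mul_neg] at h
  rw [h]
  push_cast
  rfl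

/-- The Fourier expansion of the eigenvector. -/
lemma sum_bracket_rowV [Fintype F] {θ : AddChar F ℂ} (hθ : θ ≠ 1) {p : Pos T n}
    (hp : p ∈ pUP T n) (α : F) :
    ∑ c : rowCols p → F, (bracket θ (rowV hp α c) : V T n F → ℂ) =
      ((Fintype.card F : ℂ) ^ (rowCols p).card) • elemVec θ p α := by
  classical
  funext B
  have h1 : ∀ c : rowCols p → F, bracket θ (rowV hp α c) B =
      θ (-(α * (B : Mat T n F) p.1 p.2)) *
        ∏ k : rowCols p, θ (-(c k * (B : Mat T n F) p.1 k.1)) := by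
    intro c
    rw [rowV, bracket_add, bracket_sum, AddChar.mul_apply, bracket_singleV, AddChar.prod_apply]
    simp only [bracket_singleV]
  rw [Finset.sum_apply, Finset.sum_congr rfl fun c _ => h1 c, ← Finset.mul_sum,
    ← Fintype.prod_sum fun (k : rowCols p) (c : F) => θ (-(c * (B : Mat T n F) p.1 k.1))]
  simp only [sum_addChar_neg_mul hθ, Pi.smul_apply, smul_eq_mul]
  by_cases hB : ∀ k, p.1 < k → k.val < rowBound p → (B : Mat T n F) p.1 k = 0
  · rw [elemVec, if_pos hB, Finset.prod_congr rfl fun (k : rowCols p) _ =>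
      if_pos (hB k.1 (mem_rowCols.mp k.2).1 (mem_rowCols.mp k.2).2), Finset.prod_const,
      Finset.card_univ, Fintype.card_coe, mul_comm]
  · rw [elemVec, if_neg hB, mul_zero]
    push Not at hB
    obtain ⟨k, hk, hkb, h⟩ := hB
    rw [Finset.prod_eq_zero (Finset.mem_univ (⟨k, mem_rowCols.mpr ⟨hk, hkb⟩⟩ : rowCols p))
      (if_neg h), mul_zero]

/-- By `sum_bracket_rowV`, a nonzero multiple of `elemVec` is a sum of characters with verge `α
e_p`. -/
lemma elemVec_mem [Finite F] {θ : AddChar F ℂ} (hθ : θ ≠ 1) {p : Pos T n} (hp : p ∈ pUP T n)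
    {α : F} (hα : α ≠ 0) : elemVec θ p α ∈ charSpan (tildeOrbit θ (singleV p hp α)) := by
  have := Fintype.ofFinite F
  rw [tildeOrbit_eq_vergeSet θ (verge_singleV hp hα) (isStaircase_singleV hp hα)]
  have h0 : ((Fintype.card F : ℂ) ^ (rowCols p).card) ≠ 0 :=
    pow_ne_zero _ (Nat.cast_ne_zero.mpr Fintype.card_ne_zero)
  rw [← Submodule.smul_mem_iff _ h0, ← sum_bracket_rowV hθ hp]
  refine Submodule.sum_mem _ fun c _ => Submodule.subset_span ⟨_, ⟨rowV hp α c, ?_, rfl⟩, rfl⟩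
  rw [verge_rowV hp hα, verge_singleV hp hα]

/-- The `U`-module generated by the eigenvector of the elementary subgroup. -/
noncomputable def elemModule (θ : AddChar F ℂ) (p : Pos T n) (α : F) :
    Subrepresentation (resU (monomialRep T n F)) where
  toSubmodule := Submodule.span ℂ
    (Set.range fun u : sylowU T n F => resU (monomialRep T n F) (op u) (elemVec θ p α))
  apply_mem_toSubmodule g w hw := by
    induction hw using Submodule.span_induction with
    | mem w hw =>
      obtain ⟨u, rfl⟩ := hw
      refine Submodule.subset_span ⟨u * unop g, ?_⟩
      exact op_mul_apply _ u (unop g) _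
    | zero => rw [map_zero]; exact Submodule.zero_mem _
    | add x y _ _ hx hy => rw [map_add]; exact Submodule.add_mem _ hx hy
    | smul c x _ hx => rw [map_smul]; exact Submodule.smul_mem _ _ hx

lemma elemModule_le [Finite F] {θ : AddChar F ℂ} (hθ : θ ≠ 1) {p : Pos T n} (hp : p ∈ pUP T n)
    {α : F} (hα : α ≠ 0) :
    (elemModule θ p α).toSubmodule ≤ charSpan (tildeOrbit θ (singleV p hp α)) := by
  refine Submodule.span_le.mpr ?_
  rintro _ ⟨u, rfl⟩
  exact monomialRep_mem_charSpan θ ⊤ _ (Subgroup.mem_top _) (elemVec_mem hθ hp hα)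

lemma elemVec_ne_zero (θ : AddChar F ℂ) (p : Pos T n) (α : F) : elemVec θ p α ≠ 0 := fun h => by
  have := elemVec_zero θ p α
  rw [h] at this
  exact zero_ne_one this

/-- The product of the translates by `c⁻¹` and `c'⁻¹` equals that of the translate by `c⁻¹c'` and
the vector itself, which vanishes for different cosets. -/
lemma linearIndependent_elemVec [Finite F] (hF : ringChar F ≠ 2) {θ : AddChar F ℂ}
    (hθ : θ ≠ 1) {p : Pos T n} (hp : p ∈ pUP T n) {α : F} (hα : α ≠ 0) :
    LinearIndependent ℂ fun c : sylowU T n F ⧸ elemSubgroup F p =>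
      resU (monomialRep T n F) (op c.out⁻¹) (elemVec θ p α) := by
  have := Fintype.ofFinite (V T n F)
  apply linearIndependent_of_sum_mul_star_eq_zero
  · intro c h
    apply elemVec_ne_zero θ p α
    have h1 := op_mul_apply (resU (monomialRep T n F)) c.out⁻¹ c.out (elemVec θ p α)
    rw [h, map_zero, inv_mul_cancel, op_one, map_one] at h1
    exact h1
  · intro c c' hne
    have h1 : c.out⁻¹ * c'.out ∉ elemSubgroup F p := by
      intro h
      apply hne
      rw [← c.out_eq, ← c'.out_eq]
      exact Quotient.sound (QuotientGroup.leftRel_apply.mpr h)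
    have h2 := op_mul_apply (resU (monomialRep T n F)) (c.out⁻¹ * c'.out) c'.out⁻¹
      (elemVec θ p α)
    rw [mul_inv_cancel_right] at h2
    rw [h2]
    exact (sum_monomialRep_mul_star _ _ _).trans (sum_elemVec_mul_star hF hθ hp hα h1)

lemma affords_elemModule [Finite F] (hF : ringChar F ≠ 2) {θ : AddChar F ℂ}
    (hθ : θ ≠ 1) {p : Pos T n} (hp : p ∈ pUP T n) {α : F} (hα : α ≠ 0) :
    Affords (elemModule θ p α).toRepresentation (elemChar θ p α) := by
  let v : (elemModule θ p α).toSubmodule := ⟨elemVec θ p α, Submodule.subset_span ⟨1, by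
    change (resU (monomialRep T n F)) (op 1) _ = _
    rw [op_one, map_one, Module.End.one_apply]⟩⟩
  have hv : ∀ h : elemSubgroup F p,
      (elemModule θ p α).toRepresentation (op (h : sylowU T n F)) v =
        θ (α * toMat ((h : sylowU T n F) : TU T n F) p.1 p.2) • v := fun h =>
    Subtype.ext (elemVec_eigen hF θ hp α h)
  have hcoe : ∀ u : sylowU T n F, ((elemModule θ p α).toRepresentation (op u) v).1 =
      resU (monomialRep T n F) (op u) (elemVec θ p α) := fun u => rfl
  refine trace_eq_inducedChar (v := v) hv ?_ ?_
  · exact LinearIndependent.of_comp (elemModule θ p α).toSubmodule.subtype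
      (linearIndependent_elemVec hF hθ hp hα)
  · rw [eq_top_iff]
    rintro ⟨w, hw⟩ -
    set S := Submodule.span ℂ (Set.range fun c : sylowU T n F ⧸ elemSubgroup F p =>
      (elemModule θ p α).toRepresentation (op c.out⁻¹) v) with hS
    have h1 : (elemModule θ p α).toSubmodule ≤ S.map (elemModule θ p α).toSubmodule.subtype := by
      refine Submodule.span_le.mpr ?_
      rintro _ ⟨u, rfl⟩
      let c : sylowU T n F ⧸ elemSubgroup F p := QuotientGroup.mk u⁻¹
      have hc : c.out⁻¹ * u⁻¹ ∈ elemSubgroup F p :=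
        QuotientGroup.leftRel_apply.mp (Quotient.exact (c.out_eq.trans rfl))
      have hu : u = (c.out⁻¹ * u⁻¹)⁻¹ * c.out⁻¹ := by group
      refine ⟨(elemModule θ p α).toRepresentation (op u) v, ?_, hcoe u⟩
      rw [hu, op_mul_apply, hv ⟨_, (elemSubgroup F p).inv_mem hc⟩, map_smul]
      exact S.smul_mem _ (Submodule.subset_span ⟨c, rfl⟩)
    obtain ⟨x, hx, hxw⟩ := h1 hw
    have : x = ⟨w, hw⟩ := Subtype.ext hxw
    exact this ▸ hx

/-- Columns before `rowBound p` go to row `p.1`, the others are reflected into row `p.2.rev`. Off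
the antidiagonal these rows differ, so the map is injective; on the antidiagonal they coincide. -/
lemma card_Ioo_le_card_rho {p : Pos T n} (hp : p ∈ pUP T n) (h : p.2 ≠ p.1.rev) :
    (Finset.Ioo p.1 p.2).card ≤ (rho p).card := by
  have hp' := mem_pUP_iff.mp hp
  have h1 := val_rev_add p.1
  have h2 := val_rev_add p.2
  have hN := dimN_eq T n
  have hh : p.2.val ≠ p.1.rev.val := fun h' => h (Fin.ext h')
  refine Finset.card_le_card_of_injOn
    (fun k => if k.val < rowBound p then (p.1, k) else (p.2.rev, k.rev)) ?_ ?_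
  · intro k hk
    rw [Finset.coe_Ioo, Set.mem_Ioo, Fin.lt_def, Fin.lt_def] at hk
    have h3 := val_rev_add k
    simp only
    split_ifs with hb
    · exact (mem_rho_iff hp).mpr ⟨row_mem_pUP hp hk.1 hb, Or.inl ⟨rfl, hb⟩⟩
    · unfold rowBound at hb
      split_ifs at hb with h4
      · omega
      · exact (mem_rho_iff hp).mpr ⟨mem_pUP_iff.mpr (by omega),
          Or.inr ⟨by omega, rfl, by simp only; omega⟩⟩
  · intro k hk k' hk' hkk
    have hne : p.1 ≠ p.2.rev := fun h' => h (by rw [h', Fin.rev_rev])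
    simp only at hkk
    split_ifs at hkk with h3 h4 h4
    · exact congr_arg Prod.snd hkk
    · exact absurd (congr_arg Prod.fst hkk) hne
    · exact absurd (congr_arg Prod.fst hkk).symm hne
    · exact Fin.rev_injective (congr_arg Prod.snd hkk)

/-- A matrix with verge `α e_p` is determined by its entries strictly between the diagonal and `p`.
-/
lemma finrank_charSpan_singleV_le [Finite F] (θ : AddChar F ℂ) {p : Pos T n}
    (hp : p ∈ pUP T n) {α : F} (hα : α ≠ 0) :
    Module.finrank ℂ (charSpan (tildeOrbit θ (singleV p hp α))) ≤
      Nat.card F ^ (Finset.Ioo p.1 p.2).card := by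
  classical
  rw [tildeOrbit_eq_vergeSet θ (verge_singleV hp hα) (isStaircase_singleV hp hα)]
  let Y : Set (V T n F) := {B | verge B = singleV p hp α}
  have h1 : charSpan (vergeSet θ (singleV p hp α)) =
      Submodule.span ℂ (Set.range fun B : Y => (bracket θ B.1 : V T n F → ℂ)) := by
    unfold charSpan
    congr 1
    ext f
    constructor
    · rintro ⟨χ, ⟨B, hB, rfl⟩, rfl⟩
      exact ⟨⟨B, hB.trans (verge_singleV hp hα)⟩, rfl⟩
    · rintro ⟨⟨B, hB⟩, rfl⟩
      exact ⟨_, ⟨B, Eq.trans hB (verge_singleV hp hα).symm, rfl⟩, rfl⟩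
  have : Fintype Y := Fintype.ofFinite Y
  rw [h1]
  refine (finrank_range_le_card _).trans ?_
  let f : Y → (Finset.Ioo p.1 p.2 → F) := fun B k => (B.1 : Mat T n F) p.1 k.1
  have hf : Function.Injective f := by
    rintro ⟨B, hB⟩ ⟨B', hB'⟩ h
    obtain ⟨b1, b2, b3⟩ := (verge_eq_singleV_iff hp hα).mp hB
    obtain ⟨c1, c2, c3⟩ := (verge_eq_singleV_iff hp hα).mp hB'
    apply Subtype.ext
    apply Subtype.ext
    ext i k
    by_cases hi : i = p.1
    · subst hi
      rcases le_or_gt k p.1 with h2 | h2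
      · rw [coe_strict B _ _ h2, coe_strict B' _ _ h2]
      · rcases lt_trichotomy k p.2 with h3 | h3 | h3
        · exact congr_fun h ⟨k, Finset.mem_Ioo.mpr ⟨h2, h3⟩⟩
        · rw [h3, b2, c2]
        · rw [b3 k h3, c3 k h3]
    · rw [b1 i k hi, c1 i k hi]
  have h2 := Nat.card_le_card_of_injective f hf
  rw [Nat.card_fun, Nat.card_eq_fintype_card (α := Y),
    Nat.card_eq_fintype_card (α := Finset.Ioo p.1 p.2), Fintype.card_coe] at h2
  exact h2

lemma elemModule_eq [Finite F] (hF : ringChar F ≠ 2) {θ : AddChar F ℂ} (hθ : θ ≠ 1)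
    {p : Pos T n} (hp : p ∈ pUP T n) {α : F} (hα : α ≠ 0) (h : p.2 ≠ p.1.rev) :
    (elemModule θ p α).toSubmodule = charSpan (tildeOrbit θ (singleV p hp α)) := by
  have := Fintype.ofFinite (V T n F)
  have := Fintype.ofFinite (sylowU T n F ⧸ elemSubgroup F p)
  refine Submodule.eq_of_le_of_finrank_le (elemModule_le hθ hp hα) ?_
  -- With `q = |F|`, the dimension of the orbit module is at most `q ^ |Ioo| ≤ q ^ |rho p| ≤ [U :
  -- U_{ij}]`, and the last number bounds the dimension of `elemModule` from below.
  refine (finrank_charSpan_singleV_le θ hp hα).trans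
    ((Nat.pow_le_pow_right Nat.card_pos (card_Ioo_le_card_rho hp h)).trans
    ((card_le_index hF p).trans ?_))
  let f : sylowU T n F ⧸ elemSubgroup F p → (elemModule θ p α).toSubmodule := fun c =>
    ⟨resU (monomialRep T n F) (op c.out⁻¹) (elemVec θ p α), Submodule.subset_span ⟨_, rfl⟩⟩
  have hf : LinearIndependent ℂ f :=
    LinearIndependent.of_comp (elemModule θ p α).toSubmodule.subtype
      (linearIndependent_elemVec hF hθ hp hα)
  rw [Subgroup.index, Nat.card_eq_fintype_card]
  exact hf.fintype_card_le_finrank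

/-! ### Products of functions and tensor products -/

section Tensor

variable {ι : Type*} [Fintype ι]

lemma trace_piTensorProduct_map {W : ι → Type*} [∀ i, AddCommGroup (W i)] [∀ i, Module ℂ (W i)]
    [∀ i, FiniteDimensional ℂ (W i)] (f : ∀ i, W i →ₗ[ℂ] W i) :
    LinearMap.trace ℂ _ (PiTensorProduct.map f) = ∏ i, LinearMap.trace ℂ (W i) (f i) := by
  classical
  let b := fun i => Module.finBasis ℂ (W i)
  rw [LinearMap.trace_eq_matrix_trace ℂ (Basis.piTensorProduct b), Matrix.trace,
    Finset.prod_congr rfl fun i _ => LinearMap.trace_eq_matrix_trace ℂ (b i) (f i)]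
  simp only [Matrix.trace]
  rw [Fintype.prod_sum]
  refine Finset.sum_congr rfl fun p _ => ?_
  rw [Matrix.diag_apply, LinearMap.toMatrix_apply, Basis.piTensorProduct_apply,
    PiTensorProduct.map_tprod, Basis.piTensorProduct_repr_tprod_apply]
  exact Finset.prod_congr rfl fun i _ => by rw [Matrix.diag_apply, LinearMap.toMatrix_apply]

variable {X : Type*}

/-- The pointwise multiplication of functions. -/
noncomputable def mulMap (W : ι → Submodule ℂ (X → ℂ)) :
    PiTensorProduct ℂ (fun i => W i) →ₗ[ℂ] (X → ℂ) :=
  PiTensorProduct.lift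
    ((MultilinearMap.mkPiAlgebra ℂ ι (X → ℂ)).compLinearMap fun i => (W i).subtype)

lemma mulMap_tprod (W : ι → Submodule ℂ (X → ℂ)) (w : ∀ i, W i) :
    mulMap W (PiTensorProduct.tprod ℂ w) = ∏ i, (w i : X → ℂ) := by
  simp [mulMap]

/-- Composition with a map `σ` of the underlying set commutes with multiplication of functions. With
`σ` an affine action this is equivariance; with `σ = id` it handles inclusions of subspaces. -/
lemma mulMap_map (W W' : ι → Submodule ℂ (X → ℂ)) (g : ∀ i, W i →ₗ[ℂ] W' i) (σ : X → X)
    (h : ∀ i w x, (g i w : X → ℂ) x = (w : X → ℂ) (σ x)) (t : PiTensorProduct ℂ fun i => W i) :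
    mulMap W' (PiTensorProduct.map g t) = fun x => mulMap W t (σ x) := by
  have : mulMap W' ∘ₗ PiTensorProduct.map g = (LinearMap.funLeft ℂ ℂ σ) ∘ₗ mulMap W := by
    ext w x
    simp only [LinearMap.compMultilinearMap_apply, LinearMap.comp_apply,
      PiTensorProduct.map_tprod, mulMap_tprod, LinearMap.funLeft_apply, Finset.prod_apply, h]
  exact LinearMap.congr_fun this t

/-- Inclusions of subspaces split, so their tensor product is injective. -/
lemma mulMap_injective_of_le {W W' : ι → Submodule ℂ (X → ℂ)} (h : ∀ i, W i ≤ W' i)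
    (hW' : Function.Injective (mulMap W')) : Function.Injective (mulMap W) := by
  choose g hg using fun i => LinearMap.exists_leftInverse_of_injective
    (Submodule.inclusion (h i)) (LinearMap.ker_eq_bot.mpr (Submodule.inclusion_injective (h i)))
  intro s t hst
  have e : ∀ t, mulMap W' (PiTensorProduct.map (fun i => Submodule.inclusion (h i)) t) =
      mulMap W t := fun t => mulMap_map W W' _ id (fun _ _ _ => rfl) t
  rw [← e s, ← e t] at hst
  have h1 := congr_arg (PiTensorProduct.map g) (hW' hst)
  have h2 : PiTensorProduct.map g ∘ₗ PiTensorProduct.map (fun i => Submodule.inclusion (h i)) =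
      LinearMap.id := by
    rw [← PiTensorProduct.map_comp]
    simp only [hg]
    exact PiTensorProduct.map_id
  have h3 := fun t => LinearMap.congr_fun h2 t
  simp only [LinearMap.comp_apply, LinearMap.id_apply] at h3
  rwa [h3, h3] at h1

lemma range_mulMap_mono {W W' : ι → Submodule ℂ (X → ℂ)} (h : ∀ i, W i ≤ W' i) :
    LinearMap.range (mulMap W) ≤ LinearMap.range (mulMap W') := by
  rintro _ ⟨t, rfl⟩
  exact ⟨PiTensorProduct.map (fun i => Submodule.inclusion (h i)) t,
    mulMap_map W W' _ id (fun _ _ _ => rfl) t⟩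

lemma injective_of_linearIndependent_comp {M M' κ : Type*} [AddCommMonoid M] [Module ℂ M]
    [AddCommMonoid M'] [Module ℂ M'] (b : Module.Basis κ ℂ M) (f : M →ₗ[ℂ] M')
    (h : LinearIndependent ℂ (f ∘ b)) : Function.Injective f := by
  have e : f = Finsupp.linearCombination ℂ (f ∘ b) ∘ₗ b.repr.toLinearMap := by
    refine b.ext fun i => ?_
    simp
  rw [e, LinearMap.coe_comp]
  exact Function.Injective.comp (g := Finsupp.linearCombination ℂ (f ∘ b)) h b.repr.injective

end Tensor


/-! ### Products of spaces spanned by characters. -/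

/-- The basis of characters. -/
noncomputable def charBasis [Finite F] (X : Set (AddChar (V T n F) ℂ)) :
    Module.Basis X ℂ (charSpan X) :=
  (Module.Basis.span (linearIndependent_char.comp (Subtype.val : X → _) Subtype.val_injective)).map
    (LinearEquiv.ofEq _ _ (by
      rw [charSpan, Set.range_comp, Subtype.range_coe]))

lemma charBasis_apply [Finite F] (X : Set (AddChar (V T n F) ℂ)) (χ : X) :
    (charBasis X χ : V T n F → ℂ) = χ.1 := by
  simp [charBasis, Module.Basis.span_apply]

lemma coe_prod_addChar {ι : Type*} (s : Finset ι) (χ : ι → AddChar (V T n F) ℂ) :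
    ((∏ i ∈ s, χ i : AddChar (V T n F) ℂ) : V T n F → ℂ) = ∏ i ∈ s, (χ i : V T n F → ℂ) := by
  funext B
  rw [AddChar.prod_apply, Finset.prod_apply]

/-- Multiplication sends the tensor basis of characters to characters; if these are distinct, they
are linearly independent. -/
lemma mulMap_charSpan_injective [Finite F] {ι : Type*} [Fintype ι]
    (X : ι → Set (AddChar (V T n F) ℂ))
    (h : Function.Injective fun χ : ∀ i, X i => ∏ i, (χ i).1) :
    Function.Injective (mulMap fun i => charSpan (X i)) := by
  refine injective_of_linearIndependent_comp (Basis.piTensorProduct fun i => charBasis (X i)) _ ?_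
  have e : (mulMap fun i => charSpan (X i)) ∘ (Basis.piTensorProduct fun i => charBasis (X i)) =
      (fun χ : AddChar (V T n F) ℂ => (χ : V T n F → ℂ)) ∘
        fun χ : ∀ i, X i => ∏ i, (χ i).1 := by
    funext χ
    rw [Function.comp_apply, Basis.piTensorProduct_apply, mulMap_tprod, Function.comp_apply,
      coe_prod_addChar]
    simp only [charBasis_apply]
  rw [e]
  exact linearIndependent_char.comp _ h

lemma range_mulMap_charSpan [Finite F] {ι : Type*} [Fintype ι]
    (X : ι → Set (AddChar (V T n F) ℂ)) :
    LinearMap.range (mulMap fun i => charSpan (X i)) =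
      charSpan (Set.range fun χ : ∀ i, X i => ∏ i, (χ i).1) := by
  rw [LinearMap.range_eq_map, ← (Basis.piTensorProduct fun i => charBasis (X i)).span_eq,
    Submodule.map_span, ← Set.range_comp, charSpan, ← Set.range_comp]
  congr 2
  funext χ
  rw [Function.comp_apply, Basis.piTensorProduct_apply, mulMap_tprod, Function.comp_apply,
    coe_prod_addChar]
  simp only [charBasis_apply]

/-! ### Basic sets -/

section Basic

variable {D : Finset (Pos T n)} (Φ : ↥(D ∩ pUP T n) → Fˣ)

lemma mem_pUP_of_mem_inter (p : ↥(D ∩ pUP T n)) : p.1 ∈ pUP T n := (Finset.mem_inter.mp p.2).2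

lemma unitV_eq (p : ↥(D ∩ pUP T n)) :
    unitV D Φ p = singleV p.1 (mem_pUP_of_mem_inter p) (Φ p : F) := rfl

lemma basic_row_injective (hD : IsBasic D) {p q : ↥(D ∩ pUP T n)} (h : p.1.1 = q.1.1) : p = q :=
  Subtype.ext (hD.2.2.1 _ (Finset.mem_inter.mp p.2).1 _ (Finset.mem_inter.mp q.2).1 h)

lemma sum_row_apply (hD : IsBasic D) {B : ↥(D ∩ pUP T n) → V T n F}
    (hB : ∀ p i k, i ≠ p.1.1 → (B p : Mat T n F) i k = 0) (q : ↥(D ∩ pUP T n))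
    (k : Fin (dimN T n)) :
    ((∑ p, B p : V T n F) : Mat T n F) q.1.1 k = (B q : Mat T n F) q.1.1 k := by
  rw [Submodule.coe_sum, Matrix.sum_apply, Finset.sum_eq_single q]
  · exact fun p _ hp => hB p _ _ fun h => hp (basic_row_injective hD h.symm)
  · simp

lemma sum_row_apply_eq_zero {B : ↥(D ∩ pUP T n) → V T n F}
    (hB : ∀ p i k, i ≠ p.1.1 → (B p : Mat T n F) i k = 0) {i : Fin (dimN T n)}
    (hi : ∀ q : ↥(D ∩ pUP T n), i ≠ q.1.1) (k : Fin (dimN T n)) :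
    ((∑ p, B p : V T n F) : Mat T n F) i k = 0 := by
  rw [Submodule.coe_sum, Matrix.sum_apply]
  exact Finset.sum_eq_zero fun p _ => hB p i k (hi p)

lemma unitV_row (p : ↥(D ∩ pUP T n)) (i k : Fin (dimN T n)) (h : i ≠ p.1.1) :
    (unitV D Φ p : Mat T n F) i k = 0 := by
  rw [unitV_eq, singleV_coe, if_neg fun h' => h h'.1.symm]

lemma basicV_apply_row (hD : IsBasic D) (q : ↥(D ∩ pUP T n)) (k : Fin (dimN T n)) :
    (basicV D Φ : Mat T n F) q.1.1 k = if q.1.2 = k then (Φ q : F) else 0 := by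
  rw [basicV, sum_row_apply hD (unitV_row Φ), unitV_eq, singleV_coe]
  simp

lemma mainCond_basicV (hD : IsBasic D) :
    mainCond (basicV D Φ) = {p | p ∈ D ∩ pUP T n} := by
  ext ⟨i, k⟩
  constructor
  · rintro ⟨h1, h2, -⟩
    by_cases h : ∀ q : ↥(D ∩ pUP T n), i ≠ q.1.1
    · exact absurd (sum_row_apply_eq_zero (unitV_row Φ) h k) h2
    · push Not at h
      obtain ⟨q, rfl⟩ := h
      simp only at h2
      rw [basicV_apply_row Φ hD] at h2
      by_cases hk : q.1.2 = k
      · rw [← hk]; exact q.2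
      · exact absurd (if_neg hk) h2
  · intro h
    have h' : (i, k) ∈ D ∩ pUP T n := h
    have e := basicV_apply_row Φ hD ⟨_, h'⟩
    simp only at e
    refine ⟨(Finset.mem_inter.mp h').2, ?_, fun m hm => ?_⟩
    · simp only
      rw [e, if_pos rfl]
      exact (Φ _).ne_zero
    · simp only
      rw [e, if_neg hm.ne]

lemma verge_basicV (hD : IsBasic D) : verge (basicV D Φ) = basicV D Φ := by
  apply Subtype.ext
  ext i k
  rw [verge_apply]
  split_ifs with h
  · rfl
  · by_contra h0
    obtain ⟨j, hkj, hj⟩ := exists_mainCond (Ne.symm h0)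
    have hj' := hj
    rw [mainCond_basicV Φ hD] at hj'
    have e := basicV_apply_row Φ hD ⟨_, hj'⟩ k
    simp only at e
    rw [e] at h0
    by_cases hk : j = k
    · exact h (hk ▸ hj)
    · exact h0 (if_neg hk).symm

lemma isStaircase_basicV (hD : IsBasic D) : IsStaircase (basicV D Φ) := by
  intro p hp r hr h
  rw [mainCond_basicV Φ hD] at hp hr
  exact hD.2.2.2 _ (Finset.mem_inter.mp hp).1 _ (Finset.mem_inter.mp hr).1 h

/-- Legs are excluded since columns of `D` contain one position. A position of `D` in the arm at
`(i, j)` lies in row `j̄`, so it is `(j̄, ī)` by symmetry: outside `pUP` off the antidiagonal, and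
equal to `(i, j)` itself on it. -/
lemma isMainSeparated_of_mainCond_eq (hD : IsBasic D) {B : V T n F}
    (hB : mainCond B = {p | p ∈ D ∩ pUP T n}) : IsMainSeparated B := by
  rw [IsMainSeparated, Set.eq_empty_iff_forall_notMem]
  rintro r ⟨⟨p, hp, hr⟩, hr'⟩
  rw [hB] at hp hr'
  obtain ⟨hpD, hpP⟩ := Finset.mem_inter.mp hp
  obtain ⟨hrD, hrP⟩ := Finset.mem_inter.mp hr'
  rcases hr with ⟨-, h1, h2⟩ | ⟨-, h1, h2⟩
  · rw [hD.2.2.2 r hrD p hpD h1] at h2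
    exact lt_irrefl _ h2
  · have h3 := hD.2.2.1 r hrD _ ((hD.2.1 p).mp hpD) h1
    by_cases h4 : p.2 = p.1.rev
    · have := h2 h4
      rw [h3, ← h4] at this
      exact lt_irrefl _ this
    · rw [h3] at hrP
      have h5 := mem_pUP_iff.mp hpP
      have h6 := mem_pUP_iff.mp hrP
      have := val_rev_add p.1
      have := val_rev_add p.2
      have : p.2.val ≠ p.1.rev.val := fun h => h4 (Fin.ext h)
      omega

/-- The row of `p` of an element of `V`. -/
def rowPart (i : Fin (dimN T n)) (B : V T n F) : V T n F :=
  ⟨Matrix.of fun a b => if a = i then (B : Mat T n F) a b else 0, by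
    intro a b h
    simp [B.2 a b h]⟩

lemma rowPart_apply (i : Fin (dimN T n)) (B : V T n F) (a b : Fin (dimN T n)) :
    (rowPart i B : Mat T n F) a b = if a = i then (B : Mat T n F) a b else 0 := rfl

lemma verge_eq_unitV_iff (p : ↥(D ∩ pUP T n)) {B : V T n F} : verge B = unitV D Φ p ↔
    (∀ i k, i ≠ p.1.1 → (B : Mat T n F) i k = 0) ∧
      (B : Mat T n F) p.1.1 p.1.2 = Φ p ∧ ∀ k, p.1.2 < k → (B : Mat T n F) p.1.1 k = 0 :=
  verge_eq_singleV_iff (mem_pUP_of_mem_inter p) (Φ p).ne_zero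

lemma verge_eq_basicV_iff (hD : IsBasic D) {B : V T n F} : verge B = basicV D Φ ↔
    (∀ i, (∀ q : ↥(D ∩ pUP T n), i ≠ q.1.1) → ∀ k, (B : Mat T n F) i k = 0) ∧
      ∀ q : ↥(D ∩ pUP T n), (B : Mat T n F) q.1.1 q.1.2 = Φ q ∧
        ∀ k, q.1.2 < k → (B : Mat T n F) q.1.1 k = 0 := by
  rw [← verge_basicV Φ hD, verge_eq_iff, mainCond_basicV Φ hD]
  constructor
  · intro h
    refine ⟨fun i hi => (h i).1 (sum_row_apply_eq_zero (unitV_row Φ) hi), fun q => ?_⟩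
    have h1 := (h q.1.1).2 q.1.2 q.2
    rwa [basicV_apply_row Φ hD, if_pos rfl] at h1
  · rintro ⟨h1, h2⟩ i
    refine ⟨fun h0 => h1 i fun q hq => ?_, fun j hj => ?_⟩
    · subst hq
      have := h0 q.1.2
      rw [basicV_apply_row Φ hD, if_pos rfl] at this
      exact (Φ q).ne_zero this
    · have e := basicV_apply_row Φ hD ⟨(i, j), hj⟩ j
      simp only [if_true] at e
      rw [e]
      exact h2 ⟨(i, j), hj⟩

lemma tildeOrbit_unitV (θ : AddChar F ℂ) (p : ↥(D ∩ pUP T n)) :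
    tildeOrbit θ (unitV D Φ p) = vergeSet θ (unitV D Φ p) :=
  tildeOrbit_eq_vergeSet θ (verge_singleV (mem_pUP_of_mem_inter p) (Φ p).ne_zero)
    (isStaircase_singleV (mem_pUP_of_mem_inter p) (Φ p).ne_zero)

lemma verge_unitV (p : ↥(D ∩ pUP T n)) : verge (unitV D Φ p) = unitV D Φ p :=
  verge_singleV (mem_pUP_of_mem_inter p) (Φ p).ne_zero

/-- The product of the characters `[B p]` is `[∑ B p]`, where the `B p` occupy different rows and
can be recovered from the sum. -/
lemma prod_tildeOrbit_injective (hD : IsBasic D) {θ : AddChar F ℂ} (hθ : θ ≠ 1) :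
    Function.Injective fun χ : ∀ p, tildeOrbit θ (unitV D Φ p) => ∏ p, (χ p).1 := by
  intro χ χ' h
  have hex : ∀ χ : ∀ p, tildeOrbit θ (unitV D Φ p), ∃ B : ↥(D ∩ pUP T n) → V T n F,
      ∀ p, (∀ i k, i ≠ p.1.1 → (B p : Mat T n F) i k = 0) ∧ (χ p).1 = bracket θ (B p) := by
    intro χ
    have : ∀ p, ∃ B : V T n F,
        (∀ i k, i ≠ p.1.1 → (B : Mat T n F) i k = 0) ∧ (χ p).1 = bracket θ B := by
      intro p
      obtain ⟨B, hB, h⟩ := (tildeOrbit_unitV Φ θ p).le (χ p).2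
      exact ⟨B, ((verge_eq_unitV_iff Φ p).mp (hB.trans (verge_unitV Φ p))).1, h⟩
    choose B hB using this
    exact ⟨B, hB⟩
  obtain ⟨B, hB⟩ := hex χ
  obtain ⟨B', hB'⟩ := hex χ'
  simp only [(hB _).2, (hB' _).2, ← bracket_sum] at h
  have h1 := bracket_injective hθ h
  funext p
  apply Subtype.ext
  rw [(hB p).2, (hB' p).2]
  congr 1
  apply Subtype.ext
  ext i k
  by_cases hi : i = p.1.1
  · subst hi
    rw [← sum_row_apply hD (fun p => (hB p).1), ← sum_row_apply hD (fun p => (hB' p).1), h1]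
  · rw [(hB p).1 i k hi, (hB' p).1 i k hi]

/-- The verge is determined row by row, so a matrix with verge `A` is exactly a sum of single rows
with the verges `Φ(i,j) e_{ij}`. -/
lemma range_prod_tildeOrbit (hD : IsBasic D) (θ : AddChar F ℂ) :
    (Set.range fun χ : ∀ p, tildeOrbit θ (unitV D Φ p) => ∏ p, (χ p).1) =
      tildeOrbit θ (basicV D Φ) := by
  rw [tildeOrbit_eq_vergeSet θ (verge_basicV Φ hD) (isStaircase_basicV Φ hD)]
  ext ψ
  constructor
  · rintro ⟨χ, rfl⟩
    have : ∀ p, ∃ B : V T n F, verge B = unitV D Φ p ∧ (χ p).1 = bracket θ B := by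
      intro p
      obtain ⟨B, hB, h⟩ := (tildeOrbit_unitV Φ θ p).le (χ p).2
      exact ⟨B, hB.trans (verge_unitV Φ p), h⟩
    choose B hB hχ using this
    have hB' := fun p => (verge_eq_unitV_iff Φ p).mp (hB p)
    refine ⟨∑ p, B p, ?_, ?_⟩
    · rw [verge_basicV Φ hD, verge_eq_basicV_iff Φ hD]
      refine ⟨fun i hi => sum_row_apply_eq_zero (fun p => (hB' p).1) hi, fun q => ?_⟩
      simp only [sum_row_apply hD (fun p => (hB' p).1)]
      exact (hB' q).2
    · simp only [hχ, ← bracket_sum]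
  · rintro ⟨B, hB, rfl⟩
    rw [verge_basicV Φ hD, verge_eq_basicV_iff Φ hD] at hB
    have h1 : ∀ p : ↥(D ∩ pUP T n), verge (rowPart p.1.1 B) = unitV D Φ p := by
      intro p
      rw [verge_eq_unitV_iff]
      refine ⟨fun i k hi => if_neg hi, ?_, fun k hk => ?_⟩
      · rw [rowPart_apply, if_pos rfl, (hB.2 p).1]
      · rw [rowPart_apply, if_pos rfl, (hB.2 p).2 k hk]
    refine ⟨fun p => ⟨bracket θ (rowPart p.1.1 B), ?_⟩, ?_⟩
    · rw [tildeOrbit_unitV]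
      exact ⟨_, (h1 p).trans (verge_unitV Φ p).symm, rfl⟩
    · simp only [← bracket_sum]
      congr 1
      apply Subtype.ext
      ext i k
      by_cases h : ∀ q : ↥(D ∩ pUP T n), i ≠ q.1.1
      · rw [sum_row_apply_eq_zero (B := fun p => rowPart p.1.1 B) (fun p i k hi => if_neg hi) h,
          hB.1 i h]
      · push Not at h
        obtain ⟨q, rfl⟩ := h
        rw [sum_row_apply hD (B := fun p => rowPart p.1.1 B) (fun p i k hi => if_neg hi),
          rowPart_apply, if_pos rfl]

end Basic

/-! ### The André–Neto module and the supercharacters. -/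

lemma trace_eq_of_equiv {M M' : Type*} [AddCommMonoid M] [Module ℂ M] [AddCommMonoid M']
    [Module ℂ M'] (e : M ≃ₗ[ℂ] M') (f : M →ₗ[ℂ] M) (g : M' →ₗ[ℂ] M')
    (h : ∀ x, e (f x) = g (e x)) : LinearMap.trace ℂ M' g = LinearMap.trace ℂ M f := by
  -- Negation is supplied by the scalar `-1`.
  let := Module.addCommMonoidToAddCommGroup ℂ (M := M)
  let := Module.addCommMonoidToAddCommGroup ℂ (M := M')
  refine Eq.trans ?_ (LinearMap.trace_conj' f e)
  congr 1
  ext x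
  rw [LinearEquiv.conj_apply_apply, h, LinearEquiv.apply_symm_apply]

/-- Multiplication of functions is an isomorphism from the André–Neto module to the orbit
module. -/
noncomputable def mulEquiv [Finite F] {θ : AddChar F ℂ} (hθ : θ ≠ 1) {D : Finset (Pos T n)}
    (hD : IsBasic D) (Φ : ↥(D ∩ pUP T n) → Fˣ) :
    (PiTensorProduct ℂ fun p : ↥(D ∩ pUP T n) => (tildeOrbitModule θ (unitV D Φ p)).toSubmodule)
      ≃ₗ[ℂ] (tildeOrbitModule θ (basicV D Φ)).toSubmodule :=
  (LinearEquiv.ofInjective (mulMap fun p => (tildeOrbitModule θ (unitV D Φ p)).toSubmodule)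
    (mulMap_charSpan_injective _ (prod_tildeOrbit_injective Φ hD hθ))).trans
    (LinearEquiv.ofEq _ _ ((range_mulMap_charSpan _).trans
      (congr_arg charSpan (range_prod_tildeOrbit Φ hD θ))))

lemma mulEquiv_equivariant [Finite F] {θ : AddChar F ℂ} (hθ : θ ≠ 1) {D : Finset (Pos T n)}
    (hD : IsBasic D) (Φ : ↥(D ∩ pUP T n) → Fˣ) (g : (TU T n F)ᵐᵒᵖ)
    (t : PiTensorProduct ℂ
      fun p : ↥(D ∩ pUP T n) => (tildeOrbitModule θ (unitV D Φ p)).toSubmodule) :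
    mulEquiv hθ hD Φ (andreNetoModule θ D Φ g t) =
      (tildeOrbitModule θ (basicV D Φ)).toRepresentation g (mulEquiv hθ hD Φ t) :=
  Subtype.ext (mulMap_map _ _ _ (affineAct (unop g)⁻¹) (fun _ _ _ => rfl) t)

lemma trace_restrict_eq {M : Type*} [AddCommGroup M] [Module ℂ M] {S S' : Submodule ℂ M}
    (h : S = S') (f : M →ₗ[ℂ] M) (hS : ∀ x ∈ S, f x ∈ S) (hS' : ∀ x ∈ S', f x ∈ S') :
    LinearMap.trace ℂ S (f.restrict hS) = LinearMap.trace ℂ S' (f.restrict hS') := by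
  subst h
  rfl

/-- Without antidiagonal positions the restricted orbit module affords the supercharacter. -/
lemma affords_resU_tildeOrbitModule [Finite F] (hF : ringChar F ≠ 2) {θ : AddChar F ℂ}
    (hθ : θ ≠ 1) {D : Finset (Pos T n)} (hD : IsBasic D) (Φ : ↥(D ∩ pUP T n) → Fˣ)
    (h : ∀ p ∈ D ∩ pUP T n, p.2 ≠ p.1.rev) :
    Affords (resU (tildeOrbitModule θ (basicV D Φ)).toRepresentation) (superChar θ D Φ) := by
  intro u
  have h1 := trace_eq_of_equiv (mulEquiv hθ hD Φ) (andreNetoModule θ D Φ (op (u : TU T n F)))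
    ((tildeOrbitModule θ (basicV D Φ)).toRepresentation (op (u : TU T n F)))
    (mulEquiv_equivariant hθ hD Φ (op (u : TU T n F)))
  -- Both sides are products over `D ∩ pUP`, and each factor is an elementary character, because off
  -- the antidiagonal `elemModule` is the whole orbit module.
  refine h1.trans ((trace_piTensorProduct_map _).trans (Finset.prod_congr rfl fun p _ => ?_))
  rw [← affords_elemModule hF hθ (mem_pUP_of_mem_inter p) (Φ p).ne_zero u]
  exact trace_restrict_eq
    (elemModule_eq hF hθ (mem_pUP_of_mem_inter p) (Φ p).ne_zero (h p.1 p.2)).symm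
    (monomialRep T n F (op (u : TU T n F)))
    (fun _ hx => (tildeOrbitModule θ (unitV D Φ p)).apply_mem_toSubmodule _ hx)
    fun _ hx => (elemModule θ p.1 (Φ p : F)).apply_mem_toSubmodule (op u) hx

/-- In general a direct summand affords the supercharacter. -/
lemma exists_summand_affords [Finite F] (hF : ringChar F ≠ 2) {θ : AddChar F ℂ}
    (hθ : θ ≠ 1) {D : Finset (Pos T n)} (hD : IsBasic D) (Φ : ↥(D ∩ pUP T n) → Fˣ) :
    ∃ W W' : Subrepresentation (resU (tildeOrbitModule θ (basicV D Φ)).toRepresentation),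
      IsCompl W W' ∧ Affords W.toRepresentation (superChar θ D Φ) := by
  let E : ↥(D ∩ pUP T n) → Submodule ℂ (V T n F → ℂ) := fun p =>
    (elemModule θ p.1 (Φ p : F)).toSubmodule
  have hE : ∀ p, E p ≤ charSpan (tildeOrbit θ (unitV D Φ p)) := fun p =>
    elemModule_le hθ (mem_pUP_of_mem_inter p) (Φ p).ne_zero
  have hinj : Function.Injective (mulMap E) := mulMap_injective_of_le hE
    (mulMap_charSpan_injective _ (prod_tildeOrbit_injective Φ hD hθ))
  have hrange : ∀ t, mulMap E t ∈ (tildeOrbitModule θ (basicV D Φ)).toSubmodule := fun t =>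
    ((range_mulMap_charSpan _).trans (congr_arg charSpan (range_prod_tildeOrbit Φ hD θ))).le
      (range_mulMap_mono hE ⟨t, rfl⟩)
  let f := (mulMap E).codRestrict _ hrange
  have hf : Function.Injective f := fun s t hst => hinj (congr_arg Subtype.val hst)
  let ρ : Representation ℂ (sylowU T n F)ᵐᵒᵖ (PiTensorProduct ℂ fun p => E p) :=
    tensorRep fun p => (elemModule θ p.1 (Φ p : F)).toRepresentation
  have hequiv : ∀ g t, f (ρ g t) =
      resU (tildeOrbitModule θ (basicV D Φ)).toRepresentation g (f t) := fun g t =>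
    Subtype.ext (mulMap_map E E _ (affineAct ((unop g : sylowU T n F) : TU T n F)⁻¹)
      (fun _ _ _ => rfl) t)
  -- The summand is the image under multiplication of the tensor product of the elementary modules.
  let W : Subrepresentation (resU (tildeOrbitModule θ (basicV D Φ)).toRepresentation) :=
    { toSubmodule := LinearMap.range f
      apply_mem_toSubmodule := by
        rintro g _ ⟨t, rfl⟩
        exact ⟨ρ g t, hequiv g t⟩ }
  -- Maschke's theorem for the finite group `U` provides the complement.
  have : Finite (sylowU T n F)ᵐᵒᵖ := Finite.of_equiv _ MulOpposite.opEquiv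
  have : NeZero (Nat.card (sylowU T n F)ᵐᵒᵖ : ℂ) := ⟨Nat.cast_ne_zero.mpr Nat.card_pos.ne'⟩
  have hss : Representation.IsSemisimpleRepresentation
    (resU (tildeOrbitModule θ (basicV D Φ)).toRepresentation) := inferInstance
  obtain ⟨W', hW'⟩ := hss.exists_isCompl W
  refine ⟨W, W', hW', fun u => ?_⟩
  have h1 := trace_eq_of_equiv (LinearEquiv.ofInjective f hf) (ρ (op u))
    (W.toRepresentation (op u)) fun t => Subtype.ext (hequiv (op u) t)
  refine h1.trans ((trace_piTensorProduct_map _).trans (Finset.prod_congr rfl fun p _ => ?_))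
  exact affords_elemModule hF hθ (mem_pUP_of_mem_inter p) (Φ p).ne_zero u

end ClassicalUnipotent

open ClassicalUnipotent
theorem mainTheorem6 (T : ClassicalType) (n : ℕ) {F : Type*} [Field F] [Finite F]
    (hF : ringChar F ≠ 2) (θ : AddChar F ℂ) (hθ : θ ≠ 1)
    (D : Finset (Pos T n)) (hne : D.Nonempty) (hD : IsBasic D)
    (Φ : ↥(D ∩ pUP T n) → Fˣ) :
    -- the supercharacter is afforded by the restricted orbit module
    ((∀ p ∈ D ∩ pUP T n, p.2 ≠ p.1.rev) →
      Affords (resU (tildeOrbitModule θ (basicV D Φ)).toRepresentation) (superChar θ D Φ)) ∧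
    -- or by a direct summand of it
    ((∃ i, (i, i.rev) ∈ D) →
      ∃ W W' : Subrepresentation (resU (tildeOrbitModule θ (basicV D Φ)).toRepresentation),
        IsCompl W W' ∧ Affords W.toRepresentation (superChar θ D Φ)) ∧
    -- `[A]` is a main separated verge, and so are all cores with this verge main separated
    (verge (basicV D Φ) = basicV D Φ ∧ IsMainSeparated (basicV D Φ) ∧
      ∀ B ∈ coresWithVerge (basicV D Φ), IsMainSeparated B) ∧
    -- the `Ũ`-orbit is the disjoint union of the `U`-orbits of these cores
    (tildeOrbit θ (basicV D Φ) = ⋃ B ∈ coresWithVerge (basicV D Φ), orbit θ B ∧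
      (coresWithVerge (basicV D Φ)).PairwiseDisjoint (orbit θ)) ∧
    -- the direct sum decomposition into `U`-orbit modules
    ((tildeOrbitModule θ (basicV D Φ)).toSubmodule = charSpan (vergeSet θ (basicV D Φ)) ∧
      charSpan (vergeSet θ (basicV D Φ)) =
        ⨆ B : coresWithVerge (basicV D Φ), (orbitModule θ B.1).toSubmodule ∧
      iSupIndep fun B : coresWithVerge (basicV D Φ) => (orbitModule θ B.1).toSubmodule) ∧
    -- the orbit module is the André–Neto module
    Nonempty (Representation.Equiv (andreNetoModule θ D Φ)
      (tildeOrbitModule θ (basicV D Φ)).toRepresentation) := by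
  have hv := verge_basicV Φ hD
  have hs := isStaircase_basicV Φ hD
  have hm := mainCond_basicV Φ hD
  have hunion := tildeOrbit_eq_iUnion hF θ hv hs
  have hdisj := pairwiseDisjoint_orbit hF hθ hv hs
  have hset := tildeOrbit_eq_vergeSet θ hv hs
  refine ⟨affords_resU_tildeOrbitModule hF hθ hD Φ, fun _ => exists_summand_affords hF hθ hD Φ,
    ⟨hv, isMainSeparated_of_mainCond_eq hD hm, fun B hB => isMainSeparated_of_mainCond_eq hD
      ((mainCond_eq_of_verge_eq (hB.2.trans hv.symm)).trans hm)⟩,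
    ⟨hunion, hdisj⟩, ⟨congr_arg charSpan hset, ?_, ?_⟩, ⟨Representation.Equiv.mk
      (mulEquiv hθ hD Φ) fun g => LinearMap.ext (mulEquiv_equivariant hθ hD Φ g)⟩⟩
  · rw [← hset, hunion, Set.biUnion_eq_iUnion, charSpan_iUnion]
    rfl
  · refine iSupIndep_charSpan fun B B' hne => ?_
    exact hdisj B.2 B'.2 fun h => hne (Subtype.ext h)
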